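/- **Setting.** Let $L,T,\epsilon,M>0$, $C_0\in\mathbb R$, $F\in C^2(\mathbb R)$, $\Omega=(0,L)^2$, and let $\phi$ be a solution on $[0,T]$, $L$-periodic in both space variables, of the Allen–Cahn type equation $$\partial_t\phi=-M\mu,\qquad \mu=-\epsilon^2\Delta\phi+F'(\phi)$$ (the equation holds pointwise: $\phi(t)$ is $C^2$ in space for every $t\in[0,T]$, and $\phi$ is differentiable in time, one-sidedly at $t=0,T$). Assume $$\phi\in W^{2,\infty}(0,T;L^2(\Omega))\cap W^{1,\infty}(0,T;W^{2,2}(\Omega))\cap L^\infty(0,T;W^{4,\infty}(\Omega)),$$ with periodic Sobolev spaces. Put $E(u)=\frac{\epsilon^2}{2}\int_\Omega|\nabla u|^2+\int_\Omega F(u)$ and $R(t)=E(\phi(t))+C_0$, and assume $R(t)>0$ for $t\in[0,T]$. Write $R^0=R(0)$. **Grid.** For integers $N_{xy},N\ge 1$ let $h=L/N_{xy}$, $\Delta t=T/N$, $t^n=n\Delta t$. For grid functions $u=(u_{i,j})$, $N_{xy}$-periodic in $i$ and in $j$, let $$\Delta_hu_{i,j}=h^{-2}(u_{i+1,j}+u_{i,j+1}+u_{i-1,j}+u_{i,j-1}-4u_{i,j}),\qquad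 (u,v)_m=h^2\sum_{i,j=1}^{N_{xy}}u_{i,j}v_{i,j},\qquad \|u\|_m^2=(u,u)_m,$$ $$\|\nabla_hu\|_{TM}^2=h^2\sum_{i,j=1}^{N_{xy}}\Big[\Big(\tfrac{u_{i+1,j}-u_{i,j}}{h}\Big)^2+\Big(\tfrac{u_{i,j+1}-u_{i,j}}{h}\Big)^2\Big],\qquad E_h(u)=\tfrac{\epsilon^2}{2}\|\nabla_hu\|_{TM}^2+h^2\sum_{i,j=1}^{N_{xy}}F(u_{i,j}).$$ **Scheme.** Let $s\in\mathbb R$. A solution of the first-order fully discrete PS-SAV scheme with stabilizing constant $s$ consists of grid functions $\phi_h^n,\mu_h^n$ and numbers $R_h^n$ such that $\phi_h^0$ is the restriction of $\phi(0)$ to the nodes $(ih,jh)$, $R_h^0=R^0$ and, for $0\le n<N$, $R_h^{n+1}>0$ (the positive root of the quadratic equation that determines $R_h^{n+1}$) and $$\frac{\phi_h^{n+1}-\phi_h^n}{\Delta t}=-M\mu_h^{n+1},\qquad \mu_h^{n+1}=-s\epsilon^2(\Delta_h\phi_h^{n+1}-\Delta_h\phi_h^n)+\frac{R_h^{n+1}}{E_h(\phi_h^n)+C_0}\big[-\epsilon^2\Delta_h\phi_h^n+F'(\phi_h^n)\big],$$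 $$\frac{R_h^{n+1}-R_h^n}{\Delta t}=-\frac1M\Big\|\frac{\phi_h^{n+1}-\phi_h^n}{\Delta t}\Big\|_m^2 .$$ Write $e_\phi^n=\phi_h^n-\phi(t^n)$ (at the nodes), $d_te_\phi^{n+1}=(e_\phi^{n+1}-e_\phi^n)/\Delta t$ and $e_R^n=R_h^n-R(t^n)$. **Theorem.** Let $K_1>0$ and $s\ge \frac{R^0}{2K_1}$. There is a constant $C>0$, independent of $h$ and $\Delta t$, such that for all $N_{xy},N\ge1$, every solution of the scheme for which $K_1$ is a lower bound of the discrete energies, $E_h(\phi_h^n)+C_0\ge K_1$ for $0\le n<N$, satisfies for all $0\le k<N$ $$\sum_{n=1}^{k}\Delta t\,\|d_te_\phi^{n+1}\|_m^2+\|\nabla_he_\phi^{k+1}\|_{TM}^2+\|e_\phi^{k+1}\|_m^2+|e_R^{k+1}|^2\le C\,(h^4+\Delta t^2).$$ In particular the scheme is first order in time and second order in space in the discrete $l^\infty(0,T;H^1)$ norm. -/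

import Mathlib

open MeasureTheory Set

noncomputable section

namespace PSSAV

/-! ### The periodic square and weak derivatives -/

/-- The square `Ω = (0, L) × (0, L)`. -/
def square (L : ℝ) : Set (ℝ × ℝ) := Ioo 0 L ×ˢ Ioo 0 L

/-- Lebesgue measure on `Ω`. -/
def vol (L : ℝ) : Measure (ℝ × ℝ) := volume.restrict (square L)

/-- `f` is `L`-periodic in each of the two space variables. -/
def IsPeriodic (L : ℝ) (f : ℝ × ℝ → ℝ) : Prop :=
  ∀ x y : ℝ, f (x + L, y) = f (x, y) ∧ f (x, y + L) = f (x, y)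

/-- Classical partial derivative in the first variable. -/
def dX (f : ℝ × ℝ → ℝ) (p : ℝ × ℝ) : ℝ := fderiv ℝ f p (1, 0)

/-- Classical partial derivative in the second variable. -/
def dY (f : ℝ × ℝ → ℝ) (p : ℝ × ℝ) : ℝ := fderiv ℝ f p (0, 1)

/-- Classical Laplacian. -/
def laplace (f : ℝ × ℝ → ℝ) (p : ℝ × ℝ) : ℝ := dX (dX f) p + dY (dY f) p

/-- `g` is the weak derivative `∂ₓ^i ∂_y^j u` of the periodic function `u`:
the test functions are the smooth periodic functions. -/
def IsWeakDeriv (L : ℝ) (i j : ℕ) (u g : ℝ × ℝ → ℝ) : Prop :=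
  ∀ ψ : ℝ × ℝ → ℝ, ContDiff ℝ ((⊤ : ℕ∞) : WithTop ℕ∞) ψ → IsPeriodic L ψ →
    ∫ p, u p * (dX^[i] (dY^[j] ψ)) p ∂(vol L) = (-1) ^ (i + j) * ∫ p, g p * ψ p ∂(vol L)

/-- `g` is the `j`-th weak derivative of `u : (0, T) → X` (with values in a Banach space `X`). -/
def IsWeakTimeDeriv {X : Type*} [NormedAddCommGroup X] [NormedSpace ℝ X]
    (T : ℝ) (j : ℕ) (u g : ℝ → X) : Prop :=
  ∀ ψ : ℝ → ℝ, ContDiff ℝ ((⊤ : ℕ∞) : WithTop ℕ∞) ψ → HasCompactSupport ψ →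
    tsupport ψ ⊆ Ioo 0 T →
    ∫ t in Ioo 0 T, iteratedDeriv j ψ t • u t = (-1 : ℝ) ^ j • ∫ t in Ioo 0 T, ψ t • g t

/-- The Bochner-Sobolev space `W^{m,∞}(0, T; X)`. -/
def MemWTime {X : Type*} [NormedAddCommGroup X] [NormedSpace ℝ X]
    (T : ℝ) (m : ℕ) (u : ℝ → X) : Prop :=
  MemLp u ⊤ (volume.restrict (Ioo 0 T)) ∧
  ∀ j ≤ m, ∃ g : ℝ → X, MemLp g ⊤ (volume.restrict (Ioo 0 T)) ∧ IsWeakTimeDeriv T j u g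

/-- `φ ∈ W^{m,∞}(0, T; W^{k,p}(Ω))` for functions periodic in space.  The space `W^{k,p}(Ω)` is
identified, through `u ↦ (∂^α u)_{|α| ≤ k}`, with a closed subspace of a finite product of copies
of `L^p(Ω)`; so the condition is that `φ(t) ∈ W^{k,p}(Ω)` for almost every `t` and that every
curve `t ↦ ∂^α φ(t)`, `|α| ≤ k`, lies in `W^{m,∞}(0, T; L^p(Ω))`.  The case `m = 0` is
`L^∞(0, T; W^{k,p}(Ω))`, the case `k = 0` is `W^{m,∞}(0, T; L^p(Ω))`. -/
def MemBochnerSobolev (L T : ℝ) (m k : ℕ) (p : ENNReal) [Fact (1 ≤ p)]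
    (φ : ℝ → ℝ × ℝ → ℝ) : Prop :=
  ∃ D : ℕ → ℕ → ℝ → Lp ℝ p (vol L),
    (∀ᵐ t ∂(volume.restrict (Ioo 0 T)),
      (⇑(D 0 0 t) =ᵐ[vol L] φ t) ∧
        ∀ i j : ℕ, i + j ≤ k → IsWeakDeriv L i j (φ t) ⇑(D i j t)) ∧
    ∀ i j : ℕ, i + j ≤ k → MemWTime T m (D i j)

/-! ### The Allen-Cahn equation -/

/-- Free energy `E(u) = ε²/2 ∫_Ω |∇u|² + ∫_Ω F(u)`. -/
def energy (L ε : ℝ) (F : ℝ → ℝ) (u : ℝ × ℝ → ℝ) : ℝ :=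
  ε ^ 2 / 2 * ∫ p, (dX u p ^ 2 + dY u p ^ 2) ∂(vol L) + ∫ p, F (u p) ∂(vol L)

/-- `φ` is an `L`-periodic solution on `[0, T]` of
`∂φ/∂t = -M μ`, `μ = -ε² Δφ + F'(φ)`. -/
structure IsAllenCahnSolution (L T ε M : ℝ) (F : ℝ → ℝ) (φ : ℝ → ℝ × ℝ → ℝ) : Prop where
  periodic : ∀ t ∈ Icc 0 T, IsPeriodic L (φ t)
  contDiff : ∀ t ∈ Icc 0 T, ContDiff ℝ 2 (φ t)
  equation : ∀ t ∈ Icc 0 T, ∀ p : ℝ × ℝ,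
    HasDerivWithinAt (fun τ => φ τ p)
      (-M * (-ε ^ 2 * laplace (φ t) p + deriv F (φ t p))) (Icc 0 T) t

/-! ### Grid functions -/

/-- Periodic grid functions on the `N × N` grid. -/
abbrev Grid (N : ℕ) : Type := ZMod N → ZMod N → ℝ

/-- Restriction of an `L`-periodic function to the nodes `(i h, j h)`, `h = L / N`
(by periodicity the index `i = 0` is the index `i = N`). -/
def sample (L : ℝ) (N : ℕ) (u : ℝ × ℝ → ℝ) : Grid N :=
  fun i j => u ((i.val : ℝ) * (L / N), (j.val : ℝ) * (L / N))

/-- Discrete Laplacian. -/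
def lapH {N : ℕ} (h : ℝ) (u : Grid N) : Grid N := fun i j =>
  1 / h ^ 2 * (u (i + 1) j + u i (j + 1) + u (i - 1) j + u i (j - 1) - 4 * u i j)

/-- Discrete inner product `(u, v)_m`. -/
def innerM {N : ℕ} [NeZero N] (h : ℝ) (u v : Grid N) : ℝ := h ^ 2 * ∑ i, ∑ j, u i j * v i j

/-- `‖u‖_m²`. -/
def normSqM {N : ℕ} [NeZero N] (h : ℝ) (u : Grid N) : ℝ := innerM h u u

/-- `‖∇_h u‖_{TM}²`, where `∇_h` is the forward difference quotient. -/
def gradSqTM {N : ℕ} [NeZero N] (h : ℝ) (u : Grid N) : ℝ :=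
  h ^ 2 * ∑ i, ∑ j, ((u (i + 1) j - u i j) / h) ^ 2 +
    h ^ 2 * ∑ i, ∑ j, ((u i (j + 1) - u i j) / h) ^ 2

/-- Discrete free energy `E_h(u) = ε²/2 ‖∇_h u‖_{TM}² + (F(u), 1)_m`. -/
def energyH {N : ℕ} [NeZero N] (h ε : ℝ) (F : ℝ → ℝ) (u : Grid N) : ℝ :=
  ε ^ 2 / 2 * gradSqTM h u + h ^ 2 * ∑ i, ∑ j, F (u i j)

/-- `(φh, μh, Rh)` is a solution of the first-order fully discrete PS-SAV scheme with mesh size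
`h`, time step `dt` and `Nt` steps, started from `(φ0, R0)`.  Each step is a quadratic equation
for `Rh (n + 1)` with one positive root; the scheme takes that root. -/
structure IsPSSAVSolution {N : ℕ} [NeZero N] (h dt : ℝ) (Nt : ℕ) (ε M s C₀ : ℝ) (F : ℝ → ℝ)
    (φ0 : Grid N) (R0 : ℝ) (φh μh : ℕ → Grid N) (Rh : ℕ → ℝ) : Prop where
  init_phi : φh 0 = φ0
  init_R : Rh 0 = R0
  pos : ∀ n < Nt, 0 < Rh (n + 1)
  phi_eq : ∀ n < Nt, ∀ i j, (φh (n + 1) i j - φh n i j) / dt = -M * μh (n + 1) i j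
  mu_eq : ∀ n < Nt, ∀ i j, μh (n + 1) i j =
    -s * ε ^ 2 * (lapH h (φh (n + 1)) i j - lapH h (φh n) i j) +
      Rh (n + 1) / (energyH h ε F (φh n) + C₀) *
        (-ε ^ 2 * lapH h (φh n) i j + deriv F (φh n i j))
  R_eq : ∀ n < Nt, (Rh (n + 1) - Rh n) / dt =
    -(1 / M) * innerM h (fun i j => (φh (n + 1) i j - φh n i j) / dt)
      (fun i j => (φh (n + 1) i j - φh n i j) / dt)

/-- The error `e_φ^n = φ_h^n - φ(t^n)` on the grid, `t^n = n dt`. -/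
def errPhi {N : ℕ} (L dt : ℝ) (φ : ℝ → ℝ × ℝ → ℝ) (φh : ℕ → Grid N) (n : ℕ) : Grid N :=
  fun i j => φh n i j - sample L N (φ (n * dt)) i j

/-- The difference quotient `d_t e_φ^{n+1} = (e_φ^{n+1} - e_φ^n) / dt`. -/
def dtErrPhi {N : ℕ} (L dt : ℝ) (φ : ℝ → ℝ × ℝ → ℝ) (φh : ℕ → Grid N) (n : ℕ) : Grid N :=
  fun i j => (errPhi L dt φ φh (n + 1) i j - errPhi L dt φ φh n i j) / dt

/-- The error `e_R^n = R_h^n - R(t^n)`, `R(t) = E(φ(t)) + C₀`. -/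
def errR (L dt ε C₀ : ℝ) (F : ℝ → ℝ) (φ : ℝ → ℝ × ℝ → ℝ) (Rh : ℕ → ℝ) (n : ℕ) : ℝ :=
  Rh n - (energy L ε F (φ (n * dt)) + C₀)

end PSSAV

end

noncomputable section

namespace PSSAV

section

/-! ### Discrete calculus on periodic grids -/

variable {N : ℕ} {h : ℝ}

/-! Write `δ = h² + Δt`, `ξ = R_h^{n+1} / (E_h(φ_h^n) + C₀)` and `a = d_t e_φ^{n+1}`. The sampled
exact solution satisfies the scheme up to `O(δ)`, and the scheme is stable near it.

Stability. `R_h` is positive and nonincreasing, so `0 < ξ ≤ R⁰/K₁ ≤ 2s`. Testing the error equation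
with `a` yields the dissipation `‖a‖²/M`, and `s ≥ ξ/2` lets the stabilising term pay for the
explicit Laplacian (`Step.energy_step`). Division by `ξ` makes the gradient term telescope; the
lower bound on `ξ` that this needs comes from the scheme itself, because the drop of `R_h` in one
step is `O(ξ²)` (`Step.le_xi_mul`). The scalar error is measured against the discrete energy of the
sampled solution: that energy obeys its balance law up to `O(Δt δ)` per step, while the increment of
the quadrature error `E_h - E` is only known to be `O(h²)`, without the factor `Δt`. The scalar
equation contains `‖a‖²` with a coefficient that is not small, so `errEnergy` weights `r²` and
`‖e‖²` by a small `η` (`Step.exists_estimate`). Gronwall then gives `O(δ²)`.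

Bootstrap. As `F` is only locally controlled, this requires `|e| ≤ 1` at every node. Solved for `Δ_h
e^{n+1}`, the error equation has amplification factor `|1 - ξ/s| ≤ 1`, and each step adds the norms
of `a` and of the residual, without a factor `Δt`. If `h² ≤ Δt`, the sum over all steps is `O(δ/Δt)
= O(1)`; if `Δt ≤ h²`, an inverse inequality gives `O(δ/h²) = O(1)` (`lap_bound_of_sum`). The
Agmon-type inequality `sq_le_of_lapH` turns this into `|e|² = O(δ)`, and an induction closes with no
condition linking `h` and `Δt` (`exists_error_bound`). When `δ` is bounded below, bounded errors
suffice (`exists_coarse_bound`).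

Consistency. For almost every time, periodic mollification turns weak derivatives into classical
ones with the same bounds. These are restated as finite difference bounds, which survive pointwise
limits and hence hold without mollification and at every time (`exists_fdBound`). The Lipschitz
dependence of the second derivatives on time, with values in `L²`, controls `Δ_h φ(t) - Δ_h φ(s)`
(`exists_lapH_time_lipschitz`); the equation transfers this to `∂_t φ`, which bounds the truncation
error and the energy defect (`exists_consistent`). -/

/-- Forward difference quotients. -/
def diffX (h : ℝ) (u : Grid N) : Grid N := fun i j => (u (i + 1) j - u i j) / h

def diffY (h : ℝ) (u : Grid N) : Grid N := fun i j => (u i (j + 1) - u i j) / h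

lemma lapH_sub (u v : Grid N) : lapH h (u - v) = lapH h u - lapH h v := by
  ext i j; simp only [lapH, Pi.sub_apply]; ring

lemma lapH_smul (c : ℝ) (u : Grid N) : lapH h (c • u) = c • lapH h u := by
  ext i j; simp only [lapH, Pi.smul_apply, smul_eq_mul]; ring

lemma diffX_add (u v : Grid N) : diffX h (u + v) = diffX h u + diffX h v := by
  ext i j; simp only [diffX, Pi.add_apply]; ring

lemma diffY_add (u v : Grid N) : diffY h (u + v) = diffY h u + diffY h v := by
  ext i j; simp only [diffY, Pi.add_apply]; ring

lemma diffX_smul (c : ℝ) (u : Grid N) : diffX h (c • u) = c • diffX h u := by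
  ext i j; simp only [diffX, Pi.smul_apply, smul_eq_mul]; ring

lemma diffY_smul (c : ℝ) (u : Grid N) : diffY h (c • u) = c • diffY h u := by
  ext i j; simp only [diffY, Pi.smul_apply, smul_eq_mul]; ring

variable [NeZero N]

lemma sum_zmod_eq_sum_range {β : Type*} [AddCommMonoid β] (f : ℕ → β) :
    ∑ i : ZMod N, f i.val = ∑ i ∈ Finset.range N, f i := by
  obtain ⟨n, rfl⟩ : ∃ n, N = n + 1 := ⟨N - 1, (Nat.succ_pred (NeZero.ne N)).symm⟩
  exact Fin.sum_univ_eq_sum_range f (n + 1)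

lemma sum_shift (f : ZMod N → ℝ) (c : ZMod N) : ∑ i, f (i + c) = ∑ i, f i :=
  Equiv.sum_comp (Equiv.addRight c) f

/-- The bilinear form of `gradSqTM`. -/
def gradIn (h : ℝ) (u v : Grid N) : ℝ :=
  innerM h (diffX h u) (diffX h v) + innerM h (diffY h u) (diffY h v)

lemma gradSqTM_eq (u : Grid N) : gradSqTM h u = gradIn h u u := by
  simp [gradSqTM, gradIn, innerM, diffX, diffY, sq]

lemma innerM_comm (u v : Grid N) : innerM h u v = innerM h v u := by
  simp [innerM, mul_comm]

lemma innerM_add_left (u v w : Grid N) : innerM h (u + v) w = innerM h u w + innerM h v w := by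
  simp only [innerM, Pi.add_apply, add_mul, Finset.sum_add_distrib, mul_add]

lemma innerM_smul_left (c : ℝ) (u w : Grid N) : innerM h (c • u) w = c * innerM h u w := by
  simp only [innerM, Pi.smul_apply, smul_eq_mul, mul_assoc, ← Finset.mul_sum]
  ring

lemma innerM_neg_left (u w : Grid N) : innerM h (-u) w = -innerM h u w := by
  have := innerM_smul_left (h := h) (-1) u w
  simpa using this

lemma innerM_sub_left (u v w : Grid N) : innerM h (u - v) w = innerM h u w - innerM h v w := by
  rw [sub_eq_add_neg, innerM_add_left, innerM_neg_left]; ring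

lemma innerM_add_right (u v w : Grid N) : innerM h w (u + v) = innerM h w u + innerM h w v := by
  rw [innerM_comm, innerM_add_left, innerM_comm u, innerM_comm v]

lemma innerM_smul_right (c : ℝ) (u w : Grid N) : innerM h w (c • u) = c * innerM h w u := by
  rw [innerM_comm, innerM_smul_left, innerM_comm]

lemma innerM_neg_right (u w : Grid N) : innerM h w (-u) = -innerM h w u := by
  rw [innerM_comm, innerM_neg_left, innerM_comm]

lemma normSqM_nonneg (u : Grid N) : 0 ≤ normSqM h u := by
  unfold normSqM innerM
  exact mul_nonneg (sq_nonneg _)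
    (Finset.sum_nonneg fun i _ => Finset.sum_nonneg fun j _ => mul_self_nonneg _)

lemma normSqM_smul (c : ℝ) (u : Grid N) : normSqM h (c • u) = c ^ 2 * normSqM h u := by
  rw [normSqM, innerM_smul_left, innerM_smul_right, normSqM]; ring

lemma normSqM_neg (u : Grid N) : normSqM h (-u) = normSqM h u := by
  rw [normSqM, innerM_neg_left, innerM_neg_right, normSqM]; ring

lemma normSqM_add (u v : Grid N) :
    normSqM h (u + v) = normSqM h u + 2 * innerM h u v + normSqM h v := by
  simp only [normSqM, innerM_add_left, innerM_add_right]
  rw [innerM_comm v u]; ring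

lemma innerM_sq_le (u v : Grid N) : innerM h u v ^ 2 ≤ normSqM h u * normSqM h v := by
  have key : ∀ c : ℝ, 0 ≤ normSqM h v * (c * c) + (2 * innerM h u v) * c + normSqM h u := by
    intro c
    have := normSqM_nonneg (h := h) (u + c • v)
    rw [normSqM_add, innerM_smul_right, normSqM_smul] at this
    linarith
  have := discrim_le_zero key
  unfold discrim at this
  linarith

/-- The discrete `L²` norm. -/
def normM (h : ℝ) (u : Grid N) : ℝ := √(normSqM h u)

lemma normM_nonneg (u : Grid N) : 0 ≤ normM h u := Real.sqrt_nonneg _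

lemma normM_sq (u : Grid N) : normM h u ^ 2 = normSqM h u := Real.sq_sqrt (normSqM_nonneg u)

lemma abs_innerM_le (u v : Grid N) : |innerM h u v| ≤ normM h u * normM h v := by
  refine abs_le_of_sq_le_sq ?_ (mul_nonneg (normM_nonneg u) (normM_nonneg v))
  rw [mul_pow, normM_sq, normM_sq]
  exact innerM_sq_le u v

lemma innerM_le (u v : Grid N) : innerM h u v ≤ normM h u * normM h v :=
  (le_abs_self _).trans (abs_innerM_le u v)

lemma normM_add_le (u v : Grid N) : normM h (u + v) ≤ normM h u + normM h v := by
  refine abs_le_of_sq_le_sq' ?_ (add_nonneg (normM_nonneg u) (normM_nonneg v)) |>.2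
  rw [normM_sq, normSqM_add, ← normM_sq, ← normM_sq]
  nlinarith [innerM_le (h := h) u v]

lemma normM_smul (c : ℝ) (u : Grid N) : normM h (c • u) = |c| * normM h u := by
  rw [normM, normSqM_smul, Real.sqrt_mul (sq_nonneg c), Real.sqrt_sq_eq_abs, normM]

lemma normM_neg (u : Grid N) : normM h (-u) = normM h u := by
  rw [normM, normSqM_neg, normM]

lemma normM_sub_le (u v : Grid N) : normM h (u - v) ≤ normM h u + normM h v := by
  rw [sub_eq_add_neg]
  simpa [normM_neg] using normM_add_le (h := h) u (-v)

lemma normSqM_add_le (u v : Grid N) : normSqM h (u + v) ≤ 2 * normSqM h u + 2 * normSqM h v := by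
  have h1 := normSqM_nonneg (h := h) (u - v)
  have h2 : normSqM h (u - v) = normSqM h u - 2 * innerM h u v + normSqM h v := by
    rw [sub_eq_add_neg, normSqM_add, innerM_neg_right, normSqM_neg]; ring
  rw [normSqM_add]
  linarith

lemma normSqM_mono {u v : Grid N} (huv : ∀ i j, |u i j| ≤ |v i j|) :
    normSqM h u ≤ normSqM h v := by
  unfold normSqM innerM
  refine mul_le_mul_of_nonneg_left ?_ (sq_nonneg _)
  refine Finset.sum_le_sum fun i _ => Finset.sum_le_sum fun j _ => ?_
  simpa only [abs_mul_abs_self] using mul_self_le_mul_self (abs_nonneg _) (huv i j)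

lemma normSqM_const {L : ℝ} (hN : h = L / N) (c : ℝ) :
    normSqM h (fun _ _ => c : Grid N) = L ^ 2 * c ^ 2 := by
  have hN0 : (N : ℝ) ≠ 0 := Nat.cast_ne_zero.mpr (NeZero.ne N)
  simp only [normSqM, innerM, Finset.sum_const, Finset.card_univ, ZMod.card, nsmul_eq_mul]
  rw [hN]; field_simp

lemma normSqM_le_of_abs_le {L : ℝ} (hN : h = L / N) {u : Grid N} {c : ℝ}
    (hu : ∀ i j, |u i j| ≤ c) : normSqM h u ≤ L ^ 2 * c ^ 2 := by
  rw [← normSqM_const hN c]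
  exact normSqM_mono fun i j => (hu i j).trans (le_abs_self c)

lemma normM_le_of_abs_le {L : ℝ} (hL : 0 ≤ L) (hN : h = L / N) {u : Grid N} {c : ℝ} (hc : 0 ≤ c)
    (hu : ∀ i j, |u i j| ≤ c) : normM h u ≤ L * c := by
  refine Real.sqrt_le_iff.mpr ⟨by positivity, ?_⟩
  rw [mul_pow]; exact normSqM_le_of_abs_le hN hu

lemma normM_le_mul {u v : Grid N} {c : ℝ} (hc : 0 ≤ c) (huv : ∀ i j, |u i j| ≤ c * |v i j|) :
    normM h u ≤ c * normM h v := by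
  have e := normM_smul (h := h) c v
  rw [abs_of_nonneg hc] at e
  rw [← e]
  refine Real.sqrt_le_sqrt (normSqM_mono fun i j => ?_)
  simpa [abs_mul, abs_of_nonneg hc] using huv i j

/-- Summation by parts. Periodicity makes the sum invariant under shifts, so there is no boundary
term. -/
lemma innerM_diffX (u v : Grid N) (hh : h ≠ 0) :
    innerM h (diffX h u) (diffX h v) =
      -innerM h (fun i j => 1 / h ^ 2 * (u (i + 1) j + u (i - 1) j - 2 * u i j)) v := by
  have e1 : ∑ i, ∑ j, (u (i + 1) j - u i j) * v (i + 1) j =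
      ∑ i, ∑ j, (u i j - u (i - 1) j) * v i j := by
    rw [← sum_shift (fun i => ∑ j, (u i j - u (i - 1) j) * v i j) 1]
    simp
  have e2 : ∑ i, ∑ j, diffX h u i j * diffX h v i j = 1 / h ^ 2 *
      (∑ i, ∑ j, (u (i + 1) j - u i j) * v (i + 1) j - ∑ i, ∑ j, (u (i + 1) j - u i j) * v i j) := by
    simp only [← Finset.sum_sub_distrib, Finset.mul_sum, diffX]
    refine Finset.sum_congr rfl fun i _ => Finset.sum_congr rfl fun j _ => ?_
    field_simp
  rw [innerM, e2, e1, innerM]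
  simp only [← Finset.sum_sub_distrib, Finset.mul_sum, ← Finset.sum_neg_distrib]
  refine Finset.sum_congr rfl fun i _ => Finset.sum_congr rfl fun j _ => ?_
  ring

lemma innerM_diffY (u v : Grid N) (hh : h ≠ 0) :
    innerM h (diffY h u) (diffY h v) =
      -innerM h (fun i j => 1 / h ^ 2 * (u i (j + 1) + u i (j - 1) - 2 * u i j)) v := by
  have := innerM_diffX (fun i j => u j i) (fun i j => v j i) hh
  simp only [innerM, diffX] at this
  simp only [innerM, diffY]
  rw [Finset.sum_comm, this]
  congr 2
  rw [Finset.sum_comm]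

lemma innerM_lapH (u v : Grid N) (hh : h ≠ 0) : innerM h (lapH h u) v = -gradIn h u v := by
  rw [gradIn, innerM_diffX u v hh, innerM_diffY u v hh, ← neg_add, neg_neg, ← innerM_add_left]
  congr 1
  ext i j
  simp only [lapH, Pi.add_apply]
  ring

lemma gradSqTM_nonneg (u : Grid N) : 0 ≤ gradSqTM h u := by
  rw [gradSqTM_eq]
  exact add_nonneg (normSqM_nonneg _) (normSqM_nonneg _)

lemma gradIn_comm (u v : Grid N) : gradIn h u v = gradIn h v u := by
  rw [gradIn, innerM_comm, innerM_comm (diffY h u), gradIn]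

lemma gradIn_smul_right (c : ℝ) (u v : Grid N) : gradIn h u (c • v) = c * gradIn h u v := by
  rw [gradIn, diffX_smul, diffY_smul, innerM_smul_right, innerM_smul_right, gradIn]; ring

lemma gradSqTM_smul (c : ℝ) (u : Grid N) : gradSqTM h (c • u) = c ^ 2 * gradSqTM h u := by
  rw [gradSqTM_eq, gradIn_smul_right, gradIn_comm, gradIn_smul_right, gradSqTM_eq]; ring

lemma gradSqTM_add (u v : Grid N) :
    gradSqTM h (u + v) = gradSqTM h u + 2 * gradIn h u v + gradSqTM h v := by
  simp only [gradSqTM_eq, gradIn, diffX_add, diffY_add, innerM_add_left, innerM_add_right]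
  rw [innerM_comm (diffX h v), innerM_comm (diffY h v)]
  ring

lemma gradSqTM_add_le (u v : Grid N) :
    gradSqTM h (u + v) ≤ 2 * gradSqTM h u + 2 * gradSqTM h v := by
  have h1 := gradSqTM_nonneg (h := h) (u + (-1 : ℝ) • v)
  rw [gradSqTM_add, gradIn_smul_right, gradSqTM_smul] at h1
  rw [gradSqTM_add]
  linarith

lemma gradIn_sq_le (u v : Grid N) : gradIn h u v ^ 2 ≤ gradSqTM h u * gradSqTM h v := by
  have key : ∀ c : ℝ, 0 ≤ gradSqTM h v * (c * c) + (2 * gradIn h u v) * c + gradSqTM h u := by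
    intro c
    have := gradSqTM_nonneg (h := h) (u + c • v)
    rw [gradSqTM_add, gradIn_smul_right, gradSqTM_smul] at this
    linarith
  have := discrim_le_zero key
  unfold discrim at this
  linarith

lemma normSqM_shift (u : Grid N) (a b : ZMod N) :
    normSqM h (fun i j => u (i + a) (j + b)) = normSqM h u := by
  simp only [normSqM, innerM]
  congr 1
  rw [← sum_shift (fun i => ∑ j, u i j * u i j) a]
  exact Finset.sum_congr rfl fun i _ => sum_shift (fun j => u (i + a) j * u (i + a) j) b

lemma normM_shift (u : Grid N) (a b : ZMod N) :
    normM h (fun i j => u (i + a) (j + b)) = normM h u := by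
  rw [normM, normSqM_shift, normM]

/-- Inverse inequality for the discrete Laplacian. -/
lemma normM_lapH_le (hh : 0 < h) (u : Grid N) : normM h (lapH h u) ≤ 8 / h ^ 2 * normM h u := by
  have e : lapH h u = (1 / h ^ 2) • ((fun i j => u (i + 1) (j + 0)) + (fun i j => u (i + 0) (j + 1))
      + (fun i j => u (i + -1) (j + 0)) + (fun i j => u (i + 0) (j + -1)) - (4 : ℝ) • u : Grid N) := by
    ext i j
    simp [lapH, sub_eq_add_neg]
  rw [e, normM_smul, abs_of_pos (by positivity)]
  have h1 := normM_sub_le (h := h) ((fun i j => u (i + 1) (j + 0)) + (fun i j => u (i + 0) (j + 1))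
      + (fun i j => u (i + -1) (j + 0)) + (fun i j => u (i + 0) (j + -1)) : Grid N) ((4 : ℝ) • u)
  have h2 := normM_add_le (h := h) ((fun i j => u (i + 1) (j + 0)) + (fun i j => u (i + 0) (j + 1))
      + (fun i j => u (i + -1) (j + 0)) : Grid N) (fun i j => u (i + 0) (j + -1))
  have h3 := normM_add_le (h := h)
    ((fun i j => u (i + 1) (j + 0)) + (fun i j => u (i + 0) (j + 1)) : Grid N)
    (fun i j => u (i + -1) (j + 0))
  have h4 := normM_add_le (h := h) (fun i j => u (i + 1) (j + 0)) (fun i j => u (i + 0) (j + 1))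
  rw [normM_smul] at h1
  simp only [normM_shift] at h1 h2 h3 h4
  norm_num at h1
  have : normM h ((fun i j => u (i + 1) (j + 0)) + (fun i j => u (i + 0) (j + 1))
      + (fun i j => u (i + -1) (j + 0)) + (fun i j => u (i + 0) (j + -1)) - (4 : ℝ) • u : Grid N)
      ≤ 8 * normM h u := by
    simp only [add_zero] at *
    linarith
  calc _ ≤ 1 / h ^ 2 * (8 * normM h u) := by gcongr
    _ = _ := by ring

/-- Interpolation of the `H¹` seminorm between `L²` and `H²`, by summation by parts and
Cauchy–Schwarz. -/
lemma gradSqTM_le_lapH (hh : h ≠ 0) (u : Grid N) :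
    gradSqTM h u ≤ normM h (lapH h u) * normM h u := by
  have := innerM_lapH u u hh
  rw [gradSqTM_eq]
  have h2 := abs_innerM_le (h := h) (lapH h u) u
  rw [this, abs_neg] at h2
  exact (le_abs_self _).trans h2

/-- Inverse inequality for the discrete gradient. -/
lemma gradSqTM_le_normSqM (hh : 0 < h) (u : Grid N) : gradSqTM h u ≤ 8 / h ^ 2 * normSqM h u := by
  have h1 := gradSqTM_le_lapH hh.ne' u
  have h2 := mul_le_mul_of_nonneg_right (normM_lapH_le hh u) (normM_nonneg (h := h) u)
  rw [mul_assoc, ← sq, normM_sq] at h2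
  exact h1.trans h2

/-- Difference quotients commute with the discrete Laplacian, so summation by parts shows that the
Laplacian alone controls all second differences, the mixed ones included. -/
lemma gradSqTM_diffX_add (hh : h ≠ 0) (u : Grid N) :
    gradSqTM h (diffX h u) + gradSqTM h (diffY h u) = normSqM h (lapH h u) := by
  have ex : lapH h (diffX h u) = diffX h (lapH h u) := by
    ext i j; simp only [lapH, diffX, sub_add_cancel, add_sub_cancel_right]
    ring
  have ey : lapH h (diffY h u) = diffY h (lapH h u) := by
    ext i j; simp only [lapH, diffY, sub_add_cancel, add_sub_cancel_right]
    ring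
  have hx := innerM_lapH (diffX h u) (diffX h u) hh
  have hy := innerM_lapH (diffY h u) (diffY h u) hh
  rw [ex] at hx
  rw [ey] at hy
  have hl := innerM_lapH u (lapH h u) hh
  rw [gradIn, innerM_comm (diffX h u), innerM_comm (diffY h u)] at hl
  rw [gradSqTM_eq, gradSqTM_eq, normSqM, innerM_comm]
  rw [innerM_comm] at hl
  linarith

/-- One-dimensional discrete Sobolev inequality. -/
lemma sq_le_sum_add_sum {L l : ℝ} (hl : 0 < l) (hh : 0 < h) (hN : h = L / N) (v : ZMod N → ℝ)
    (i : ZMod N) : v i ^ 2 ≤ (1 / L + 1 / l) * (h * ∑ k, v k ^ 2) +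
      l * (h * ∑ k, ((v (k + 1) - v k) / h) ^ 2) := by
  have hN0 : (N : ℝ) ≠ 0 := Nat.cast_ne_zero.mpr (NeZero.ne N)
  have hLh : L = N * h := by rw [hN]; field_simp
  have hNpos : (0 : ℝ) < N := lt_of_le_of_ne (Nat.cast_nonneg _) (Ne.symm hN0)
  set S := ∑ k, |v (k + 1) ^ 2 - v k ^ 2| with hS
  -- Along the path from `j` to `i` on the circle, `v²` grows by at most its total variation `S`.
  -- Averaging over `j` bounds `v i ^ 2` by the mean of `v²` plus `S`; Young's inequality with
  -- weight `l / h` splits `S`.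
  have path : ∀ j, v i ^ 2 ≤ v j ^ 2 + S := by
    intro j
    have tel : ∀ m : ℕ, v (j + (m : ZMod N)) ^ 2 ≤
        v j ^ 2 + ∑ k ∈ Finset.range m, |v (j + (k : ZMod N) + 1) ^ 2 - v (j + (k : ZMod N)) ^ 2| := by
      intro m
      induction m with
      | zero => simp
      | succ m ih =>
        rw [Finset.sum_range_succ]
        have := le_abs_self (v (j + (m : ZMod N) + 1) ^ 2 - v (j + (m : ZMod N)) ^ 2)
        push_cast
        rw [← add_assoc]
        linarith
    have h1 := tel (i - j).val
    rw [ZMod.natCast_zmod_val, add_sub_cancel] at h1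
    refine h1.trans (add_le_add le_rfl ?_)
    have h2 : ∑ k ∈ Finset.range N, |v (j + (k : ZMod N) + 1) ^ 2 - v (j + (k : ZMod N)) ^ 2| = S := by
      rw [← sum_zmod_eq_sum_range
        (fun k => |v (j + (k : ZMod N) + 1) ^ 2 - v (j + (k : ZMod N)) ^ 2|), hS,
        ← sum_shift (fun k => |v (k + 1) ^ 2 - v k ^ 2|) j]
      refine Finset.sum_congr rfl fun k _ => ?_
      rw [ZMod.natCast_zmod_val, add_comm j k]
    rw [← h2]
    exact Finset.sum_le_sum_of_subset_of_nonneg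
      (Finset.range_mono (ZMod.val_lt _).le) fun _ _ _ => abs_nonneg _
  have hSle : S ≤ 1 / l * (h * ∑ k, v k ^ 2) + l * (h * ∑ k, ((v (k + 1) - v k) / h) ^ 2) := by
    have h3 : ∑ k, v k ^ 2 = ∑ k, (v (k + 1) ^ 2 / 2 + v k ^ 2 / 2) := by
      rw [Finset.sum_add_distrib, sum_shift (fun k => v k ^ 2 / 2) 1, ← Finset.sum_add_distrib]
      simp
    rw [h3, hS]
    simp only [Finset.mul_sum, ← Finset.sum_add_distrib]
    refine Finset.sum_le_sum fun k _ => ?_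
    set a := v (k + 1)
    set b := v k
    have e1 : l * (h * ((a - b) / h) ^ 2) = l / h * (a - b) ^ 2 := by field_simp
    have e2 : 1 / l * (h * (a ^ 2 / 2 + b ^ 2 / 2)) = (h / l) * ((a ^ 2 + b ^ 2) / 2) := by ring
    rw [e1, e2, show a ^ 2 - b ^ 2 = (a - b) * (a + b) by ring, abs_mul]
    set c := l / h
    have hc : 0 < c := by positivity
    have e3 : h / l = 1 / c := by simp [c]
    rw [e3]
    have h4 : |a + b| ^ 2 ≤ 2 * (a ^ 2 + b ^ 2) := by rw [sq_abs]; nlinarith [sq_nonneg (a - b)]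
    have h5 : |a - b| * |a + b| ≤ c * |a - b| ^ 2 + 1 / (4 * c) * |a + b| ^ 2 := by
      have : 0 ≤ (1 / c) * (c * |a - b| - |a + b| / 2) ^ 2 := by positivity
      have e : (1 / c) * (c * |a - b| - |a + b| / 2) ^ 2 =
        c * |a - b| ^ 2 + 1 / (4 * c) * |a + b| ^ 2 - |a - b| * |a + b| := by field_simp; ring
      linarith
    have h6 : 1 / (4 * c) * |a + b| ^ 2 ≤ 1 / (4 * c) * (2 * (a ^ 2 + b ^ 2)) := by gcongr
    have e4 : 1 / (4 * c) * (2 * (a ^ 2 + b ^ 2)) = 1 / c * ((a ^ 2 + b ^ 2) / 2) := by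
      field_simp; ring
    rw [sq_abs] at h5
    linarith
  have havg : v i ^ 2 ≤ 1 / L * (h * ∑ k, v k ^ 2) + S := by
    have h7 : ∑ _k : ZMod N, v i ^ 2 ≤ ∑ k, (v k ^ 2 + S) := Finset.sum_le_sum fun k _ => path k
    rw [Finset.sum_add_distrib] at h7
    simp only [Finset.sum_const, Finset.card_univ, ZMod.card, nsmul_eq_mul] at h7
    have h8 : 1 / L * (h * ∑ k, v k ^ 2) = (∑ k, v k ^ 2) / N := by rw [hLh]; field_simp
    rw [h8, div_add' _ _ _ hN0, le_div_iff₀ hNpos]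
    linarith
  linarith

/-- Two-dimensional discrete Agmon-type inequality. -/
lemma sq_le_of_lapH {L l : ℝ} (hL : 0 < L) (hl : 0 < l) (hN : h = L / N) (u : Grid N)
    (i j : ZMod N) : u i j ^ 2 ≤
      (1 / L + 1 / l) * ((1 / L + 1) * normSqM h u + gradSqTM h u) +
        l * ((1 / L + 1) * gradSqTM h u + normSqM h (lapH h u)) := by
  have hN0 : (N : ℝ) ≠ 0 := Nat.cast_ne_zero.mpr (NeZero.ne N)
  have hNpos : (0 : ℝ) < N := lt_of_le_of_ne (Nat.cast_nonneg _) (Ne.symm hN0)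
  have hh : 0 < h := by rw [hN]; positivity
  -- A trace bound on the line of index `j`: the one-dimensional inequality in the second variable
  -- with `l = 1`, summed over the first variable. It is applied to `u` and to `diffX h u`, while
  -- the free `l` is kept for the first variable.
  have row : ∀ w : Grid N, h * ∑ k, w k j ^ 2 ≤ (1 / L + 1) * normSqM h w + gradSqTM h w := by
    intro w
    have h1 : h * ∑ k, w k j ^ 2 ≤ h * ∑ k, ((1 / L + 1 / 1) * (h * ∑ m, w k m ^ 2) +
        1 * (h * ∑ m, ((w k (m + 1) - w k m) / h) ^ 2)) :=
      mul_le_mul_of_nonneg_left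
        (Finset.sum_le_sum fun k _ => sq_le_sum_add_sum one_pos hh hN (w k) j) hh.le
    refine h1.trans ?_
    have e : h * ∑ k, ((1 / L + 1 / 1) * (h * ∑ m, w k m ^ 2) +
        1 * (h * ∑ m, ((w k (m + 1) - w k m) / h) ^ 2)) =
        (1 / L + 1) * normSqM h w + h ^ 2 * ∑ k, ∑ m, ((w k (m + 1) - w k m) / h) ^ 2 := by
      rw [Finset.sum_add_distrib, normSqM, innerM]
      simp only [← Finset.mul_sum, ← sq]
      ring
    rw [e, gradSqTM]
    have : 0 ≤ h ^ 2 * ∑ i, ∑ j, ((w (i + 1) j - w i j) / h) ^ 2 := by positivity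
    linarith
  have h1 := sq_le_sum_add_sum hl hh hN (fun k => u k j) i
  have h2 := row u
  have h3 := row (diffX h u)
  have h4 : normSqM h (diffX h u) ≤ gradSqTM h u := by
    rw [gradSqTM_eq, gradIn]
    have := normSqM_nonneg (h := h) (diffY h u)
    unfold normSqM at *
    linarith
  have h5 : gradSqTM h (diffX h u) ≤ normSqM h (lapH h u) := by
    have := gradSqTM_diffX_add hh.ne' u
    have := gradSqTM_nonneg (h := h) (diffY h u)
    linarith
  have h6 : h * ∑ k, ((u (k + 1) j - u k j) / h) ^ 2 ≤
      (1 / L + 1) * gradSqTM h u + normSqM h (lapH h u) := by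
    refine (show h * ∑ k, ((u (k + 1) j - u k j) / h) ^ 2 = h * ∑ k, diffX h u k j ^ 2 from rfl) ▸
      h3.trans ?_
    gcongr
  refine h1.trans ?_
  gcongr

end

section

/-! ### Lipschitz representatives of `W^{1,∞}(0, T; X)` -/

open Filter Topology in
lemma ae_norm_le_of_memLp_top {α X : Type*} [NormedAddCommGroup X] {mα : MeasurableSpace α}
    {ν : Measure α} {g : α → X} (hg : MemLp g ⊤ ν) :
    ∃ B : ℝ, 0 ≤ B ∧ ∀ᵐ t ∂ν, ‖g t‖ ≤ B := by
  refine ⟨(eLpNorm g ⊤ ν).toReal, ENNReal.toReal_nonneg, ?_⟩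
  have h1 := ae_le_eLpNormEssSup (f := g) (μ := ν)
  have h2 : eLpNorm g ⊤ ν ≠ ⊤ := hg.2.ne
  filter_upwards [h1] with t ht
  rw [← eLpNorm_exponent_top] at ht
  have := ENNReal.toReal_mono h2 ht
  simpa using this

open Filter Topology in
/-- Testing the weak derivative with a smoothed indicator of `[s, t]`. -/
lemma norm_convolution_sub_le {X : Type*} [NormedAddCommGroup X] [NormedSpace ℝ X]
    {T : ℝ} {u g : ℝ → X} {B : ℝ}
    (hu : Integrable u (volume.restrict (Ioo 0 T)))
    (hg : ∀ᵐ t ∂(volume.restrict (Ioo 0 T)), ‖g t‖ ≤ B)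
    (hw : IsWeakTimeDeriv T 1 u g) (f : ContDiffBump (0 : ℝ)) {s t : ℝ} (hst : s ≤ t)
    (hs : f.rOut < s) (ht : t + f.rOut < T) :
    ‖(∫ τ in Ioo 0 T, f.normed volume (s - τ) • u τ) -
      ∫ τ in Ioo 0 T, f.normed volume (t - τ) • u τ‖ ≤ B * (t - s + 2 * f.rOut) := by
  set ρ := f.normed volume with hρ
  have hρc : Continuous ρ := f.continuous_normed
  have hr := f.rOut_pos
  have hρ0 : ∀ x, f.rOut ≤ |x| → ρ x = 0 := by
    intro x hx
    have : x ∉ Function.support ρ := by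
      rw [hρ, f.support_normed_eq]
      simpa using hx
    simpa using this
  have hρi : Integrable ρ := f.integrable_normed
  set P : ℝ → ℝ := fun x => ∫ y in (0 : ℝ)..x, ρ y with hP
  have hPd : ∀ x, HasDerivAt P (ρ x) x := fun x =>
    intervalIntegral.integral_hasDerivAt_right (hρc.intervalIntegrable _ _)
      (hρc.stronglyMeasurableAtFilter _ _) hρc.continuousAt
  have hPs : ContDiff ℝ ((⊤ : ℕ∞) : WithTop ℕ∞) P := by
    rw [contDiff_infty_iff_deriv]
    refine ⟨fun x => (hPd x).differentiableAt, ?_⟩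
    rw [show deriv P = ρ from funext fun x => (hPd x).deriv]
    exact f.contDiff_normed
  -- `ψ` is the indicator of `[s, t]` convolved with the bump: its derivative is the difference of
  -- the two translated bumps, it takes values in `[0, 1]`, and its support lies in `[s - rOut, t +
  -- rOut]`.
  set ψ : ℝ → ℝ := fun τ => P (t - τ) - P (s - τ) with hψ
  have hψi : ∀ τ, ψ τ = ∫ y in (s - τ)..(t - τ), ρ y := fun τ =>
    intervalIntegral.integral_interval_sub_left (hρc.intervalIntegrable _ _)
      (hρc.intervalIntegrable _ _)
  have hψs : ContDiff ℝ ((⊤ : ℕ∞) : WithTop ℕ∞) ψ :=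
    (hPs.comp (contDiff_const.sub contDiff_id)).sub (hPs.comp (contDiff_const.sub contDiff_id))
  have hψd : ∀ τ, iteratedDeriv 1 ψ τ = ρ (s - τ) - ρ (t - τ) := by
    intro τ
    rw [iteratedDeriv_one]
    have h1 := (hPd (t - τ)).comp τ ((hasDerivAt_id τ).const_sub t)
    have h2 := (hPd (s - τ)).comp τ ((hasDerivAt_id τ).const_sub s)
    have h3 : HasDerivAt ψ (ρ (t - τ) * -1 - ρ (s - τ) * -1) τ := h1.sub h2
    rw [h3.deriv]
    ring
  have hψ0 : ∀ τ, τ ∉ Icc (s - f.rOut) (t + f.rOut) → ψ τ = 0 := by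
    intro τ hτ
    rw [hψi]
    refine intervalIntegral.integral_zero_ae (Eventually.of_forall fun y hy => hρ0 y ?_)
    rw [uIoc_of_le (by linarith)] at hy
    rw [mem_Icc, not_and_or, not_le, not_le] at hτ
    rcases hτ with hτ | hτ
    · exact le_abs.2 (Or.inl (by linarith [hy.1]))
    · exact le_abs.2 (Or.inr (by linarith [hy.2]))
  have hsub : tsupport ψ ⊆ Icc (s - f.rOut) (t + f.rOut) :=
    closure_minimal (fun τ hτ => by_contra fun h => hτ (hψ0 τ h)) isClosed_Icc
  have hIcc : Icc (s - f.rOut) (t + f.rOut) ⊆ Ioo 0 T := fun x hx =>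
    ⟨by linarith [hx.1], by linarith [hx.2]⟩
  have hcs : HasCompactSupport ψ := HasCompactSupport.intro isCompact_Icc hψ0
  have key := hw ψ hψs hcs (hsub.trans hIcc)
  have hψ1 : ∀ τ, |ψ τ| ≤ 1 := by
    intro τ
    rw [hψi, intervalIntegral.integral_of_le (by linarith), abs_of_nonneg
      (integral_nonneg fun y => f.nonneg_normed y)]
    refine (setIntegral_le_integral hρi (Eventually.of_forall fun y => f.nonneg_normed y)).trans ?_
    exact f.integral_normed.le
  have hint : ∀ x, Integrable (fun τ => ρ (x - τ) • u τ) (volume.restrict (Ioo 0 T)) := by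
    intro x
    obtain ⟨c, hc⟩ := hρc.bounded_above_of_compact_support f.hasCompactSupport_normed
    exact hu.bdd_smul c (hρc.comp (continuous_const.sub continuous_id)).aestronglyMeasurable
      (Eventually.of_forall fun τ => hc _)
  have hL : ∫ τ in Ioo 0 T, iteratedDeriv 1 ψ τ • u τ =
      (∫ τ in Ioo 0 T, ρ (s - τ) • u τ) - ∫ τ in Ioo 0 T, ρ (t - τ) • u τ := by
    rw [← integral_sub (hint s) (hint t)]
    simp only [hψd, sub_smul]
  rw [← hL, key, norm_smul]
  simp only [pow_one, norm_neg, norm_one, one_mul]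
  calc ‖∫ τ in Ioo 0 T, ψ τ • g τ‖
      ≤ ∫ τ in Ioo 0 T, (Icc (s - f.rOut) (t + f.rOut)).indicator (fun _ => B) τ := by
        refine norm_integral_le_of_norm_le ?_ ?_
        · exact (integrable_const B).indicator measurableSet_Icc
        · filter_upwards [hg] with τ hτ
          by_cases hm : τ ∈ Icc (s - f.rOut) (t + f.rOut)
          · rw [indicator_of_mem hm, norm_smul, Real.norm_eq_abs]
            calc |ψ τ| * ‖g τ‖ ≤ 1 * B := by gcongr; exact hψ1 τ
              _ = B := one_mul B
          · rw [indicator_of_notMem hm, hψ0 τ hm]; simp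
    _ = B * (t - s + 2 * f.rOut) := by
        rw [integral_indicator measurableSet_Icc, Measure.restrict_restrict measurableSet_Icc,
          inter_eq_left.2 hIcc, setIntegral_const, smul_eq_mul, measureReal_def, Real.volume_Icc,
          ENNReal.toReal_ofReal (by linarith)]
        ring

-- The mollified curves are Lipschitz with the essential bound of the weak derivative as constant,
-- up to an error that vanishes with the radius. They converge almost everywhere, and `S` is the set
-- of times of convergence.
open Filter Topology in
lemma exists_lipschitz_of_memWTime {X : Type*} [NormedAddCommGroup X] [NormedSpace ℝ X]
    [CompleteSpace X] {T : ℝ} {u : ℝ → X} (hu : MemWTime T 1 u) :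
    ∃ C : ℝ, 0 ≤ C ∧ ∃ S : Set ℝ, (∀ᵐ t ∂(volume.restrict (Ioo 0 T)), t ∈ S) ∧
      ∀ s ∈ S, ∀ t ∈ S, ‖u t - u s‖ ≤ C * |t - s| := by
  obtain ⟨g, hg, hw⟩ := hu.2 1 le_rfl
  obtain ⟨B, hB, hgB⟩ := ae_norm_le_of_memLp_top hg
  have hui : Integrable u (volume.restrict (Ioo 0 T)) := hu.1.integrable le_top
  have hind : LocallyIntegrable ((Ioo 0 T).indicator u) :=
    ((integrable_indicator_iff measurableSet_Ioo).2 hui).locallyIntegrable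
  let f : ℕ → ContDiffBump (0 : ℝ) := fun n =>
    ⟨1 / (2 * (n + 1)), 1 / (n + 1), by positivity, by
      have : (0 : ℝ) < n + 1 := by positivity
      gcongr; linarith⟩
  have hf : ∀ n, (f n).rOut = 1 / ((n : ℝ) + 1) := fun n => rfl
  have hf0 : Tendsto (fun n => (f n).rOut) atTop (𝓝 0) := tendsto_one_div_add_atTop_nhds_zero_nat
  have hconv := ContDiffBump.ae_convolution_tendsto_right_of_locallyIntegrable (μ := volume)
    (φ := f) (K := 2) hf0 (Eventually.of_forall fun n => by
      simp only [f]; field_simp; exact le_rfl) hind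
  have hcv : ∀ n x, convolution ((f n).normed volume) ((Ioo 0 T).indicator u)
      (ContinuousLinearMap.lsmul ℝ ℝ) volume x =
      ∫ τ in Ioo 0 T, (f n).normed volume (x - τ) • u τ := by
    intro n x
    rw [convolution_eq_swap, ← integral_indicator measurableSet_Ioo]
    congr 1
    ext τ
    by_cases hτ : τ ∈ Ioo 0 T <;> simp [hτ]
  simp only [hcv] at hconv
  refine ⟨B, hB, {x | x ∈ Ioo 0 T ∧ Tendsto (fun n => ∫ τ in Ioo 0 T,
    (f n).normed volume (x - τ) • u τ) atTop (𝓝 (u x))}, ?_, ?_⟩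
  · filter_upwards [ae_restrict_of_ae hconv, ae_restrict_mem measurableSet_Ioo] with x hx hm
    refine ⟨hm, ?_⟩
    simpa [hm] using hx
  · have main : ∀ s t, s ≤ t → s ∈ Ioo 0 T → t ∈ Ioo 0 T →
        Tendsto (fun n => ∫ τ in Ioo 0 T, (f n).normed volume (s - τ) • u τ) atTop (𝓝 (u s)) →
        Tendsto (fun n => ∫ τ in Ioo 0 T, (f n).normed volume (t - τ) • u τ) atTop (𝓝 (u t)) →
        ‖u s - u t‖ ≤ B * (t - s) := by
      intro s t hst hs ht h1 h2
      have hlim : Tendsto (fun n => B * (t - s + 2 * (f n).rOut)) atTop (𝓝 (B * (t - s + 2 * 0))) :=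
        ((hf0.const_mul 2).const_add (t - s)).const_mul B
      rw [mul_zero, add_zero] at hlim
      refine le_of_tendsto_of_tendsto (h1.sub h2).norm hlim ?_
      filter_upwards [hf0.eventually_lt_const hs.1, hf0.eventually_lt_const (sub_pos.2 ht.2)]
        with n hn1 hn2
      exact norm_convolution_sub_le hui hgB hw (f n) hst hn1 (by linarith)
    rintro s ⟨hs, hs'⟩ t ⟨ht, ht'⟩
    rcases le_total s t with hst | hst
    · rw [abs_of_nonneg (by linarith), norm_sub_rev]
      exact main s t hst hs ht hs' ht'
    · rw [abs_of_nonpos (by linarith), neg_sub]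
      exact main t s hst ht hs ht' hs'

end

section

/-! ### Periodic mollification -/

lemma vol_eq_prod (L : ℝ) :
    vol L = ((volume : Measure ℝ).restrict (Ioo 0 L)).prod (volume.restrict (Ioo 0 L)) := by
  rw [vol, square, Measure.prod_restrict, Measure.volume_eq_prod]

instance (L : ℝ) : IsFiniteMeasure (vol L) := by
  rw [vol_eq_prod]; infer_instance

lemma integral_Ioo_eq {L : ℝ} (hL : 0 ≤ L) (f : ℝ → ℝ) :
    ∫ x in Ioo 0 L, f x = ∫ x in (0 : ℝ)..L, f x := by
  rw [intervalIntegral.integral_of_le hL, integral_Ioc_eq_integral_Ioo]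

lemma integral_vol {L : ℝ} (hL : 0 ≤ L) {f : ℝ × ℝ → ℝ} (hf : Integrable f (vol L)) :
    ∫ p, f p ∂(vol L) = ∫ x in (0 : ℝ)..L, ∫ y in (0 : ℝ)..L, f (x, y) := by
  rw [vol_eq_prod] at hf ⊢
  rw [integral_prod _ hf, integral_Ioo_eq hL]
  simp only [integral_Ioo_eq hL]

lemma integrable_vol_of_continuous {L : ℝ} {f : ℝ × ℝ → ℝ} (hf : Continuous f) :
    Integrable f (vol L) := by
  have : IntegrableOn f (Icc 0 L ×ˢ Icc 0 L) :=
    hf.continuousOn.integrableOn_compact (isCompact_Icc.prod isCompact_Icc)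
  exact this.mono_set (prod_mono Ioo_subset_Icc_self Ioo_subset_Icc_self)

/-- A smooth nonnegative `L`-periodic kernel of unit mass. -/
structure PerKernel (L : ℝ) (k : ℝ → ℝ) : Prop where
  smooth : ContDiff ℝ ((⊤ : ℕ∞) : WithTop ℕ∞) k
  periodic : Function.Periodic k L
  nonneg : ∀ x, 0 ≤ k x
  mass : ∫ x in (0 : ℝ)..L, k x = 1

/-- The derivative `∂ₓ^i ∂_y^j` of the convolution of `u` with `k ⊗ k` over the period square. -/
def mol (L : ℝ) (k : ℝ → ℝ) (i j : ℕ) (u : ℝ × ℝ → ℝ) (p : ℝ × ℝ) : ℝ :=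
  ∫ q, u q * (iteratedDeriv i k (p.1 - q.1) * iteratedDeriv j k (p.2 - q.2)) ∂(vol L)

lemma iterate_dX_dY_mul {a b : ℝ → ℝ} (ha : ContDiff ℝ ((⊤ : ℕ∞) : WithTop ℕ∞) a)
    (hb : ContDiff ℝ ((⊤ : ℕ∞) : WithTop ℕ∞) b) (i j : ℕ) :
    dX^[i] (dY^[j] fun q => a q.1 * b q.2) =
      fun q => iteratedDeriv i a q.1 * iteratedDeriv j b q.2 := by
  have hd : ∀ (c : ℝ → ℝ), ContDiff ℝ ((⊤ : ℕ∞) : WithTop ℕ∞) c → ∀ n x,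
      HasDerivAt (iteratedDeriv n c) (iteratedDeriv (n + 1) c x) x := by
    intro c hc n x
    rw [iteratedDeriv_succ]
    exact ((hc.differentiable_iteratedDeriv n (by exact_mod_cast ENat.natCast_lt_top n)) x).hasDerivAt
  have hfd : ∀ m n q, HasFDerivAt (fun q : ℝ × ℝ => iteratedDeriv m a q.1 * iteratedDeriv n b q.2)
      (iteratedDeriv m a q.1 • (iteratedDeriv (n + 1) b q.2 • ContinuousLinearMap.snd ℝ ℝ ℝ) +
        iteratedDeriv n b q.2 • (iteratedDeriv (m + 1) a q.1 • ContinuousLinearMap.fst ℝ ℝ ℝ)) q :=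
    fun m n q =>
      ((hd a ha m q.1).comp_hasFDerivAt q hasFDerivAt_fst).mul
        ((hd b hb n q.2).comp_hasFDerivAt q hasFDerivAt_snd)
  have hY : dY^[j] (fun q => a q.1 * b q.2) = fun q => iteratedDeriv 0 a q.1 * iteratedDeriv j b q.2 := by
    induction j with
    | zero => simp
    | succ j ih =>
      rw [Function.iterate_succ', Function.comp, ih]
      ext q
      rw [dY, (hfd 0 j q).fderiv]
      simp
  rw [hY]
  induction i with
  | zero => rfl
  | succ i ih =>
    rw [Function.iterate_succ', Function.comp, ih]
    ext q
    rw [dX, (hfd i j q).fderiv]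
    simp [mul_comm]

namespace PerKernel

variable {L : ℝ} {k : ℝ → ℝ}

lemma contDiff_iteratedDeriv (hk : PerKernel L k) (n : ℕ) :
    ContDiff ℝ ((⊤ : ℕ∞) : WithTop ℕ∞) (iteratedDeriv n k) := by
  induction n with
  | zero => simpa using hk.smooth
  | succ n ih =>
    rw [iteratedDeriv_succ]
    exact (contDiff_infty_iff_deriv.1 ih).2

lemma hasDerivAt_iteratedDeriv (hk : PerKernel L k) (n : ℕ) (x : ℝ) :
    HasDerivAt (iteratedDeriv n k) (iteratedDeriv (n + 1) k x) x := by
  rw [iteratedDeriv_succ]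
  exact ((contDiff_infty_iff_deriv.1 (hk.contDiff_iteratedDeriv n)).1 x).hasDerivAt

lemma continuous_iteratedDeriv (hk : PerKernel L k) (n : ℕ) : Continuous (iteratedDeriv n k) :=
  (hk.contDiff_iteratedDeriv n).continuous

lemma periodic_iteratedDeriv (hk : PerKernel L k) (n : ℕ) :
    Function.Periodic (iteratedDeriv n k) L := by
  intro x
  have h1 := congrFun (iteratedDeriv_comp_add_const (n := n) (f := k) (s := L)) x
  rw [show (fun z => k (z + L)) = k from funext hk.periodic] at h1
  exact h1.symm

lemma exists_bound (hk : PerKernel L k) (hL : 0 < L) (n : ℕ) :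
    ∃ C, 0 ≤ C ∧ ∀ x, |iteratedDeriv n k x| ≤ C := by
  obtain ⟨C, hC⟩ := ((hk.periodic_iteratedDeriv n).isBounded_of_continuous hL.ne'
    (hk.continuous_iteratedDeriv n)).exists_norm_le
  refine ⟨C, (norm_nonneg _).trans (hC _ (mem_range_self 0)), fun x => hC _ (mem_range_self x)⟩

lemma integral_sub_left (hk : PerKernel L k) (x : ℝ) : ∫ q in (0 : ℝ)..L, k (x - q) = 1 := by
  rw [intervalIntegral.integral_comp_sub_left (fun q => k q) x, sub_zero]
  have := hk.periodic.intervalIntegral_add_eq (x - L) 0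
  rw [sub_add_cancel, zero_add] at this
  rw [this, hk.mass]

lemma integral_sub_right (hk : PerKernel L k) (q : ℝ) : ∫ x in (0 : ℝ)..L, k (x - q) = 1 := by
  rw [intervalIntegral.integral_comp_sub_right (fun q => k q) q]
  have := hk.periodic.intervalIntegral_add_eq (0 - q) 0
  rw [zero_add, show 0 - q + L = L - q by ring] at this
  rw [this, hk.mass]

lemma integral_kernel_left (hk : PerKernel L k) (hL : 0 < L) (p : ℝ × ℝ) :
    ∫ q, k (p.1 - q.1) * k (p.2 - q.2) ∂(vol L) = 1 := by
  rw [vol_eq_prod, integral_prod_mul (fun x => k (p.1 - x)) (fun x => k (p.2 - x)),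
    integral_Ioo_eq hL.le, integral_Ioo_eq hL.le, hk.integral_sub_left, hk.integral_sub_left,
    one_mul]

lemma integral_kernel_right (hk : PerKernel L k) (hL : 0 < L) (q : ℝ × ℝ) :
    ∫ p, k (p.1 - q.1) * k (p.2 - q.2) ∂(vol L) = 1 := by
  rw [vol_eq_prod, integral_prod_mul (fun x => k (x - q.1)) (fun x => k (x - q.2)),
    integral_Ioo_eq hL.le, integral_Ioo_eq hL.le, hk.integral_sub_right, hk.integral_sub_right,
    one_mul]

lemma integrable_mul (hk : PerKernel L k) (hL : 0 < L) {u : ℝ × ℝ → ℝ}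
    (hu : Integrable u (vol L)) (i j : ℕ) (p : ℝ × ℝ) :
    Integrable (fun q => u q * (iteratedDeriv i k (p.1 - q.1) * iteratedDeriv j k (p.2 - q.2)))
      (vol L) := by
  obtain ⟨A, hA0, hA⟩ := hk.exists_bound hL i
  obtain ⟨B, hB0, hB⟩ := hk.exists_bound hL j
  have ci := hk.continuous_iteratedDeriv i
  have cj := hk.continuous_iteratedDeriv j
  refine hu.mul_bdd (c := A * B) (Continuous.aestronglyMeasurable (by fun_prop))
    (Filter.Eventually.of_forall fun q => ?_)
  rw [Real.norm_eq_abs, abs_mul]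
  exact mul_le_mul (hA _) (hB _) (abs_nonneg _) hA0

lemma hasDerivAt_mol_left (hk : PerKernel L k) (hL : 0 < L) {u : ℝ × ℝ → ℝ}
    (hu : Integrable u (vol L)) (i j : ℕ) (x y : ℝ) :
    HasDerivAt (fun x => mol L k i j u (x, y)) (mol L k (i + 1) j u (x, y)) x := by
  obtain ⟨A, hA0, hA⟩ := hk.exists_bound hL (i + 1)
  obtain ⟨B, hB0, hB⟩ := hk.exists_bound hL j
  refine (hasDerivAt_integral_of_dominated_loc_of_deriv_le (s := univ) Filter.univ_mem
    (F := fun x q => u q * (iteratedDeriv i k (x - q.1) * iteratedDeriv j k (y - q.2)))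
    (F' := fun x q => u q * (iteratedDeriv (i + 1) k (x - q.1) * iteratedDeriv j k (y - q.2)))
    (bound := fun q => ‖u q‖ * (A * B))
    (Filter.Eventually.of_forall fun x => (hk.integrable_mul hL hu i j (x, y)).1)
    (hk.integrable_mul hL hu i j (x, y)) (hk.integrable_mul hL hu (i + 1) j (x, y)).1
    (Filter.Eventually.of_forall fun q x _ => ?_) (hu.norm.mul_const _)
    (Filter.Eventually.of_forall fun q x _ => ?_)).2
  · simp only [norm_mul, Real.norm_eq_abs]
    gcongr
    exacts [hA _, hB _]
  · have h1 := (hk.hasDerivAt_iteratedDeriv i (x - q.1)).comp_sub_const x q.1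
    exact (h1.mul_const _).const_mul _

lemma hasDerivAt_mol_right (hk : PerKernel L k) (hL : 0 < L) {u : ℝ × ℝ → ℝ}
    (hu : Integrable u (vol L)) (i j : ℕ) (x y : ℝ) :
    HasDerivAt (fun y => mol L k i j u (x, y)) (mol L k i (j + 1) u (x, y)) y := by
  obtain ⟨A, hA0, hA⟩ := hk.exists_bound hL i
  obtain ⟨B, hB0, hB⟩ := hk.exists_bound hL (j + 1)
  refine (hasDerivAt_integral_of_dominated_loc_of_deriv_le (s := univ) Filter.univ_mem
    (F := fun y q => u q * (iteratedDeriv i k (x - q.1) * iteratedDeriv j k (y - q.2)))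
    (F' := fun y q => u q * (iteratedDeriv i k (x - q.1) * iteratedDeriv (j + 1) k (y - q.2)))
    (bound := fun q => ‖u q‖ * (A * B))
    (Filter.Eventually.of_forall fun y => (hk.integrable_mul hL hu i j (x, y)).1)
    (hk.integrable_mul hL hu i j (x, y)) (hk.integrable_mul hL hu i (j + 1) (x, y)).1
    (Filter.Eventually.of_forall fun q y _ => ?_) (hu.norm.mul_const _)
    (Filter.Eventually.of_forall fun q y _ => ?_)).2
  · simp only [norm_mul, Real.norm_eq_abs]
    gcongr
    exacts [hA _, hB _]
  · have h1 := (hk.hasDerivAt_iteratedDeriv j (y - q.2)).comp_sub_const y q.2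
    exact (h1.const_mul _).const_mul _

/-- The translated kernel is itself an admissible periodic test function. The sign from the weak
derivative cancels the one from differentiating `k (x - ·)`. -/
lemma mol_eq_of_isWeakDeriv (hk : PerKernel L k) {u g : ℝ × ℝ → ℝ} {i j : ℕ}
    (h : IsWeakDeriv L i j u g) : mol L k i j u = mol L k 0 0 g := by
  ext p
  have ha : ∀ x, ContDiff ℝ ((⊤ : ℕ∞) : WithTop ℕ∞) (fun q => k (x - q)) := fun x =>
    hk.smooth.comp (contDiff_const.sub contDiff_id)
  have h1 := h (fun q => k (p.1 - q.1) * k (p.2 - q.2))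
    (((ha p.1).comp contDiff_fst).mul ((ha p.2).comp contDiff_snd)) (fun x y => by
      have e : ∀ z w : ℝ, k (z - (w + L)) = k (z - w) := fun z w => by
        rw [← hk.periodic (z - (w + L))]; congr 1; ring
      simp only [e, and_self])
  rw [iterate_dX_dY_mul (ha p.1) (ha p.2)] at h1
  simp only [iteratedDeriv_comp_const_sub, smul_eq_mul] at h1
  have e1 : ∫ q, u q * ((-1) ^ i * iteratedDeriv i k (p.1 - q.1) *
      ((-1) ^ j * iteratedDeriv j k (p.2 - q.2))) ∂(vol L) = (-1) ^ (i + j) * mol L k i j u p := by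
    rw [mol, ← integral_const_mul]
    congr 1
    ext q
    ring
  rw [e1] at h1
  have := mul_left_cancel₀ (pow_ne_zero _ (by norm_num)) h1
  rw [this, mol]
  simp

lemma abs_mol_le (hk : PerKernel L k) (hL : 0 < L) {g : ℝ × ℝ → ℝ} {B : ℝ}
    (hgB : ∀ᵐ q ∂(vol L), |g q| ≤ B) (p : ℝ × ℝ) : |mol L k 0 0 g p| ≤ B := by
  have hb : Integrable (fun q => B * (k (p.1 - q.1) * k (p.2 - q.2))) (vol L) := by
    simpa using hk.integrable_mul hL (integrable_const B) 0 0 p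
  calc |mol L k 0 0 g p| ≤ ∫ q, B * (k (p.1 - q.1) * k (p.2 - q.2)) ∂(vol L) := by
        rw [← Real.norm_eq_abs, mol]
        refine norm_integral_le_of_norm_le hb ?_
        filter_upwards [hgB] with q hq
        have h0 := mul_nonneg (hk.nonneg (p.1 - q.1)) (hk.nonneg (p.2 - q.2))
        simp only [iteratedDeriv_zero, Real.norm_eq_abs]
        rw [abs_mul, abs_of_nonneg h0]
        exact mul_le_mul_of_nonneg_right hq h0
    _ = B := by rw [integral_const_mul, hk.integral_kernel_left hL, mul_one]

/-- Jensen's inequality for the probability density `k ⊗ k`: the variance about the mean `c` is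
nonnegative. -/
lemma mol_sq_le (hk : PerKernel L k) (hL : 0 < L) {g : ℝ × ℝ → ℝ} (hg : Integrable g (vol L))
    (hg2 : Integrable (fun q => g q ^ 2) (vol L)) (p : ℝ × ℝ) :
    mol L k 0 0 g p ^ 2 ≤ mol L k 0 0 (fun q => g q ^ 2) p := by
  set c := mol L k 0 0 g p with hc
  have i1 := hk.integrable_mul hL hg 0 0 p
  have i2 := hk.integrable_mul hL hg2 0 0 p
  have i3 : Integrable (fun q => k (p.1 - q.1) * k (p.2 - q.2)) (vol L) := by
    simpa using hk.integrable_mul hL (integrable_const (1 : ℝ)) 0 0 p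
  have h0 : 0 ≤ ∫ q, (g q - c) ^ 2 * (k (p.1 - q.1) * k (p.2 - q.2)) ∂(vol L) :=
    integral_nonneg fun q => mul_nonneg (sq_nonneg _) (mul_nonneg (hk.nonneg _) (hk.nonneg _))
  simp only [iteratedDeriv_zero] at i1 i2
  have e : ∫ q, (g q - c) ^ 2 * (k (p.1 - q.1) * k (p.2 - q.2)) ∂(vol L) =
      mol L k 0 0 (fun q => g q ^ 2) p - 2 * c * mol L k 0 0 g p + c ^ 2 := by
    have e1 : (fun q : ℝ × ℝ => (g q - c) ^ 2 * (k (p.1 - q.1) * k (p.2 - q.2))) = fun q =>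
        g q ^ 2 * (k (p.1 - q.1) * k (p.2 - q.2)) -
          2 * c * (g q * (k (p.1 - q.1) * k (p.2 - q.2))) +
          c ^ 2 * (k (p.1 - q.1) * k (p.2 - q.2)) := by ext q; ring
    have ha := integral_add (i2.sub (i1.const_mul (2 * c))) (i3.const_mul (c ^ 2))
    have hs := integral_sub i2 (i1.const_mul (2 * c))
    simp only [Pi.sub_apply] at ha
    rw [e1, ha, hs, integral_const_mul, integral_const_mul, hk.integral_kernel_left hL]
    simp [mol]
  rw [e, ← hc] at h0
  linarith

lemma continuous_mol (hk : PerKernel L k) (hL : 0 < L) {g : ℝ × ℝ → ℝ}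
    (hg : Integrable g (vol L)) (i j : ℕ) : Continuous (mol L k i j g) := by
  obtain ⟨A, hA0, hA⟩ := hk.exists_bound hL i
  obtain ⟨B, hB0, hB⟩ := hk.exists_bound hL j
  have ci := hk.continuous_iteratedDeriv i
  have cj := hk.continuous_iteratedDeriv j
  refine continuous_of_dominated (bound := fun q => ‖g q‖ * (A * B))
    (fun p => (hk.integrable_mul hL hg i j p).1)
    (fun p => Filter.Eventually.of_forall fun q => ?_) (hg.norm.mul_const _)
    (Filter.Eventually.of_forall fun q => by fun_prop)
  simp only [norm_mul, Real.norm_eq_abs]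
  gcongr
  exacts [hA _, hB _]

lemma integral_mol (hk : PerKernel L k) (hL : 0 < L) {g : ℝ × ℝ → ℝ} (hg : Integrable g (vol L)) :
    ∫ p, mol L k 0 0 g p ∂(vol L) = ∫ q, g q ∂(vol L) := by
  obtain ⟨A, hA0, hA⟩ := hk.exists_bound hL 0
  have ck := hk.continuous_iteratedDeriv 0
  simp only [mol]
  rw [integral_integral_swap]
  · congr 1
    ext q
    simp only [iteratedDeriv_zero]
    rw [integral_const_mul, hk.integral_kernel_right hL, mul_one]
  · refine Integrable.mul_bdd (c := A * A) (hg.comp_snd (vol L))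
      (Continuous.aestronglyMeasurable (by fun_prop)) (Filter.Eventually.of_forall fun z => ?_)
    rw [Real.norm_eq_abs, abs_mul]
    exact mul_le_mul (hA _) (hA _) (abs_nonneg _) hA0

lemma integral_mol_sq_le (hk : PerKernel L k) (hL : 0 < L) {g : ℝ × ℝ → ℝ}
    (hg : Integrable g (vol L)) (hg2 : Integrable (fun q => g q ^ 2) (vol L)) :
    ∫ p, mol L k 0 0 g p ^ 2 ∂(vol L) ≤ ∫ q, g q ^ 2 ∂(vol L) := by
  rw [← hk.integral_mol hL hg2]
  exact integral_mono (integrable_vol_of_continuous ((hk.continuous_mol hL hg 0 0).pow 2))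
    (integrable_vol_of_continuous (hk.continuous_mol hL hg2 0 0))
    fun p => hk.mol_sq_le hL hg hg2 p

end PerKernel

end

/-! ### Powers of the raised cosine as a periodic approximate identity -/

section

/-- The raised cosine, which peaks at the multiples of `L`. -/
def raisedCos (L x : ℝ) : ℝ := (1 + Real.cos (2 * Real.pi * x / L)) / 2

/-- Normalised powers of the raised cosine. -/
def cosKernel (L : ℝ) (n : ℕ) (x : ℝ) : ℝ :=
  (∫ y in (0 : ℝ)..L, raisedCos L y ^ n)⁻¹ * raisedCos L x ^ n

lemma continuous_raisedCos (L : ℝ) : Continuous (raisedCos L) := by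
  unfold raisedCos; fun_prop

lemma raisedCos_nonneg (L x : ℝ) : 0 ≤ raisedCos L x := by
  unfold raisedCos; linarith [Real.neg_one_le_cos (2 * Real.pi * x / L)]

lemma raisedCos_le_one (L x : ℝ) : raisedCos L x ≤ 1 := by
  unfold raisedCos; linarith [Real.cos_le_one (2 * Real.pi * x / L)]

lemma raisedCos_zero (L : ℝ) : raisedCos L 0 = 1 := by simp [raisedCos]

lemma raisedCos_periodic {L : ℝ} (hL : 0 < L) : Function.Periodic (raisedCos L) L := by
  intro x
  unfold raisedCos
  rw [show 2 * Real.pi * (x + L) / L = 2 * Real.pi * x / L + 2 * Real.pi by field_simp,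
    Real.cos_add_two_pi]

lemma raisedCos_lt_one {L : ℝ} (hL : 0 < L) {x : ℝ} (hx : x ∈ Icc (-(L / 2)) (L / 2))
    (h0 : x ≠ 0) : raisedCos L x < 1 := by
  have hpi := Real.pi_pos
  have h1 : |2 * Real.pi * x / L| < 2 * Real.pi := by
    rw [abs_div, abs_mul, abs_of_pos hL, abs_of_pos (by positivity : 0 < 2 * Real.pi),
      div_lt_iff₀ hL]
    have : |x| ≤ L / 2 := abs_le.2 hx
    nlinarith
  have h2 : Real.cos (2 * Real.pi * x / L) ≠ 1 := by
    intro h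
    rw [Real.cos_eq_one_iff_of_lt_of_lt (by linarith [(abs_lt.1 h1).1]) (abs_lt.1 h1).2] at h
    have : 2 * Real.pi * x / L ≠ 0 := by positivity
    exact this h
  have h3 := lt_of_le_of_ne (Real.cos_le_one (2 * Real.pi * x / L)) h2
  unfold raisedCos
  linarith

lemma integral_raisedCos_pow_pos {L : ℝ} (hL : 0 < L) (n : ℕ) :
    0 < ∫ y in (0 : ℝ)..L, raisedCos L y ^ n :=
  intervalIntegral.integral_pos hL ((continuous_raisedCos L).pow n).continuousOn
    (fun x _ => pow_nonneg (raisedCos_nonneg L x) n)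
    ⟨0, ⟨le_rfl, hL.le⟩, by simp [raisedCos_zero]⟩

lemma perKernel_cosKernel {L : ℝ} (hL : 0 < L) (n : ℕ) : PerKernel L (cosKernel L n) where
  smooth := by
    unfold cosKernel raisedCos
    fun_prop
  periodic x := by simp only [cosKernel, raisedCos_periodic hL x]
  nonneg x := mul_nonneg (inv_nonneg.2 (integral_raisedCos_pow_pos hL n).le)
    (pow_nonneg (raisedCos_nonneg L x) n)
  mass := by
    unfold cosKernel
    rw [intervalIntegral.integral_const_mul, inv_mul_cancel₀ (integral_raisedCos_pow_pos hL n).ne']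

lemma integral_reflect {L : ℝ} {g : ℝ → ℝ} (hg : Function.Periodic g L) (x : ℝ) :
    ∫ q in (0 : ℝ)..L, g q = ∫ r in (-(L / 2))..(L / 2), g (x - r) := by
  rw [intervalIntegral.integral_comp_sub_left (fun q => g q) x]
  have := hg.intervalIntegral_add_eq (x - L / 2) 0
  rw [zero_add, show x - L / 2 + L = x - -(L / 2) by ring] at this
  exact this.symm

lemma IsPeriodic.fst {L : ℝ} {u : ℝ × ℝ → ℝ} (hu : IsPeriodic L u) (y : ℝ) :
    Function.Periodic (fun x => u (x, y)) L := fun x => (hu x y).1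

lemma IsPeriodic.snd {L : ℝ} {u : ℝ × ℝ → ℝ} (hu : IsPeriodic L u) (x : ℝ) :
    Function.Periodic (fun y => u (x, y)) L := fun y => (hu x y).2

/-- The period square centred at the origin. -/
def centredSquare (L : ℝ) : Set (ℝ × ℝ) := Icc (-(L / 2)) (L / 2) ×ˢ Icc (-(L / 2)) (L / 2)

lemma setIntegral_centredSquare {L : ℝ} (hL : 0 < L) {f : ℝ × ℝ → ℝ} (hf : Continuous f) :
    ∫ r in centredSquare L, f r =
      ∫ x in (-(L / 2))..(L / 2), ∫ y in (-(L / 2))..(L / 2), f (x, y) := by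
  have hi : IntegrableOn f (centredSquare L) :=
    hf.continuousOn.integrableOn_compact (isCompact_Icc.prod isCompact_Icc)
  have hle : -(L / 2) ≤ L / 2 := by linarith
  unfold centredSquare at *
  rw [Measure.volume_eq_prod] at *
  rw [setIntegral_prod _ hi, intervalIntegral.integral_of_le hle, integral_Icc_eq_integral_Ioc]
  simp only [intervalIntegral.integral_of_le hle, integral_Icc_eq_integral_Ioc]

/-- Moving the integral to the square centred at the origin displays the kernel as the `n`-th power
of one function with a single peak there, normalised by its mass. -/
lemma mol_cosKernel {L : ℝ} (hL : 0 < L) (n : ℕ) {u : ℝ × ℝ → ℝ} (hu : Continuous u)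
    (hper : IsPeriodic L u) (p : ℝ × ℝ) :
    mol L (cosKernel L n) 0 0 u p =
      (∫ r in centredSquare L, (raisedCos L r.1 * raisedCos L r.2) ^ n)⁻¹ •
        ∫ r in centredSquare L, (raisedCos L r.1 * raisedCos L r.2) ^ n • u (p - r) := by
  have cr := continuous_raisedCos L
  have cc : Continuous (raisedCos L) := cr
  have hk := perKernel_cosKernel hL n
  have ck : Continuous (cosKernel L n) := hk.smooth.continuous
  set I := ∫ y in (0 : ℝ)..L, raisedCos L y ^ n with hI
  have hIpos : 0 < I := integral_raisedCos_pow_pos hL n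
  have hper1 : Function.Periodic (fun y => raisedCos L y ^ n) L := fun x => by
    simp only [raisedCos_periodic hL x]
  have hI2 : ∫ r in (-(L / 2))..(L / 2), raisedCos L r ^ n = I := by
    have := hper1.intervalIntegral_add_eq (-(L / 2)) 0
    rw [zero_add, show -(L / 2) + L = L / 2 by ring] at this
    exact this
  have e1 : ∫ r in centredSquare L, (raisedCos L r.1 * raisedCos L r.2) ^ n = I * I := by
    rw [setIntegral_centredSquare hL (by fun_prop)]
    simp only [mul_pow, intervalIntegral.integral_const_mul, intervalIntegral.integral_mul_const,
      hI2]
  have e2 : mol L (cosKernel L n) 0 0 u p = ∫ r in centredSquare L,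
      u (p - r) * (cosKernel L n r.1 * cosKernel L n r.2) := by
    rw [setIntegral_centredSquare hL (by fun_prop), mol]
    simp only [iteratedDeriv_zero]
    rw [integral_vol hL.le (integrable_vol_of_continuous (by fun_prop))]
    have kp : ∀ z w : ℝ, cosKernel L n (z - (w + L)) = cosKernel L n (z - w) := fun z w => by
      rw [← hk.periodic (z - (w + L))]; congr 1; ring
    have hin : ∀ x, ∫ y in (0 : ℝ)..L, u (x, y) * (cosKernel L n (p.1 - x) * cosKernel L n (p.2 - y))
        = ∫ r in (-(L / 2))..(L / 2), u (x, p.2 - r) * (cosKernel L n (p.1 - x) * cosKernel L n r) := by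
      intro x
      rw [integral_reflect (g := fun y => u (x, y) * (cosKernel L n (p.1 - x) * cosKernel L n (p.2 - y)))
        (fun y => by simp only [(hper x y).2, kp]) p.2]
      simp only [sub_sub_cancel]
    simp only [hin]
    rw [integral_reflect (g := fun x => ∫ r in (-(L / 2))..(L / 2), u (x, p.2 - r) *
      (cosKernel L n (p.1 - x) * cosKernel L n r)) (fun x => by simp only [(hper x _).1, kp]) p.1]
    simp only [sub_sub_cancel]
    rfl
  rw [e1, e2, ← integral_smul]
  congr 1
  ext r
  simp only [cosKernel, smul_eq_mul, ← hI, mul_pow]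
  field_simp

-- On the centred square the product of the raised cosines has its unique maximum at the origin, so
-- its normalised powers concentrate there.
open Filter Topology in
lemma tendsto_mol_cosKernel {L : ℝ} (hL : 0 < L) {u : ℝ × ℝ → ℝ} (hu : Continuous u)
    (hper : IsPeriodic L u) (p : ℝ × ℝ) :
    Tendsto (fun n => mol L (cosKernel L n) 0 0 u p) atTop (𝓝 (u p)) := by
  have cc := continuous_raisedCos L
  have h := tendsto_setIntegral_pow_smul_of_unique_maximum_of_isCompact_of_continuousOn
    (μ := (volume : Measure (ℝ × ℝ))) (s := centredSquare L) (x₀ := (0 : ℝ × ℝ))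
    (c := fun r => raisedCos L r.1 * raisedCos L r.2) (g := fun r => u (p - r))
    (isCompact_Icc.prod isCompact_Icc) (by fun_prop) ?_
    (fun r _ => mul_nonneg (raisedCos_nonneg _ _) (raisedCos_nonneg _ _))
    (by simp [raisedCos_zero]) ?_ (by fun_prop)
  · simp only [sub_zero] at h
    refine h.congr fun n => ?_
    rw [mol_cosKernel hL n hu hper]
  · rintro ⟨x, y⟩ ⟨hx, hy⟩ hne
    simp only [Prod.fst_zero, Prod.snd_zero, raisedCos_zero, mul_one]
    have a1 := raisedCos_nonneg L x
    have a2 := raisedCos_nonneg L y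
    have b1 := raisedCos_le_one L x
    have b2 := raisedCos_le_one L y
    by_cases h0 : x = 0
    · have hy0 : y ≠ 0 := fun h => hne (by rw [h0, h]; rfl)
      nlinarith [raisedCos_lt_one hL hy hy0]
    · nlinarith [raisedCos_lt_one hL hx h0]
  · refine subset_closure ?_
    rw [centredSquare, interior_prod_eq, interior_Icc]
    exact ⟨⟨by simp; linarith, by simp; linarith⟩, ⟨by simp; linarith, by simp; linarith⟩⟩

end

section

/-! ### Finite differences of smooth functions -/

/-- The mean value inequality on `uIcc 0 r`. The factor `1 / (m + 1)` that integration would give is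
dropped; sharp constants are irrelevant here. Applied repeatedly in the step `r`, it yields the
Taylor bounds below. -/
lemma abs_le_pow_of_deriv {g g' : ℝ → ℝ} {K : ℝ} {m : ℕ} (hK : 0 ≤ K) (h0 : g 0 = 0)
    (hd : ∀ r, HasDerivAt g (g' r) r) (hb : ∀ r, |g' r| ≤ K * |r| ^ m) (r : ℝ) :
    |g r| ≤ K * |r| ^ (m + 1) := by
  have h := Convex.norm_image_sub_le_of_norm_hasDerivWithin_le (f := g) (f' := g') (s := uIcc 0 r)
    (x := 0) (y := r) (C := K * |r| ^ m) (fun x _ => (hd x).hasDerivWithinAt) (fun x hx => by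
      refine (hb x).trans ?_
      have : |x| ≤ |r| := by simpa using abs_sub_left_of_mem_uIcc hx
      gcongr) (convex_uIcc _ _) left_mem_uIcc right_mem_uIcc
  rw [h0, sub_zero, sub_zero, Real.norm_eq_abs, Real.norm_eq_abs] at h
  rw [pow_succ, ← mul_assoc]
  exact h

lemma abs_sub_le_of_deriv {f f1 : ℝ → ℝ} {B : ℝ} (hB : 0 ≤ B) (h1 : ∀ x, HasDerivAt f (f1 x) x)
    (hb : ∀ x, |f1 x| ≤ B) (x r : ℝ) : |f (x + r) - f x| ≤ B * |r| := by
  have := abs_le_pow_of_deriv (g := fun r => f (x + r) - f x) (g' := fun r => f1 (x + r)) (m := 0)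
    hB (by simp) (fun r => ((h1 (x + r)).comp_const_add x r).sub_const _)
    (fun r => by simpa using hb _) r
  simpa using this

lemma abs_second_diff_le {f f1 f2 : ℝ → ℝ} {B : ℝ} (hB : 0 ≤ B)
    (h1 : ∀ x, HasDerivAt f (f1 x) x) (h2 : ∀ x, HasDerivAt f1 (f2 x) x)
    (hb : ∀ x, |f2 x| ≤ B) (x r : ℝ) : |f (x + r) + f (x - r) - 2 * f x| ≤ 2 * B * r ^ 2 := by
  have := abs_le_pow_of_deriv (g := fun r => f (x + r) + f (x - r) - 2 * f x)
    (g' := fun r => f1 (x + r) - f1 (x - r)) (m := 1) (K := 2 * B)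
    (by positivity) (by simp; ring)
    (fun r => by
      have := (((h1 (x + r)).comp_const_add x r).add ((h1 (x - r)).comp_const_sub x r)).sub_const
        (2 * f x)
      simpa [sub_eq_add_neg] using this)
    (fun r => by
      have := abs_sub_le_of_deriv hB h2 hb (x - r) (2 * r)
      rw [show x - r + 2 * r = x + r by ring, abs_mul, abs_two] at this
      simpa [mul_comm, mul_left_comm] using this) r
  simpa using this

/-- Differentiating the remainder twice in `r` leaves the second difference of `f2`, which four
derivatives of `f` control. -/
lemma abs_second_diff_sub_le {f f1 f2 f3 f4 : ℝ → ℝ} {B : ℝ} (hB : 0 ≤ B)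
    (h1 : ∀ x, HasDerivAt f (f1 x) x) (h2 : ∀ x, HasDerivAt f1 (f2 x) x)
    (h3 : ∀ x, HasDerivAt f2 (f3 x) x) (h4 : ∀ x, HasDerivAt f3 (f4 x) x)
    (hb : ∀ x, |f4 x| ≤ B) (x r : ℝ) :
    |f (x + r) + f (x - r) - 2 * f x - r ^ 2 * f2 x| ≤ 2 * B * r ^ 4 := by
  have hs : ∀ r, |f1 (x + r) - f1 (x - r) - 2 * r * f2 x| ≤ 2 * B * |r| ^ 3 :=
    abs_le_pow_of_deriv (g := fun r => f1 (x + r) - f1 (x - r) - 2 * r * f2 x)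
      (g' := fun r => f2 (x + r) + f2 (x - r) - 2 * f2 x) (m := 2) (K := 2 * B)
      (by positivity) (by simp)
      (fun r => by
        have := (((h2 (x + r)).comp_const_add x r).sub ((h2 (x - r)).comp_const_sub x r)).sub
          (((hasDerivAt_id r).const_mul 2).mul_const (f2 x))
        exact this.congr_deriv (by ring))
      (fun r => by simpa using abs_second_diff_le hB h3 h4 hb x r)
  have := abs_le_pow_of_deriv (g := fun r => f (x + r) + f (x - r) - 2 * f x - r ^ 2 * f2 x)
    (g' := fun r => f1 (x + r) - f1 (x - r) - 2 * r * f2 x) (m := 3) (K := 2 * B)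
    (by positivity) (by simp; ring)
    (fun r => by
      have := ((((h1 (x + r)).comp_const_add x r).add ((h1 (x - r)).comp_const_sub x r)).sub_const
        (2 * f x)).sub (((hasDerivAt_id r).pow 2).mul_const (f2 x))
      exact this.congr_deriv (by simp; ring)) hs r
  rwa [show |r| ^ (3 + 1) = r ^ 4 from Even.pow_abs (by decide) r] at this

/-- The five-point Laplacian with step `δ`. -/
def lapD (δ : ℝ) (u : ℝ × ℝ → ℝ) (p : ℝ × ℝ) : ℝ :=
  1 / δ ^ 2 * (u (p.1 + δ, p.2) + u (p.1, p.2 + δ) + u (p.1 - δ, p.2) + u (p.1, p.2 - δ) - 4 * u p)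

/-- First and second differences of `g` in the axis directions are of first and second order, up to
the perturbation `η`. -/
structure DiffBound (B η : ℝ) (g : ℝ × ℝ → ℝ) : Prop where
  lipX : ∀ x y r, |g (x + r, y) - g (x, y)| ≤ B * |r| + η
  lipY : ∀ x y r, |g (x, y + r) - g (x, y)| ≤ B * |r| + η
  secX : ∀ x y r, |g (x + r, y) + g (x - r, y) - 2 * g (x, y)| ≤ B * r ^ 2 + η
  secY : ∀ x y r, |g (x, y + r) + g (x, y - r) - 2 * g (x, y)| ≤ B * r ^ 2 + η

/-- Finite difference form of membership in a ball of `W^{4,∞}`. -/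
structure FDBound (B : ℝ) (u : ℝ × ℝ → ℝ) : Prop where
  bound : ∀ p, |u p| ≤ B
  diff : DiffBound B 0 u
  lap : ∀ δ δ' : ℝ, 0 < δ → 0 < δ' → ∀ p, |lapD δ u p - lapD δ' u p| ≤ B * (δ ^ 2 + δ' ^ 2)
  lap_diff : ∀ δ : ℝ, 0 < δ → DiffBound B (B * δ ^ 2) (lapD δ u)

open Filter Topology in
lemma DiffBound.of_tendsto {ι : Type*} {l : Filter ι} [l.NeBot] {B η : ℝ}
    {g : ι → ℝ × ℝ → ℝ} {g' : ℝ × ℝ → ℝ} (hg : ∀ᶠ n in l, DiffBound B η (g n))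
    (hlim : ∀ p, Tendsto (fun n => g n p) l (𝓝 (g' p))) : DiffBound B η g' where
  lipX x y r := le_of_tendsto ((hlim _).sub (hlim _)).abs (hg.mono fun _ h => h.lipX x y r)
  lipY x y r := le_of_tendsto ((hlim _).sub (hlim _)).abs (hg.mono fun _ h => h.lipY x y r)
  secX x y r := le_of_tendsto (((hlim _).add (hlim _)).sub ((hlim _).const_mul 2)).abs
    (hg.mono fun _ h => h.secX x y r)
  secY x y r := le_of_tendsto (((hlim _).add (hlim _)).sub ((hlim _).const_mul 2)).abs
    (hg.mono fun _ h => h.secY x y r)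

open Filter Topology in
lemma tendsto_lapD {ι : Type*} {l : Filter ι} {g : ι → ℝ × ℝ → ℝ} {g' : ℝ × ℝ → ℝ}
    (hlim : ∀ p, Tendsto (fun n => g n p) l (𝓝 (g' p))) (δ : ℝ) (p : ℝ × ℝ) :
    Tendsto (fun n => lapD δ (g n) p) l (𝓝 (lapD δ g' p)) :=
  (((((hlim _).add (hlim _)).add (hlim _)).add (hlim _)).sub ((hlim _).const_mul 4)).const_mul _

open Filter Topology in
lemma FDBound.of_tendsto {ι : Type*} {l : Filter ι} [l.NeBot] {B : ℝ}
    {g : ι → ℝ × ℝ → ℝ} {g' : ℝ × ℝ → ℝ} (hg : ∀ᶠ n in l, FDBound B (g n))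
    (hlim : ∀ p, Tendsto (fun n => g n p) l (𝓝 (g' p))) : FDBound B g' where
  bound p := le_of_tendsto (hlim p).abs (hg.mono fun _ h => h.bound p)
  diff := DiffBound.of_tendsto (hg.mono fun _ h => h.diff) hlim
  lap δ δ' hδ hδ' p := le_of_tendsto ((tendsto_lapD hlim δ p).sub (tendsto_lapD hlim δ' p)).abs
    (hg.mono fun _ h => h.lap δ δ' hδ hδ' p)
  lap_diff δ hδ := DiffBound.of_tendsto (hg.mono fun _ h => h.lap_diff δ hδ) (tendsto_lapD hlim δ)

/-- `W i j` are the classical partial derivatives of `W 0 0`, bounded by `B` up to order four. -/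
structure DerivFamily (B : ℝ) (W : ℕ → ℕ → ℝ × ℝ → ℝ) : Prop where
  derivX : ∀ i j x y, HasDerivAt (fun x => W i j (x, y)) (W (i + 1) j (x, y)) x
  derivY : ∀ i j x y, HasDerivAt (fun y => W i j (x, y)) (W i (j + 1) (x, y)) y
  bound : ∀ i j, i + j ≤ 4 → ∀ p, |W i j p| ≤ B

namespace DerivFamily

variable {B : ℝ} {W : ℕ → ℕ → ℝ × ℝ → ℝ}

lemma nonneg (hW : DerivFamily B W) : 0 ≤ B := (abs_nonneg _).trans (hW.bound 0 0 (by simp) 0)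

lemma diffBound (hW : DerivFamily B W) {i j : ℕ} (hij : i + j ≤ 2) :
    DiffBound (2 * B) 0 (W i j) where
  lipX x y r := by
    have := abs_sub_le_of_deriv hW.nonneg (fun x => hW.derivX i j x y)
      (fun x => hW.bound (i + 1) j (by omega) _) x r
    have : 0 ≤ B * |r| := mul_nonneg hW.nonneg (abs_nonneg _)
    linarith
  lipY x y r := by
    have := abs_sub_le_of_deriv hW.nonneg (fun y => hW.derivY i j x y)
      (fun y => hW.bound i (j + 1) (by omega) _) y r
    have : 0 ≤ B * |r| := mul_nonneg hW.nonneg (abs_nonneg _)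
    linarith
  secX x y r := by
    have := abs_second_diff_le hW.nonneg (fun x => hW.derivX i j x y)
      (fun x => hW.derivX (i + 1) j x y) (fun x => hW.bound (i + 1 + 1) j (by omega) _) x r
    linarith
  secY x y r := by
    have := abs_second_diff_le hW.nonneg (fun y => hW.derivY i j x y)
      (fun y => hW.derivY i (j + 1) x y) (fun y => hW.bound i (j + 1 + 1) (by omega) _) y r
    linarith

lemma abs_lapD_sub_le (hW : DerivFamily B W) {δ : ℝ} (hδ : 0 < δ) (p : ℝ × ℝ) :
    |lapD δ (W 0 0) p - (W 2 0 p + W 0 2 p)| ≤ 4 * B * δ ^ 2 := by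
  obtain ⟨x, y⟩ := p
  have hx := abs_second_diff_sub_le hW.nonneg (fun x => hW.derivX 0 0 x y)
    (fun x => hW.derivX 1 0 x y) (fun x => hW.derivX 2 0 x y) (fun x => hW.derivX 3 0 x y)
    (fun x => hW.bound 4 0 (by omega) _) x δ
  have hy := abs_second_diff_sub_le hW.nonneg (fun y => hW.derivY 0 0 x y)
    (fun y => hW.derivY 0 1 x y) (fun y => hW.derivY 0 2 x y) (fun y => hW.derivY 0 3 x y)
    (fun y => hW.bound 0 4 (by omega) _) y δ
  simp only [Nat.reduceAdd] at hx hy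
  have e : lapD δ (W 0 0) (x, y) - (W 2 0 (x, y) + W 0 2 (x, y)) = 1 / δ ^ 2 *
      ((W 0 0 (x + δ, y) + W 0 0 (x - δ, y) - 2 * W 0 0 (x, y) - δ ^ 2 * W 2 0 (x, y)) +
      (W 0 0 (x, y + δ) + W 0 0 (x, y - δ) - 2 * W 0 0 (x, y) - δ ^ 2 * W 0 2 (x, y))) := by
    rw [lapD]; field_simp; ring
  rw [e, abs_mul, abs_of_pos (by positivity)]
  calc _ ≤ 1 / δ ^ 2 * (2 * B * δ ^ 4 + 2 * B * δ ^ 4) := by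
        gcongr
        exact (abs_add_le _ _).trans (add_le_add hx hy)
    _ = _ := by field_simp; ring

/-- The constant `16` comes from second differences of `lapD`: the consistency error `4 * B * δ ^ 2`
enters with total weight `1 + 1 + 2`. The differences of the true second derivatives cost less. -/
lemma fdBound (hW : DerivFamily B W) : FDBound (16 * B) (W 0 0) := by
  have hB := hW.nonneg
  have d0 := hW.diffBound (i := 0) (j := 0) (by omega)
  have d2 := hW.diffBound (i := 2) (j := 0) (by omega)
  have d2' := hW.diffBound (i := 0) (j := 2) (by omega)
  refine ⟨fun p => (hW.bound 0 0 (by omega) p).trans (by linarith), ?_, ?_, ?_⟩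
  · constructor
    · intro x y r; have := d0.lipX x y r; nlinarith [abs_nonneg r]
    · intro x y r; have := d0.lipY x y r; nlinarith [abs_nonneg r]
    · intro x y r; have := d0.secX x y r; nlinarith [sq_nonneg r]
    · intro x y r; have := d0.secY x y r; nlinarith [sq_nonneg r]
  · intro δ δ' hδ hδ' p
    have h1 := abs_le.1 (hW.abs_lapD_sub_le hδ p)
    have h2 := abs_le.1 (hW.abs_lapD_sub_le hδ' p)
    have : 0 ≤ B * δ ^ 2 := by positivity
    have : 0 ≤ B * δ' ^ 2 := by positivity
    rw [abs_le]
    constructor <;> linarith [h1.1, h1.2, h2.1, h2.2]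
  · intro δ hδ
    have hl := fun p => abs_le.1 (hW.abs_lapD_sub_le hδ p)
    have : 0 ≤ B * δ ^ 2 := by positivity
    constructor
    · intro x y r
      have h1 := hl (x + r, y); have h2 := hl (x, y)
      have h3 := abs_le.1 (d2.lipX x y r); have h4 := abs_le.1 (d2'.lipX x y r)
      have : 0 ≤ B * |r| := by positivity
      rw [abs_le]
      constructor <;> linarith [h1.1, h1.2, h2.1, h2.2, h3.1, h3.2, h4.1, h4.2]
    · intro x y r
      have h1 := hl (x, y + r); have h2 := hl (x, y)
      have h3 := abs_le.1 (d2.lipY x y r); have h4 := abs_le.1 (d2'.lipY x y r)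
      have : 0 ≤ B * |r| := by positivity
      rw [abs_le]
      constructor <;> linarith [h1.1, h1.2, h2.1, h2.2, h3.1, h3.2, h4.1, h4.2]
    · intro x y r
      have h1 := hl (x + r, y); have h2 := hl (x, y); have h5 := hl (x - r, y)
      have h3 := abs_le.1 (d2.secX x y r); have h4 := abs_le.1 (d2'.secX x y r)
      have : 0 ≤ B * r ^ 2 := by positivity
      rw [abs_le]
      constructor <;> linarith [h1.1, h1.2, h2.1, h2.2, h3.1, h3.2, h4.1, h4.2, h5.1, h5.2]
    · intro x y r
      have h1 := hl (x, y + r); have h2 := hl (x, y); have h5 := hl (x, y - r)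
      have h3 := abs_le.1 (d2.secY x y r); have h4 := abs_le.1 (d2'.secY x y r)
      have : 0 ≤ B * r ^ 2 := by positivity
      rw [abs_le]
      constructor <;> linarith [h1.1, h1.2, h2.1, h2.2, h3.1, h3.2, h4.1, h4.2, h5.1, h5.2]

end DerivFamily

end

section

/-! ### Quadrature on periodic grids -/

lemma sq_integral_le {f : ℝ → ℝ} (hf : Continuous f) {a b : ℝ} (hab : a < b) :
    (∫ x in a..b, f x) ^ 2 ≤ (b - a) * ∫ x in a..b, f x ^ 2 := by
  set I := ∫ x in a..b, f x with hI
  have hba : 0 < b - a := sub_pos.2 hab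
  set c := I / (b - a) with hc
  have h0 : 0 ≤ ∫ x in a..b, (f x - c) ^ 2 :=
    intervalIntegral.integral_nonneg hab.le fun x _ => sq_nonneg _
  have e : ∫ x in a..b, (f x - c) ^ 2 = (∫ x in a..b, f x ^ 2) - 2 * c * I + c ^ 2 * (b - a) := by
    have e1 : (fun x => (f x - c) ^ 2) = fun x => f x ^ 2 - 2 * c * f x + c ^ 2 := by
      ext x; ring
    rw [e1, intervalIntegral.integral_add
      (Continuous.intervalIntegrable (by fun_prop) _ _)
      (Continuous.intervalIntegrable (by fun_prop) _ _),
      intervalIntegral.integral_sub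
      (Continuous.intervalIntegrable (by fun_prop) _ _)
      (Continuous.intervalIntegrable (by fun_prop) _ _),
      intervalIntegral.integral_const_mul, intervalIntegral.integral_const, smul_eq_mul]
    ring
  rw [e] at h0
  have h1 := mul_nonneg hba.le h0
  have h2 : (b - a) * ((∫ x in a..b, f x ^ 2) - 2 * c * I + c ^ 2 * (b - a)) =
      (b - a) * (∫ x in a..b, f x ^ 2) - I ^ 2 := by
    rw [hc]; field_simp; ring
  linarith

/-- Folding the cell about its midpoint makes twice the quadrature error an integral of second
differences. -/
lemma abs_cell_sub_le {f : ℝ → ℝ} {K h : ℝ} (hf : Continuous f) (hh : 0 < h)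
    (hs : ∀ x r, |f (x + r) + f (x - r) - 2 * f x| ≤ K * r ^ 2) (x : ℝ) :
    |h * f x - ∫ y in (x - h / 2)..(x + h / 2), f y| ≤ K * h ^ 3 := by
  have hK : 0 ≤ K := by simpa using (abs_nonneg _).trans (hs 0 1)
  have e1 : ∫ r in (-(h / 2))..(h / 2), f (x + r) = ∫ y in (x - h / 2)..(x + h / 2), f y := by
    rw [intervalIntegral.integral_comp_add_left (fun y => f y) x]; rfl
  have e2 : ∫ r in (-(h / 2))..(h / 2), f (x - r) = ∫ y in (x - h / 2)..(x + h / 2), f y := by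
    rw [intervalIntegral.integral_comp_sub_left (fun y => f y) x, sub_neg_eq_add]
  have e3 : ∫ r in (-(h / 2))..(h / 2), (f (x + r) + f (x - r) - 2 * f x) =
      2 * (∫ y in (x - h / 2)..(x + h / 2), f y) - 2 * (h * f x) := by
    rw [intervalIntegral.integral_sub
      (Continuous.intervalIntegrable (by fun_prop) _ _)
      (Continuous.intervalIntegrable (by fun_prop) _ _),
      intervalIntegral.integral_add
      (Continuous.intervalIntegrable (by fun_prop) _ _)
      (Continuous.intervalIntegrable (by fun_prop) _ _), e1, e2, intervalIntegral.integral_const,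
      smul_eq_mul]
    ring
  have h4 := intervalIntegral.norm_integral_le_of_norm_le_const (a := -(h / 2)) (b := h / 2)
    (C := K * h ^ 2) (f := fun r => f (x + r) + f (x - r) - 2 * f x) (fun r hr => by
      refine (hs x r).trans ?_
      rw [uIoc_of_le (by linarith)] at hr
      have : r ^ 2 ≤ h ^ 2 := sq_le_sq' (by linarith [hr.1]) (by linarith [hr.2])
      gcongr)
  rw [e3, Real.norm_eq_abs, show h / 2 - -(h / 2) = h by ring, abs_of_pos hh] at h4
  have h5 := abs_le.1 h4
  have : 0 ≤ K * h ^ 3 := by positivity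
  rw [abs_le]
  constructor <;> nlinarith [h5.1, h5.2]

/-- The cells centred at the nodes tile `[-h/2, L - h/2]`, which is one full period. -/
lemma sum_cells {N : ℕ} [NeZero N] {L h : ℝ} (hN : h = L / N) {f : ℝ → ℝ} (hf : Continuous f)
    (hper : Function.Periodic f L) :
    ∑ i : ZMod N, ∫ y in ((i.val : ℝ) * h - h / 2)..((i.val : ℝ) * h + h / 2), f y =
      ∫ y in (0 : ℝ)..L, f y := by
  have hN0 : (N : ℝ) ≠ 0 := Nat.cast_ne_zero.mpr (NeZero.ne N)
  rw [sum_zmod_eq_sum_range (fun i => ∫ y in ((i : ℝ) * h - h / 2)..((i : ℝ) * h + h / 2), f y)]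
  have := intervalIntegral.sum_integral_adjacent_intervals (f := f) (μ := volume)
    (a := fun i : ℕ => (i : ℝ) * h - h / 2) (n := N)
    (fun k _ => hf.intervalIntegrable _ _)
  have e : ∀ k : ℕ, ((k + 1 : ℕ) : ℝ) * h - h / 2 = (k : ℝ) * h + h / 2 := fun k => by
    push_cast; ring
  simp only [e] at this
  rw [this]
  have hp := hper.intervalIntegral_add_eq (-(h / 2)) 0
  rw [zero_add] at hp
  rw [← hp]
  congr 1
  · simp
  · rw [hN]; field_simp; ring

lemma abs_sum_sub_integral_le {N : ℕ} [NeZero N] {L h K : ℝ} (hL : 0 < L) (hN : h = L / N)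
    {f : ℝ → ℝ} (hf : Continuous f) (hper : Function.Periodic f L)
    (hs : ∀ x r, |f (x + r) + f (x - r) - 2 * f x| ≤ K * r ^ 2) :
    |h * ∑ i : ZMod N, f (i.val * h) - ∫ y in (0 : ℝ)..L, f y| ≤ L * K * h ^ 2 := by
  have hNpos : (0 : ℝ) < N := Nat.cast_pos.mpr (NeZero.pos N)
  have hh : 0 < h := by rw [hN]; positivity
  rw [← sum_cells hN hf hper, Finset.mul_sum, ← Finset.sum_sub_distrib]
  refine (Finset.abs_sum_le_sum_abs _ _).trans ?_
  refine (Finset.sum_le_sum fun i _ => abs_cell_sub_le hf hh hs _).trans ?_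
  rw [Finset.sum_const, Finset.card_univ, ZMod.card, nsmul_eq_mul]
  have : (N : ℝ) * h = L := by rw [hN]; field_simp
  rw [← this]
  apply le_of_eq
  ring

/-- The quadrature error is estimated for `f` on each cell and squared afterwards, which leaves `h ^
4`; the rectangle rule applied to `f²` would leave only `h ^ 2`. Cauchy–Schwarz bounds the squared
cell integral. -/
lemma sum_sq_le_integral_sq {N : ℕ} [NeZero N] {L h K : ℝ} (hL : 0 < L) (hN : h = L / N)
    {f : ℝ → ℝ} (hf : Continuous f) (hper : Function.Periodic f L)
    (hs : ∀ x r, |f (x + r) + f (x - r) - 2 * f x| ≤ K * r ^ 2) :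
    h * ∑ i : ZMod N, f (i.val * h) ^ 2 ≤
      2 * (∫ y in (0 : ℝ)..L, f y ^ 2) + 2 * L * K ^ 2 * h ^ 4 := by
  have hNpos : (0 : ℝ) < N := Nat.cast_pos.mpr (NeZero.pos N)
  have hh : 0 < h := by rw [hN]; positivity
  have hK : 0 ≤ K := by simpa using (abs_nonneg _).trans (hs 0 1)
  have hper2 : Function.Periodic (fun x => f x ^ 2) L := fun x => by simp only [hper x]
  rw [← sum_cells hN (f := fun x => f x ^ 2) (by fun_prop) hper2, Finset.mul_sum, Finset.mul_sum]
  have hNh : L = (N : ℝ) * h := by rw [hN]; field_simp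
  have hc : 2 * L * K ^ 2 * h ^ 4 = ∑ _i : ZMod N, 2 * K ^ 2 * h ^ 5 := by
    rw [Finset.sum_const, Finset.card_univ, ZMod.card, nsmul_eq_mul, hNh]; ring
  rw [hc, ← Finset.sum_add_distrib]
  refine Finset.sum_le_sum fun i _ => ?_
  set x : ℝ := i.val * h
  have h1 := abs_cell_sub_le hf hh hs x
  have h2 := sq_integral_le hf (show x - h / 2 < x + h / 2 by linarith)
  rw [show x + h / 2 - (x - h / 2) = h by ring] at h2
  set I := ∫ y in (x - h / 2)..(x + h / 2), f y
  set J := ∫ y in (x - h / 2)..(x + h / 2), f y ^ 2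
  have h3 : (h * f x - I) ^ 2 ≤ (K * h ^ 3) ^ 2 := sq_le_sq' (abs_le.1 h1).1 (abs_le.1 h1).2
  have h4 : (h * f x) ^ 2 ≤ 2 * I ^ 2 + 2 * (h * f x - I) ^ 2 := by nlinarith [sq_nonneg (h * f x - 2 * I)]
  have h5 : h * (h * f x ^ 2) ≤ h * (2 * J + 2 * K ^ 2 * h ^ 5) := by nlinarith
  exact le_of_mul_le_mul_left h5 hh

section TwoDim

variable {N : ℕ} [NeZero N] {L h K : ℝ} {g : ℝ × ℝ → ℝ}

/-- The rectangle rule is of second order. -/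
lemma abs_sum_sub_integral_vol_le (hL : 0 < L) (hN : h = L / N)
    (hg : Continuous g) (hper : IsPeriodic L g)
    (hsX : ∀ x y r, |g (x + r, y) + g (x - r, y) - 2 * g (x, y)| ≤ K * r ^ 2)
    (hsY : ∀ x y r, |g (x, y + r) + g (x, y - r) - 2 * g (x, y)| ≤ K * r ^ 2) :
    |h ^ 2 * ∑ i : ZMod N, ∑ j : ZMod N, g (i.val * h, j.val * h) - ∫ p, g p ∂(vol L)| ≤
      2 * L ^ 2 * K * h ^ 2 := by
  have hNpos : (0 : ℝ) < N := Nat.cast_pos.mpr (NeZero.pos N)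
  have hh : 0 < h := by rw [hN]; positivity
  have hNh : (N : ℝ) * h = L := by rw [hN]; field_simp
  have h1 : ∀ j : ZMod N, |h * ∑ i : ZMod N, g (i.val * h, j.val * h) -
      ∫ x in (0 : ℝ)..L, g (x, j.val * h)| ≤ L * K * h ^ 2 := fun j =>
    abs_sum_sub_integral_le hL hN (f := fun x => g (x, j.val * h)) (by fun_prop) (hper.fst _)
      fun x r => hsX x _ r
  have h2 : ∀ x, |h * ∑ j : ZMod N, g (x, j.val * h) - ∫ y in (0 : ℝ)..L, g (x, y)| ≤
      L * K * h ^ 2 := fun x =>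
    abs_sum_sub_integral_le hL hN (f := fun y => g (x, y)) (by fun_prop) (hper.snd _)
      fun y r => hsY x y r
  rw [integral_vol hL.le (integrable_vol_of_continuous hg), Finset.sum_comm]
  have cin : Continuous fun x => ∫ y in (0 : ℝ)..L, g (x, y) :=
    intervalIntegral.continuous_parametric_intervalIntegral_of_continuous' (by fun_prop) _ _
  have e1 : h ^ 2 * ∑ j : ZMod N, ∑ i : ZMod N, g (i.val * h, j.val * h) -
      (∫ x in (0 : ℝ)..L, ∫ y in (0 : ℝ)..L, g (x, y)) =
      h * ∑ j : ZMod N, (h * ∑ i : ZMod N, g (i.val * h, j.val * h) -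
        ∫ x in (0 : ℝ)..L, g (x, j.val * h)) +
      ∫ x in (0 : ℝ)..L, (h * ∑ j : ZMod N, g (x, j.val * h) - ∫ y in (0 : ℝ)..L, g (x, y)) := by
    rw [intervalIntegral.integral_sub (Continuous.intervalIntegrable (by fun_prop) _ _)
      (cin.intervalIntegrable _ _), intervalIntegral.integral_const_mul,
      intervalIntegral.integral_finsetSum
        (fun j _ => Continuous.intervalIntegrable (by fun_prop) _ _),
      Finset.sum_sub_distrib, ← Finset.mul_sum]
    ring
  rw [e1]
  have h3 : |h * ∑ j : ZMod N, (h * ∑ i : ZMod N, g (i.val * h, j.val * h) -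
        ∫ x in (0 : ℝ)..L, g (x, j.val * h))| ≤ L ^ 2 * K * h ^ 2 := by
    rw [abs_mul, abs_of_pos hh]
    calc _ ≤ h * ∑ _j : ZMod N, L * K * h ^ 2 := by
          gcongr
          exact (Finset.abs_sum_le_sum_abs _ _).trans (Finset.sum_le_sum fun j _ => h1 j)
      _ = _ := by
          rw [Finset.sum_const, Finset.card_univ, ZMod.card, nsmul_eq_mul, ← hNh]; ring
  have h4 := intervalIntegral.norm_integral_le_of_norm_le_const (a := 0) (b := L)
    (C := L * K * h ^ 2)
    (f := fun x => h * ∑ j : ZMod N, g (x, j.val * h) - ∫ y in (0 : ℝ)..L, g (x, y))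
    (fun x _ => h2 x)
  rw [Real.norm_eq_abs, sub_zero, abs_of_pos hL] at h4
  refine (abs_add_le _ _).trans ?_
  linarith

lemma sum_sq_le_integral_vol_sq (hL : 0 < L) (hN : h = L / N)
    (hg : Continuous g) (hper : IsPeriodic L g)
    (hsX : ∀ x y r, |g (x + r, y) + g (x - r, y) - 2 * g (x, y)| ≤ K * r ^ 2)
    (hsY : ∀ x y r, |g (x, y + r) + g (x, y - r) - 2 * g (x, y)| ≤ K * r ^ 2) :
    h ^ 2 * ∑ i : ZMod N, ∑ j : ZMod N, g (i.val * h, j.val * h) ^ 2 ≤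
      4 * (∫ p, g p ^ 2 ∂(vol L)) + 6 * L ^ 2 * K ^ 2 * h ^ 4 := by
  have hNpos : (0 : ℝ) < N := Nat.cast_pos.mpr (NeZero.pos N)
  have hh : 0 < h := by rw [hN]; positivity
  have hNh : (N : ℝ) * h = L := by rw [hN]; field_simp
  have h1 : ∀ j : ZMod N, h * ∑ i : ZMod N, g (i.val * h, j.val * h) ^ 2 ≤
      2 * (∫ x in (0 : ℝ)..L, g (x, j.val * h) ^ 2) + 2 * L * K ^ 2 * h ^ 4 := fun j =>
    sum_sq_le_integral_sq hL hN (f := fun x => g (x, j.val * h)) (by fun_prop) (hper.fst _)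
      fun x r => hsX x _ r
  have h2 : ∀ x, h * ∑ j : ZMod N, g (x, j.val * h) ^ 2 ≤
      2 * (∫ y in (0 : ℝ)..L, g (x, y) ^ 2) + 2 * L * K ^ 2 * h ^ 4 := fun x =>
    sum_sq_le_integral_sq hL hN (f := fun y => g (x, y)) (by fun_prop) (hper.snd _)
      fun y r => hsY x y r
  rw [integral_vol hL.le (integrable_vol_of_continuous (f := fun p => g p ^ 2) (by fun_prop)),
    Finset.sum_comm]
  have cin : Continuous fun x => ∫ y in (0 : ℝ)..L, g (x, y) ^ 2 :=
    intervalIntegral.continuous_parametric_intervalIntegral_of_continuous' (by fun_prop) _ _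
  have h3 : ∫ x in (0 : ℝ)..L, h * ∑ j : ZMod N, g (x, j.val * h) ^ 2 ≤
      ∫ x in (0 : ℝ)..L, (2 * (∫ y in (0 : ℝ)..L, g (x, y) ^ 2) + 2 * L * K ^ 2 * h ^ 4) :=
    intervalIntegral.integral_mono hL.le (Continuous.intervalIntegrable (by fun_prop) _ _)
      (Continuous.intervalIntegrable (by fun_prop) _ _) h2
  rw [intervalIntegral.integral_add ((cin.const_mul 2).intervalIntegrable _ _)
    (Continuous.intervalIntegrable (by fun_prop) _ _), intervalIntegral.integral_const_mul,
    intervalIntegral.integral_const, intervalIntegral.integral_const_mul,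
    intervalIntegral.integral_finsetSum
        (fun j _ => Continuous.intervalIntegrable (by fun_prop) _ _), smul_eq_mul, sub_zero] at h3
  have h4 : h ^ 2 * ∑ j : ZMod N, ∑ i : ZMod N, g (i.val * h, j.val * h) ^ 2 ≤
      h * ∑ j : ZMod N, (2 * (∫ x in (0 : ℝ)..L, g (x, j.val * h) ^ 2) + 2 * L * K ^ 2 * h ^ 4) := by
    rw [sq h, mul_assoc, Finset.mul_sum (a := h)]
    gcongr with j _
    exact h1 j
  rw [Finset.sum_add_distrib, Finset.sum_const, Finset.card_univ, ZMod.card, nsmul_eq_mul,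
    ← Finset.mul_sum] at h4
  have e : h * ((N : ℝ) * (2 * L * K ^ 2 * h ^ 4)) = 2 * L ^ 2 * K ^ 2 * h ^ 4 := by
    rw [← hNh]; ring
  rw [mul_add, e] at h4
  linarith

end TwoDim

/-! ### Sampling -/

/-- At the last index the representative jumps back to `0`, and periodicity of `f` makes up for the
jump. -/
lemma periodic_val_add_one {N : ℕ} [NeZero N] {L h : ℝ} (hN : h = L / N) {f : ℝ → ℝ}
    (hf : Function.Periodic f L) (i : ZMod N) :
    f (((i + 1).val : ℝ) * h) = f ((i.val : ℝ) * h + h) := by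
  have hN0 : (N : ℝ) ≠ 0 := Nat.cast_ne_zero.mpr (NeZero.ne N)
  have hNh : (N : ℝ) * h = L := by rw [hN]; field_simp
  by_cases hi : i.val + 1 < N
  · have h1 : (i + 1).val = i.val + 1 := by
      have e : i + 1 = ((i.val + 1 : ℕ) : ZMod N) := by push_cast; rw [ZMod.natCast_zmod_val]
      rw [e, ZMod.val_natCast_of_lt hi]
    rw [h1]; push_cast; congr 1; ring
  · have h2 : i.val + 1 = N := le_antisymm (ZMod.val_lt i) (not_lt.1 hi)
    have h1 : i + 1 = 0 := by
      have e : i + 1 = ((i.val + 1 : ℕ) : ZMod N) := by push_cast; rw [ZMod.natCast_zmod_val]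
      rw [e, h2, ZMod.natCast_self]
    have h3 : (i.val : ℝ) * h + h = 0 + L := by
      have h4 : (i.val : ℝ) + 1 = N := by exact_mod_cast h2
      rw [← hNh, ← h4]; ring
    rw [h1, h3, hf 0, ZMod.val_zero]
    simp

lemma periodic_val_sub_one {N : ℕ} [NeZero N] {L h : ℝ} (hN : h = L / N) {f : ℝ → ℝ}
    (hf : Function.Periodic f L) (i : ZMod N) :
    f (((i - 1).val : ℝ) * h) = f ((i.val : ℝ) * h - h) := by
  have hf' : Function.Periodic (fun x => f (x - h)) L := fun x => by
    simp only
    rw [show x + L - h = x - h + L by ring, hf]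
  have := periodic_val_add_one hN hf' (i - 1)
  simp only [sub_add_cancel, add_sub_cancel_right] at this
  exact this.symm

lemma lapH_sample {N : ℕ} [NeZero N] {L h : ℝ} (hN : h = L / N) {u : ℝ × ℝ → ℝ}
    (hu : IsPeriodic L u) (i j : ZMod N) :
    lapH h (sample L N u) i j = lapD h u (i.val * h, j.val * h) := by
  simp only [lapH, sample, lapD, ← hN]
  rw [periodic_val_add_one hN (hu.fst _), periodic_val_add_one hN (hu.snd _),
    periodic_val_sub_one hN (hu.fst _), periodic_val_sub_one hN (hu.snd _)]

end

section

/-! ### Finite difference bounds for the exact solution -/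

variable {L T ε M : ℝ} {F : ℝ → ℝ} {φ : ℝ → ℝ × ℝ → ℝ}

lemma abs_le_norm_Lp_top (f : Lp ℝ ⊤ (vol L)) : ∀ᵐ q ∂(vol L), |f q| ≤ ‖f‖ := by
  filter_upwards [ae_le_eLpNormEssSup (f := f) (μ := vol L)] with q hq
  rw [← eLpNorm_exponent_top] at hq
  have := ENNReal.toReal_mono (Lp.eLpNorm_ne_top f) hq
  rw [Lp.norm_def]
  simpa using this

/-- The mollified weak derivatives are the classical derivatives of the mollified function, and
averaging against a probability kernel does not increase the `L^∞` bound. Hence `B` does not depend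
on `n`. -/
lemma ae_fdBound (hL : 0 < L)
    (hcont : ∀ t ∈ Icc 0 T, Continuous (φ t)) (hreg : MemBochnerSobolev L T 0 4 ⊤ φ) :
    ∃ B : ℝ, 0 ≤ B ∧ ∀ᵐ t ∂(volume.restrict (Ioo 0 T)), t ∈ Icc 0 T ∧
      ∀ n, DerivFamily B (fun i j => mol L (cosKernel L n) i j (φ t)) := by
  obtain ⟨D, hD, hDW⟩ := hreg
  have hb : ∀ i j : ℕ, ∃ b : ℝ, 0 ≤ b ∧
      (i + j ≤ 4 → ∀ᵐ t ∂(volume.restrict (Ioo 0 T)), ‖D i j t‖ ≤ b) := by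
    intro i j
    by_cases hij : i + j ≤ 4
    · obtain ⟨b, hb0, hb⟩ := ae_norm_le_of_memLp_top (hDW i j hij).1
      exact ⟨b, hb0, fun _ => hb⟩
    · exact ⟨0, le_rfl, fun h => absurd h hij⟩
  choose b hb0 hb using hb
  set B := ∑ i ∈ Finset.range 5, ∑ j ∈ Finset.range 5, b i j with hB
  have hbB : ∀ i j, i + j ≤ 4 → b i j ≤ B := by
    intro i j hij
    calc b i j ≤ ∑ j ∈ Finset.range 5, b i j :=
          Finset.single_le_sum (fun j _ => hb0 i j) (Finset.mem_range.2 (by omega))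
      _ ≤ B := Finset.single_le_sum (f := fun i => ∑ j ∈ Finset.range 5, b i j)
          (fun i _ => Finset.sum_nonneg fun j _ => hb0 i j) (Finset.mem_range.2 (by omega))
  refine ⟨B, Finset.sum_nonneg fun i _ => Finset.sum_nonneg fun j _ => hb0 i j, ?_⟩
  have hall : ∀ᵐ t ∂(volume.restrict (Ioo 0 T)), ∀ i j, i + j ≤ 4 → ‖D i j t‖ ≤ b i j := by
    simp only [ae_all_iff]
    exact fun i j hij => hb i j hij
  filter_upwards [hD, hall, ae_restrict_mem measurableSet_Ioo] with t ht htb htm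
  have htI : t ∈ Icc 0 T := Ioo_subset_Icc_self htm
  refine ⟨htI, fun n => ?_⟩
  have hk := perKernel_cosKernel hL n
  have hint : Integrable (φ t) (vol L) := integrable_vol_of_continuous (hcont t htI)
  refine ⟨fun i j x y => hk.hasDerivAt_mol_left hL hint i j x y,
    fun i j x y => hk.hasDerivAt_mol_right hL hint i j x y, fun i j hij p => ?_⟩
  rw [hk.mol_eq_of_isWeakDeriv (ht.2 i j hij)]
  refine hk.abs_mol_le hL ?_ p
  filter_upwards [abs_le_norm_Lp_top (D i j t)] with q hq
  exact hq.trans ((htb i j hij).trans (hbB i j hij))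

lemma IsAllenCahnSolution.continuousWithinAt (hsol : IsAllenCahnSolution L T ε M F φ) {t : ℝ}
    (ht : t ∈ Icc 0 T) (p : ℝ × ℝ) : ContinuousWithinAt (fun τ => φ τ p) (Icc 0 T) t :=
  (hsol.equation t ht p).continuousWithinAt

/-- A set of full measure is dense. This carries closed conditions from almost every time to every
time, the end points included. -/
lemma subset_closure_of_ae {S : Set ℝ} (hT : 0 < T)
    (hS : ∀ᵐ t ∂(volume.restrict (Ioo 0 T)), t ∈ S) : Icc 0 T ⊆ closure (S ∩ Ioo 0 T) := by
  rw [ae_restrict_iff' measurableSet_Ioo] at hS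
  have h1 := Measure.dense_of_ae hS
  have h2 := h1.open_subset_closure_inter (isOpen_Ioo (a := (0 : ℝ)) (b := T))
  rw [← closure_Ioo hT.ne]
  refine closure_minimal (h2.trans (closure_mono fun x hx => ⟨hx.2 hx.1, hx.1⟩)) isClosed_closure

-- Two limits: the mollification is removed at almost every time, and the pointwise continuity of
-- `φ` in time reaches the remaining times. Finite difference bounds are stable under both.
open Filter Topology in
lemma exists_fdBound (hL : 0 < L) (hT : 0 < T) (hsol : IsAllenCahnSolution L T ε M F φ)
    (hreg : MemBochnerSobolev L T 0 4 ⊤ φ) :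
    ∃ B : ℝ, ∀ t ∈ Icc 0 T, FDBound B (φ t) := by
  have hc : ∀ t ∈ Icc 0 T, Continuous (φ t) := fun t ht => (hsol.contDiff t ht).continuous
  obtain ⟨B, -, hB⟩ := ae_fdBound hL hc hreg
  refine ⟨16 * B, fun t ht => ?_⟩
  set S := {t | t ∈ Icc 0 T ∧ ∀ n, DerivFamily B (fun i j => mol L (cosKernel L n) i j (φ t))}
  have hS : ∀ τ ∈ S, FDBound (16 * B) (φ τ) := fun τ hτ =>
    FDBound.of_tendsto (l := atTop) (Eventually.of_forall fun n => (hτ.2 n).fdBound)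
      (tendsto_mol_cosKernel hL (hc τ hτ.1) (hsol.periodic τ hτ.1))
  have hcl : t ∈ closure (S ∩ Ioo 0 T) := subset_closure_of_ae hT hB ht
  have : (𝓝[S ∩ Ioo 0 T] t).NeBot := mem_closure_iff_nhdsWithin_neBot.1 hcl
  refine FDBound.of_tendsto (l := 𝓝[S ∩ Ioo 0 T] t) (g := φ)
    (eventually_mem_nhdsWithin.mono fun τ hτ => hS τ hτ.1) fun p => ?_
  exact (hsol.continuousWithinAt ht p).mono_left
    (nhdsWithin_mono _ fun x hx => Ioo_subset_Icc_self hx.2)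

lemma integral_sq_Lp_two (g : Lp ℝ 2 (vol L)) :
    Integrable g (vol L) ∧ Integrable (fun q => g q ^ 2) (vol L) ∧
      ∫ q, g q ^ 2 ∂(vol L) = ‖g‖ ^ 2 := by
  have hm := Lp.memLp g
  refine ⟨hm.integrable (by norm_num), hm.integrable_sq, ?_⟩
  rw [← real_inner_self_eq_norm_sq, L2.inner_def]
  simp [sq]

/-- Grid form of an `L²` bound for a mollified function. -/
lemma sum_mol_sq_le {N : ℕ} [NeZero N] {h K : ℝ} (hL : 0 < L) (hN : h = L / N) {k : ℝ → ℝ}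
    (hk : PerKernel L k) (g : Lp ℝ 2 (vol L)) (hd : DiffBound K 0 (mol L k 0 0 g)) :
    normSqM h (sample L N (mol L k 0 0 g)) ≤ 4 * ‖g‖ ^ 2 + 6 * L ^ 2 * K ^ 2 * h ^ 4 := by
  obtain ⟨h1, h2, h3⟩ := integral_sq_Lp_two g
  have hper : IsPeriodic L (mol L k 0 0 g) := by
    have kp : ∀ z w : ℝ, k (z + L - w) = k (z - w) := fun z w => by
      rw [← hk.periodic (z - w)]; congr 1; ring
    intro x y
    simp only [mol, iteratedDeriv_zero, kp, and_self]
  have h4 := sum_sq_le_integral_vol_sq hL hN (hk.continuous_mol hL h1 0 0) hper (K := K)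
    (fun x y r => by simpa using hd.secX x y r) (fun x y r => by simpa using hd.secY x y r)
  have h5 := hk.integral_mol_sq_le hL h1 h2
  rw [h3] at h5
  have e : normSqM h (sample L N (mol L k 0 0 g)) = h ^ 2 * ∑ i : ZMod N, ∑ j : ZMod N,
      mol L k 0 0 g (i.val * h, j.val * h) ^ 2 := by
    simp only [normSqM, innerM, sample, ← hN, sq]
  rw [e]
  linarith

lemma mol_sub_eq {k : ℝ → ℝ} (hk : PerKernel L k) (hL : 0 < L) (f g : Lp ℝ 2 (vol L))
    (p : ℝ × ℝ) : mol L k 0 0 (f - g : Lp ℝ 2 (vol L)) p = mol L k 0 0 f p - mol L k 0 0 g p := by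
  have hf := hk.integrable_mul hL (integral_sq_Lp_two f).1 0 0 p
  have hg := hk.integrable_mul hL (integral_sq_Lp_two g).1 0 0 p
  rw [mol, mol, mol, ← integral_sub hf hg]
  refine integral_congr_ae ?_
  filter_upwards [Lp.coeFn_sub f g] with q hq
  rw [hq, Pi.sub_apply]
  ring

lemma DiffBound.sub {B : ℝ} {f g : ℝ × ℝ → ℝ} (hf : DiffBound B 0 f) (hg : DiffBound B 0 g) :
    DiffBound (2 * B) 0 (fun p => f p - g p) := by
  constructor <;> intro x y r
  · have h1 := abs_le.1 (hf.lipX x y r); have h2 := abs_le.1 (hg.lipX x y r)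
    rw [abs_le]; constructor <;> linarith [h1.1, h1.2, h2.1, h2.2]
  · have h1 := abs_le.1 (hf.lipY x y r); have h2 := abs_le.1 (hg.lipY x y r)
    rw [abs_le]; constructor <;> linarith [h1.1, h1.2, h2.1, h2.2]
  · have h1 := abs_le.1 (hf.secX x y r); have h2 := abs_le.1 (hg.secX x y r)
    rw [abs_le]; constructor <;> linarith [h1.1, h1.2, h2.1, h2.2]
  · have h1 := abs_le.1 (hf.secY x y r); have h2 := abs_le.1 (hg.secY x y r)
    rw [abs_le]; constructor <;> linarith [h1.1, h1.2, h2.1, h2.2]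

open Filter Topology in
lemma tendsto_normSqM {ι : Type*} {l : Filter ι} {N : ℕ} [NeZero N] {h : ℝ} {u : ι → Grid N}
    {v : Grid N} (huv : ∀ i j, Tendsto (fun n => u n i j) l (𝓝 (v i j))) :
    Tendsto (fun n => normSqM h (u n)) l (𝓝 (normSqM h v)) :=
  (tendsto_finsetSum _ fun i _ => tendsto_finsetSum _ fun j _ =>
    (huv i j).mul (huv i j)).const_mul _

-- For the mollified solution the five-point Laplacian is the sum of the pure second derivatives up
-- to `O(h²)`. Their time increments are mollified `L²` functions of norm `O(|t - s|)`, and passing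
-- to the grid norm costs another `O(h²)`.
open Filter Topology in
lemma exists_lapH_time_lipschitz (hL : 0 < L) (hT : 0 < T)
    (hsol : IsAllenCahnSolution L T ε M F φ)
    (hreg₂ : MemBochnerSobolev L T 1 2 2 φ) (hreg₃ : MemBochnerSobolev L T 0 4 ⊤ φ) :
    ∃ B : ℝ, 0 ≤ B ∧ ∀ (N : ℕ) [NeZero N] (h : ℝ), h = L / N → ∀ s ∈ Icc 0 T, ∀ t ∈ Icc 0 T,
      normSqM h (lapH h (sample L N (φ t)) - lapH h (sample L N (φ s))) ≤
        B * (|t - s| ^ 2 + h ^ 4) := by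
  have hc : ∀ t ∈ Icc 0 T, Continuous (φ t) := fun t ht => (hsol.contDiff t ht).continuous
  obtain ⟨B, hB0, hB⟩ := ae_fdBound hL hc hreg₃
  obtain ⟨D, hD, hDW⟩ := hreg₂
  obtain ⟨C₁, hC₁, S₁, hS₁, hl₁⟩ := exists_lipschitz_of_memWTime (hDW 2 0 (by norm_num))
  obtain ⟨C₂, hC₂, S₂, hS₂, hl₂⟩ := exists_lipschitz_of_memWTime (hDW 0 2 (by norm_num))
  set S : Set ℝ := {t | (t ∈ Icc 0 T ∧
      ∀ n, DerivFamily B (fun i j => mol L (cosKernel L n) i j (φ t))) ∧ t ∈ S₁ ∧ t ∈ S₂ ∧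
      ∀ i j : ℕ, i + j ≤ 2 → IsWeakDeriv L i j (φ t) ⇑(D i j t)} with hSdef
  have hS : ∀ᵐ t ∂(volume.restrict (Ioo 0 T)), t ∈ S := by
    filter_upwards [hB, hS₁, hS₂, hD] with t h1 h2 h3 h4
    exact ⟨h1, h2, h3, h4.2⟩
  set Q : ℝ := 4 * (4 * C₁ ^ 2 + 4 * C₂ ^ 2) + 4 * (12 * L ^ 2 * (4 * B) ^ 2) +
    2 * (L ^ 2 * (8 * B) ^ 2) with hQ
  have hQ0 : 0 ≤ Q := by positivity
  refine ⟨Q, hQ0, fun N _ h hN => ?_⟩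
  have hNpos : (0 : ℝ) < N := Nat.cast_pos.mpr (NeZero.pos N)
  have hh : 0 < h := by rw [hN]; positivity
  have main : ∀ s ∈ S, ∀ t ∈ S,
      normSqM h (lapH h (sample L N (φ t)) - lapH h (sample L N (φ s))) ≤
        Q * (|t - s| ^ 2 + h ^ 4) := by
    rintro s ⟨⟨hsI, hsD⟩, hs1, hs2, hsw⟩ t ⟨⟨htI, htD⟩, ht1, ht2, htw⟩
    have hlim : ∀ τ ∈ Icc 0 T, ∀ i j, Tendsto (fun n => lapD h
        (mol L (cosKernel L n) 0 0 (φ τ)) ((i : ZMod N).val * h, (j : ZMod N).val * h)) atTop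
        (𝓝 (lapH h (sample L N (φ τ)) i j)) := by
      intro τ hτ i j
      rw [lapH_sample hN (hsol.periodic τ hτ)]
      exact tendsto_lapD (tendsto_mol_cosKernel hL (hc τ hτ) (hsol.periodic τ hτ)) _ _
    refine le_of_tendsto (tendsto_normSqM (l := atTop) (u := fun n i j => lapD h
        (mol L (cosKernel L n) 0 0 (φ t)) ((i : ZMod N).val * h, (j : ZMod N).val * h) - lapD h
        (mol L (cosKernel L n) 0 0 (φ s)) ((i : ZMod N).val * h, (j : ZMod N).val * h))
        fun i j => (hlim t htI i j).sub (hlim s hsI i j)) (Eventually.of_forall fun n => ?_)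
    have hk := perKernel_cosKernel hL n
    set k := cosKernel L n
    -- The constant `4 * B` bounds second differences of the increment: `2 * B` at each of the two
    -- times.
    have part : ∀ i j : ℕ, i + j = 2 → ∀ C, 0 ≤ C → ‖D i j t - D i j s‖ ≤ C * |t - s| →
        normSqM h (sample L N (fun p => mol L k i j (φ t) p - mol L k i j (φ s) p)) ≤
          4 * (C * |t - s|) ^ 2 + 6 * L ^ 2 * (4 * B) ^ 2 * h ^ 4 := by
      intro i j hij C hC hDC
      have e : (fun p => mol L k i j (φ t) p - mol L k i j (φ s) p) =
          mol L k 0 0 (D i j t - D i j s : Lp ℝ 2 (vol L)) := by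
        ext p
        rw [mol_sub_eq hk hL, hk.mol_eq_of_isWeakDeriv (htw i j hij.le),
          hk.mol_eq_of_isWeakDeriv (hsw i j hij.le)]
      have hd := ((htD n).diffBound hij.le).sub ((hsD n).diffBound hij.le)
      rw [e] at hd ⊢
      refine (sum_mol_sq_le hL hN hk _ hd).trans ?_
      rw [show 2 * (2 * B) = 4 * B by ring]
      gcongr
    set A : Grid N := sample L N (fun p => mol L k 2 0 (φ t) p - mol L k 2 0 (φ s) p)
    set A' : Grid N := sample L N (fun p => mol L k 0 2 (φ t) p - mol L k 0 2 (φ s) p)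
    have p1 : normSqM h A ≤ _ := part 2 0 rfl C₁ hC₁ (hl₁ s hs1 t ht1)
    have p2 : normSqM h A' ≤ _ := part 0 2 rfl C₂ hC₂ (hl₂ s hs2 t ht2)
    set V : Grid N := fun i j => lapD h (mol L k 0 0 (φ t)) (i.val * h, j.val * h) -
      lapD h (mol L k 0 0 (φ s)) (i.val * h, j.val * h) with hV
    have hE : normSqM h (V - (A + A')) ≤ L ^ 2 * (8 * B * h ^ 2) ^ 2 := by
      refine normSqM_le_of_abs_le hN fun i j => ?_
      have h1 := abs_le.1 ((htD n).abs_lapD_sub_le hh (i.val * h, j.val * h))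
      have h2 := abs_le.1 ((hsD n).abs_lapD_sub_le hh (i.val * h, j.val * h))
      simp only [V, A, A', Pi.sub_apply, Pi.add_apply, sample, ← hN]
      rw [abs_le]
      constructor <;> linarith [h1.1, h1.2, h2.1, h2.2]
    have h3 := normSqM_add_le (h := h) (V - (A + A')) (A + A')
    have h4 := normSqM_add_le (h := h) A A'
    rw [sub_add_cancel] at h3
    calc normSqM h V ≤ 4 * (4 * (C₁ * |t - s|) ^ 2 + 6 * L ^ 2 * (4 * B) ^ 2 * h ^ 4) +
          4 * (4 * (C₂ * |t - s|) ^ 2 + 6 * L ^ 2 * (4 * B) ^ 2 * h ^ 4) +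
          2 * (L ^ 2 * (8 * B * h ^ 2) ^ 2) := by linarith
      _ = 4 * (4 * C₁ ^ 2 + 4 * C₂ ^ 2) * |t - s| ^ 2 + (4 * (12 * L ^ 2 * (4 * B) ^ 2) +
          2 * (L ^ 2 * (8 * B) ^ 2)) * h ^ 4 := by ring
      _ ≤ Q * |t - s| ^ 2 + Q * h ^ 4 := by
          have q1 : 4 * (4 * C₁ ^ 2 + 4 * C₂ ^ 2) ≤ Q := by
            have : 0 ≤ 4 * (12 * L ^ 2 * (4 * B) ^ 2) + 2 * (L ^ 2 * (8 * B) ^ 2) := by positivity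
            linarith
          have q2 : 4 * (12 * L ^ 2 * (4 * B) ^ 2) + 2 * (L ^ 2 * (8 * B) ^ 2) ≤ Q := by
            have : 0 ≤ 4 * (4 * C₁ ^ 2 + 4 * C₂ ^ 2) := by positivity
            linarith
          gcongr
      _ = Q * (|t - s| ^ 2 + h ^ 4) := by ring
  have hneb : ∀ t ∈ Icc 0 T, (𝓝[S ∩ Ioo 0 T] t).NeBot := fun t ht =>
    mem_closure_iff_nhdsWithin_neBot.1 (subset_closure_of_ae hT hS ht)
  have htime : ∀ t ∈ Icc 0 T, ∀ i j, Tendsto (fun τ => lapH h (sample L N (φ τ)) i j)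
      (𝓝[S ∩ Ioo 0 T] t) (𝓝 (lapH h (sample L N (φ t)) i j)) := by
    intro t ht i j
    have hp : ∀ p, Tendsto (fun τ => φ τ p) (𝓝[S ∩ Ioo 0 T] t) (𝓝 (φ t p)) := fun p =>
      (hsol.continuousWithinAt ht p).mono_left
        (nhdsWithin_mono _ fun x hx => Ioo_subset_Icc_self hx.2)
    rw [lapH_sample hN (hsol.periodic t ht)]
    refine (tendsto_lapD hp h _).congr' ?_
    refine eventually_mem_nhdsWithin.mono fun τ hτ => ?_
    exact (lapH_sample hN (hsol.periodic τ (Ioo_subset_Icc_self hτ.2)) i j).symm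
  have hid : ∀ t, Tendsto (fun τ : ℝ => τ) (𝓝[S ∩ Ioo 0 T] t) (𝓝 t) := fun t =>
    tendsto_id.mono_left nhdsWithin_le_nhds
  -- The estimate is extended from `S` to all times in one variable after the other.
  have step1 : ∀ s ∈ S, ∀ t ∈ Icc 0 T,
      normSqM h (lapH h (sample L N (φ t)) - lapH h (sample L N (φ s))) ≤
        Q * (|t - s| ^ 2 + h ^ 4) := by
    intro s hs t ht
    have := hneb t ht
    refine le_of_tendsto_of_tendsto (tendsto_normSqM fun i j => (htime t ht i j).sub_const _)
      (((((hid t).sub_const s).abs.pow 2).add_const (h ^ 4)).const_mul Q)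
      (eventually_mem_nhdsWithin.mono fun τ hτ => main s hs τ hτ.1)
  intro s hs t ht
  have := hneb s hs
  refine le_of_tendsto_of_tendsto (tendsto_normSqM fun i j => (htime s hs i j).const_sub _)
    (((((hid s).const_sub t).abs.pow 2).add_const (h ^ 4)).const_mul Q)
    (eventually_mem_nhdsWithin.mono fun τ hτ => step1 τ hτ.1 t ht)

end

section

/-! ### Consistency of the spatial discretisation -/

-- At the point `x` only differentiability of `f1` is available. The mean value inequality for the
-- remainder as a function of the step turns the little-`o` of its derivative into `o(δ²)`.
open Filter Topology in
lemma tendsto_second_diff {f f1 : ℝ → ℝ} {c x : ℝ} (h1 : ∀ x, HasDerivAt f (f1 x) x)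
    (h2 : HasDerivAt f1 c x) :
    Tendsto (fun δ => (f (x + δ) + f (x - δ) - 2 * f x) / δ ^ 2) (𝓝[>] 0) (𝓝 c) := by
  rw [Metric.tendsto_nhdsWithin_nhds]
  intro η hη
  have hlo := h2.isLittleO
  rw [Asymptotics.isLittleO_iff] at hlo
  obtain ⟨ρ, hρ, hball⟩ := Metric.eventually_nhds_iff.1 (hlo (show (0 : ℝ) < η / 4 by positivity))
  refine ⟨ρ, hρ, fun {δ} hδ hdist => ?_⟩
  have hδ0 : 0 < δ := hδ
  have hδρ : δ < ρ := by simpa [abs_of_pos hδ0] using hdist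
  have hb : ∀ r, |r| < ρ → |f1 (x + r) - f1 x - r * c| ≤ η / 4 * |r| := by
    intro r hr
    simpa using hball (y := x + r) (by simpa [Real.dist_eq] using hr)
  have hmvt := Convex.norm_image_sub_le_of_norm_hasDerivWithin_le
    (f := fun r => f (x + r) + f (x - r) - 2 * f x - r ^ 2 * c)
    (f' := fun r => f1 (x + r) - f1 (x - r) - 2 * r * c) (s := Icc 0 δ)
    (x := 0) (y := δ) (C := η / 2 * δ) (fun r _ => by
      have := ((((h1 (x + r)).comp_const_add x r).add ((h1 (x - r)).comp_const_sub x r)).sub_const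
        (2 * f x)).sub (((hasDerivAt_id r).pow 2).mul_const c)
      exact (this.congr_deriv (by simp; ring)).hasDerivWithinAt)
    (fun r hr => by
      have hr' : |r| < ρ := by rw [abs_of_nonneg hr.1]; linarith [hr.2]
      have a1 := abs_le.1 (hb r hr')
      have a2 := abs_le.1 (hb (-r) (by rwa [abs_neg]))
      rw [abs_neg, abs_of_nonneg hr.1] at a2
      rw [abs_of_nonneg hr.1] at a1
      have a3 : η / 4 * r ≤ η / 4 * δ := by gcongr; exact hr.2
      rw [← sub_eq_add_neg] at a2
      rw [Real.norm_eq_abs, abs_le]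
      constructor <;> linarith [a1.1, a1.2, a2.1, a2.2])
    (convex_Icc _ _) ⟨le_rfl, hδ0.le⟩ ⟨hδ0.le, le_rfl⟩
  have e0 : f (x + 0) + f x - 2 * f x - 0 ^ 2 * c = 0 := by simp; ring
  simp only [e0, sub_zero, Real.norm_eq_abs, abs_of_pos hδ0] at hmvt
  rw [Real.dist_eq]
  have e : (f (x + δ) + f (x - δ) - 2 * f x) / δ ^ 2 - c =
      (f (x + δ) + f (x - δ) - 2 * f x - δ ^ 2 * c) / δ ^ 2 := by field_simp
  rw [e, abs_div, abs_of_pos (by positivity : 0 < δ ^ 2), div_lt_iff₀ (by positivity)]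
  nlinarith [mul_pos hη (by positivity : 0 < δ ^ 2)]

section Slices

variable {u : ℝ × ℝ → ℝ}

lemma hasDerivAt_slice_fst (hu : Differentiable ℝ u) (x y : ℝ) :
    HasDerivAt (fun x => u (x, y)) (dX u (x, y)) x :=
  (hu (x, y)).hasFDerivAt.comp_hasDerivAt x ((hasDerivAt_id x).prodMk (hasDerivAt_const x y))

lemma hasDerivAt_slice_snd (hu : Differentiable ℝ u) (x y : ℝ) :
    HasDerivAt (fun y => u (x, y)) (dY u (x, y)) y :=
  (hu (x, y)).hasFDerivAt.comp_hasDerivAt y ((hasDerivAt_const y x).prodMk (hasDerivAt_id y))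

lemma contDiff_dX {n : ℕ} (hu : ContDiff ℝ (n + 1) u) : ContDiff ℝ n (dX u) :=
  (hu.fderiv_right (m := n) le_rfl).clm_apply contDiff_const

lemma contDiff_dY {n : ℕ} (hu : ContDiff ℝ (n + 1) u) : ContDiff ℝ n (dY u) :=
  (hu.fderiv_right (m := n) le_rfl).clm_apply contDiff_const

lemma contDiff_one_dX (hu : ContDiff ℝ 2 u) : ContDiff ℝ 1 (dX u) :=
  contDiff_dX (n := 1) (by norm_num; exact hu)

lemma contDiff_one_dY (hu : ContDiff ℝ 2 u) : ContDiff ℝ 1 (dY u) :=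
  contDiff_dY (n := 1) (by norm_num; exact hu)

lemma continuous_laplace (hu : ContDiff ℝ 2 u) : Continuous (laplace u) :=
  (contDiff_dX (n := 0) (by norm_num; exact contDiff_one_dX hu)).continuous.add
    (contDiff_dY (n := 0) (by norm_num; exact contDiff_one_dY hu)).continuous

open Filter Topology in
lemma tendsto_lapD_laplace (hu : ContDiff ℝ 2 u) (p : ℝ × ℝ) :
    Tendsto (fun δ => lapD δ u p) (𝓝[>] 0) (𝓝 (laplace u p)) := by
  obtain ⟨x, y⟩ := p
  have d0 : Differentiable ℝ u := hu.differentiable (by norm_num)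
  have dx : Differentiable ℝ (dX u) := (contDiff_one_dX hu).differentiable (by norm_num)
  have dy : Differentiable ℝ (dY u) := (contDiff_one_dY hu).differentiable (by norm_num)
  have h1 := tendsto_second_diff (fun x => hasDerivAt_slice_fst d0 x y)
    (hasDerivAt_slice_fst dx x y)
  have h2 := tendsto_second_diff (fun y => hasDerivAt_slice_snd d0 x y)
    (hasDerivAt_slice_snd dy x y)
  refine (h1.add h2).congr fun δ => ?_
  rw [lapD]
  ring

lemma IsPeriodic.dX {L : ℝ} (hp : IsPeriodic L u) : IsPeriodic L (dX u) := by
  have e1 : (fun q : ℝ × ℝ => u (q + (L, 0))) = u := by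
    ext ⟨x, y⟩; simpa using (hp x y).1
  have e2 : (fun q : ℝ × ℝ => u (q + (0, L))) = u := by
    ext ⟨x, y⟩; simpa using (hp x y).2
  intro x y
  have h1 := fderiv_comp_add_right (𝕜 := ℝ) (f := u) (x := (x, y)) (L, 0)
  have h2 := fderiv_comp_add_right (𝕜 := ℝ) (f := u) (x := (x, y)) (0, L)
  rw [e1] at h1
  rw [e2] at h2
  simp only [Prod.mk_add_mk, add_zero] at h1 h2
  exact ⟨by rw [PSSAV.dX, ← h1, PSSAV.dX], by rw [PSSAV.dX, ← h2, PSSAV.dX]⟩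

lemma IsPeriodic.dY {L : ℝ} (hp : IsPeriodic L u) : IsPeriodic L (dY u) := by
  have e1 : (fun q : ℝ × ℝ => u (q + (L, 0))) = u := by
    ext ⟨x, y⟩; simpa using (hp x y).1
  have e2 : (fun q : ℝ × ℝ => u (q + (0, L))) = u := by
    ext ⟨x, y⟩; simpa using (hp x y).2
  intro x y
  have h1 := fderiv_comp_add_right (𝕜 := ℝ) (f := u) (x := (x, y)) (L, 0)
  have h2 := fderiv_comp_add_right (𝕜 := ℝ) (f := u) (x := (x, y)) (0, L)
  rw [e1] at h1
  rw [e2] at h2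
  simp only [Prod.mk_add_mk, add_zero] at h1 h2
  exact ⟨by rw [PSSAV.dY, ← h1, PSSAV.dY], by rw [PSSAV.dY, ← h2, PSSAV.dY]⟩

lemma IsPeriodic.laplace {L : ℝ} (hp : IsPeriodic L u) : IsPeriodic L (laplace u) := fun x y => by
  simp only [PSSAV.laplace, (hp.dX.dX x y).1, (hp.dX.dX x y).2, (hp.dY.dY x y).1,
    (hp.dY.dY x y).2, and_self]

end Slices

lemma integral_vol_symm {L : ℝ} (hL : 0 ≤ L) {f : ℝ × ℝ → ℝ} (hf : Integrable f (vol L)) :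
    ∫ p, f p ∂(vol L) = ∫ y in (0 : ℝ)..L, ∫ x in (0 : ℝ)..L, f (x, y) := by
  rw [vol_eq_prod] at hf ⊢
  rw [integral_prod_symm _ hf, integral_Ioo_eq hL]
  simp only [integral_Ioo_eq hL]

lemma integral_deriv_sq {L : ℝ} {f f1 f2 : ℝ → ℝ} (h1 : ∀ x, HasDerivAt f (f1 x) x)
    (h2 : ∀ x, HasDerivAt f1 (f2 x) x) (hc : Continuous f2) (hp : Function.Periodic f L)
    (hp1 : Function.Periodic f1 L) :
    ∫ x in (0 : ℝ)..L, f1 x ^ 2 = -∫ x in (0 : ℝ)..L, f x * f2 x := by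
  have c1 : Continuous f1 := continuous_iff_continuousAt.2 fun x => (h2 x).continuousAt
  have := intervalIntegral.integral_mul_deriv_eq_deriv_mul (u := f) (v := f1) (u' := f1) (v' := f2)
    (a := 0) (b := L) (fun x _ => h1 x) (fun x _ => h2 x) (c1.intervalIntegrable _ _)
    (hc.intervalIntegrable _ _)
  have e1 : f L = f 0 := by simpa using hp 0
  have e2 : f1 L = f1 0 := by simpa using hp1 0
  rw [this, e1, e2]
  simp only [sq]
  ring

/-- Green's formula on the periodic square. -/
lemma integral_grad_sq {L : ℝ} (hL : 0 < L) {u : ℝ × ℝ → ℝ} (hu : ContDiff ℝ 2 u)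
    (hp : IsPeriodic L u) :
    ∫ p, (dX u p ^ 2 + dY u p ^ 2) ∂(vol L) = -∫ p, u p * laplace u p ∂(vol L) := by
  have d0 : Differentiable ℝ u := hu.differentiable (by norm_num)
  have dx : Differentiable ℝ (dX u) := (contDiff_one_dX hu).differentiable (by norm_num)
  have dy : Differentiable ℝ (dY u) := (contDiff_one_dY hu).differentiable (by norm_num)
  have cu := d0.continuous
  have cx := dx.continuous
  have cy := dy.continuous
  have cxx : Continuous (dX (dX u)) :=
    (contDiff_dX (n := 0) (by norm_num; exact contDiff_one_dX hu)).continuous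
  have cyy : Continuous (dY (dY u)) :=
    (contDiff_dY (n := 0) (by norm_num; exact contDiff_one_dY hu)).continuous
  have ix : ∫ p, dX u p ^ 2 ∂(vol L) = -∫ p, u p * dX (dX u) p ∂(vol L) := by
    rw [integral_vol_symm hL.le (integrable_vol_of_continuous (by fun_prop)),
      integral_vol_symm hL.le (integrable_vol_of_continuous (by fun_prop)),
      ← intervalIntegral.integral_neg]
    congr 1
    ext y
    exact integral_deriv_sq (fun x => hasDerivAt_slice_fst d0 x y)
      (fun x => hasDerivAt_slice_fst dx x y) (by fun_prop) (hp.fst y) (hp.dX.fst y)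
  have iy : ∫ p, dY u p ^ 2 ∂(vol L) = -∫ p, u p * dY (dY u) p ∂(vol L) := by
    rw [integral_vol hL.le (integrable_vol_of_continuous (by fun_prop)),
      integral_vol hL.le (integrable_vol_of_continuous (by fun_prop)),
      ← intervalIntegral.integral_neg]
    congr 1
    ext x
    exact integral_deriv_sq (fun y => hasDerivAt_slice_snd d0 x y)
      (fun y => hasDerivAt_slice_snd dy x y) (by fun_prop) (hp.snd x) (hp.dY.snd x)
  rw [integral_add (integrable_vol_of_continuous (by fun_prop))
    (integrable_vol_of_continuous (by fun_prop)), ix, iy, ← neg_add,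
    ← integral_add (integrable_vol_of_continuous (by fun_prop))
    (integrable_vol_of_continuous (by fun_prop))]
  simp only [laplace, mul_add]

/-- `F` and `F'` are bounded and Lipschitz on `[-B, B]`, with constant `K`. -/
structure LocalBound (F : ℝ → ℝ) (B K : ℝ) : Prop where
  nonneg : 0 ≤ K
  abs_le : ∀ x ∈ Icc (-B) B, |F x| ≤ K
  abs_deriv_le : ∀ x ∈ Icc (-B) B, |deriv F x| ≤ K
  lip : ∀ x ∈ Icc (-B) B, ∀ y ∈ Icc (-B) B, |F y - F x| ≤ K * |y - x|
  deriv_lip : ∀ x ∈ Icc (-B) B, ∀ y ∈ Icc (-B) B, |deriv F y - deriv F x| ≤ K * |y - x|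
  taylor : ∀ x ∈ Icc (-B) B, ∀ y ∈ Icc (-B) B,
    |F y - F x - deriv F x * (y - x)| ≤ K * |y - x| ^ 2

lemma exists_localBound {F : ℝ → ℝ} (hF : ContDiff ℝ 2 F) (B : ℝ) : ∃ K, LocalBound F B K := by
  have hd : ContDiff ℝ 1 (deriv F) := (contDiff_succ_iff_deriv (n := 1) (f := F)).1
    (by norm_num; exact hF) |>.2.2
  have hdd : Continuous (deriv (deriv F)) := hd.continuous_deriv le_rfl
  obtain ⟨K0, hK0⟩ := (isCompact_Icc (a := -B) (b := B)).exists_bound_of_continuousOn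
    hF.continuous.continuousOn
  obtain ⟨K1, hK1⟩ := (isCompact_Icc (a := -B) (b := B)).exists_bound_of_continuousOn
    hd.continuous.continuousOn
  obtain ⟨K2, hK2⟩ := (isCompact_Icc (a := -B) (b := B)).exists_bound_of_continuousOn
    hdd.continuousOn
  have hFd : ∀ x, HasDerivAt F (deriv F x) x := fun x =>
    (hF.differentiable (by norm_num) x).hasDerivAt
  have hFdd : ∀ x, HasDerivAt (deriv F) (deriv (deriv F) x) x := fun x =>
    (hd.differentiable (by norm_num) x).hasDerivAt
  have l1 : ∀ x ∈ Icc (-B) B, ∀ y ∈ Icc (-B) B, |F y - F x| ≤ K1 * |y - x| := fun x hx y hy =>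
    Convex.norm_image_sub_le_of_norm_hasDerivWithin_le (fun z _ => (hFd z).hasDerivWithinAt)
      hK1 (convex_Icc _ _) hx hy
  have l2 : ∀ x ∈ Icc (-B) B, ∀ y ∈ Icc (-B) B, |deriv F y - deriv F x| ≤ K2 * |y - x| :=
    fun x hx y hy =>
    Convex.norm_image_sub_le_of_norm_hasDerivWithin_le (fun z _ => (hFdd z).hasDerivWithinAt)
      hK2 (convex_Icc _ _) hx hy
  refine ⟨|K0| + |K1| + |K2|, by positivity, fun x hx => ?_, fun x hx => ?_, fun x hx y hy => ?_,
    fun x hx y hy => ?_, fun x hx y hy => ?_⟩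
  · exact (hK0 x hx).trans (by linarith [le_abs_self K0, abs_nonneg K1, abs_nonneg K2])
  · exact (hK1 x hx).trans (by linarith [le_abs_self K1, abs_nonneg K0, abs_nonneg K2])
  · refine (l1 x hx y hy).trans ?_
    gcongr
    linarith [le_abs_self K1, abs_nonneg K0, abs_nonneg K2]
  · refine (l2 x hx y hy).trans ?_
    gcongr
    linarith [le_abs_self K2, abs_nonneg K0, abs_nonneg K1]
  · have hsub : uIcc x y ⊆ Icc (-B) B := uIcc_subset_Icc hx hy
    have := Convex.norm_image_sub_le_of_norm_hasDerivWithin_le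
      (f := fun z => F z - F x - deriv F x * (z - x)) (f' := fun z => deriv F z - deriv F x)
      (s := uIcc x y) (x := x) (y := y) (C := |K2| * |y - x|) (fun z _ => by
        have := (((hFd z).sub_const (F x)).sub (((hasDerivAt_id z).sub_const x).const_mul
          (deriv F x)))
        exact (this.congr_deriv (by ring)).hasDerivWithinAt)
      (fun z hz => by
        refine (l2 x hx z (hsub hz)).trans ?_
        have := abs_sub_left_of_mem_uIcc hz
        gcongr
        exact le_abs_self K2) (convex_uIcc _ _) left_mem_uIcc right_mem_uIcc
    simp only [sub_self, mul_zero, sub_zero, Real.norm_eq_abs] at this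
    refine this.trans ?_
    rw [mul_assoc, ← sq]
    gcongr
    linarith [abs_nonneg K0, abs_nonneg K1]

/-- Discrete Leibniz rule, needed for quadrature of the product of `u` and its Laplacian. -/
lemma second_diff_mul_le {a b ap bp am bm A B A' B' r : ℝ} (ha : |a| ≤ A) (hb : |b| ≤ A')
    (hap : |ap - a| ≤ B * |r|) (ham : |am - a| ≤ B * |r|) (hbp : |bp - b| ≤ B' * |r|)
    (hbm : |bm - b| ≤ B' * |r|) (ha2 : |ap + am - 2 * a| ≤ B * r ^ 2)
    (hb2 : |bp + bm - 2 * b| ≤ B' * r ^ 2) :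
    |ap * bp + am * bm - 2 * (a * b)| ≤ (A * B' + A' * B + 2 * B * B') * r ^ 2 := by
  have e : ap * bp + am * bm - 2 * (a * b) = a * (bp + bm - 2 * b) + b * (ap + am - 2 * a) +
      (ap - a) * (bp - b) + (am - a) * (bm - b) := by ring
  rw [e]
  have h1 : |a * (bp + bm - 2 * b)| ≤ A * (B' * r ^ 2) := by
    rw [abs_mul]; exact mul_le_mul ha hb2 (abs_nonneg _) ((abs_nonneg _).trans ha)
  have h2 : |b * (ap + am - 2 * a)| ≤ A' * (B * r ^ 2) := by
    rw [abs_mul]; exact mul_le_mul hb ha2 (abs_nonneg _) ((abs_nonneg _).trans hb)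
  have h3 : |(ap - a) * (bp - b)| ≤ (B * |r|) * (B' * |r|) := by
    rw [abs_mul]; exact mul_le_mul hap hbp (abs_nonneg _) ((abs_nonneg _).trans hap)
  have h4 : |(am - a) * (bm - b)| ≤ (B * |r|) * (B' * |r|) := by
    rw [abs_mul]; exact mul_le_mul ham hbm (abs_nonneg _) ((abs_nonneg _).trans ham)
  have h5 : (B * |r|) * (B' * |r|) = B * B' * r ^ 2 := by
    rw [← sq_abs r]; ring
  rw [h5] at h3 h4
  refine (abs_add_le _ _).trans ?_
  have := abs_add_three (a * (bp + bm - 2 * b)) (b * (ap + am - 2 * a)) ((ap - a) * (bp - b))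
  linarith

/-! ### Second-order consistency of the Laplacian and of the energy -/

namespace FDBound

variable {B : ℝ} {u : ℝ × ℝ → ℝ}

lemma nonneg (hu : FDBound B u) : 0 ≤ B := (abs_nonneg _).trans (hu.bound 0)

lemma abs_lapD_le (hu : FDBound B u) {δ : ℝ} (hδ : 0 < δ) (p : ℝ × ℝ) : |lapD δ u p| ≤ 2 * B := by
  have h1 := hu.diff.secX p.1 p.2 δ
  have h2 := hu.diff.secY p.1 p.2 δ
  have e : lapD δ u p = 1 / δ ^ 2 * ((u (p.1 + δ, p.2) + u (p.1 - δ, p.2) - 2 * u (p.1, p.2)) +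
      (u (p.1, p.2 + δ) + u (p.1, p.2 - δ) - 2 * u (p.1, p.2))) := by rw [lapD]; ring
  rw [e, abs_mul, abs_of_pos (by positivity)]
  calc _ ≤ 1 / δ ^ 2 * (B * δ ^ 2 + 0 + (B * δ ^ 2 + 0)) := by
        gcongr
        exact (abs_add_le _ _).trans (add_le_add h1 h2)
    _ = _ := by field_simp; ring

open Filter Topology in
lemma abs_laplace_le (hu : FDBound B u) (h2 : ContDiff ℝ 2 u) (p : ℝ × ℝ) :
    |laplace u p| ≤ 2 * B :=
  le_of_tendsto (tendsto_lapD_laplace h2 p).abs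
    (eventually_mem_nhdsWithin.mono fun _ hδ => hu.abs_lapD_le hδ p)

-- The second step size in `FDBound.lap` tends to `0`.
open Filter Topology in
lemma abs_lapD_sub_laplace_le (hu : FDBound B u) (h2 : ContDiff ℝ 2 u) {h : ℝ} (hh : 0 < h)
    (p : ℝ × ℝ) : |lapD h u p - laplace u p| ≤ B * h ^ 2 := by
  have hid : Tendsto (fun δ : ℝ => δ) (𝓝[>] 0) (𝓝 0) := tendsto_id.mono_left nhdsWithin_le_nhds
  have := le_of_tendsto_of_tendsto ((tendsto_lapD_laplace h2 p).const_sub (lapD h u p)).abs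
    (((hid.pow 2).const_add (h ^ 2)).const_mul B)
    (eventually_mem_nhdsWithin.mono fun δ hδ => hu.lap h δ hh hδ p)
  simpa using this

open Filter Topology in
lemma diffBound_laplace (hu : FDBound B u) (h2 : ContDiff ℝ 2 u) : DiffBound B 0 (laplace u) := by
  have hid : Tendsto (fun δ : ℝ => B * δ ^ 2) (𝓝[>] 0) (𝓝 0) := by
    have : Tendsto (fun δ : ℝ => δ) (𝓝[>] 0) (𝓝 0) := tendsto_id.mono_left nhdsWithin_le_nhds
    simpa using (this.pow 2).const_mul B
  have hl := tendsto_lapD_laplace h2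
  have hm : ∀ᶠ δ : ℝ in 𝓝[>] 0, DiffBound B (B * δ ^ 2) (lapD δ u) :=
    eventually_mem_nhdsWithin.mono fun δ hδ => hu.lap_diff δ hδ
  exact ⟨fun x y r => le_of_tendsto_of_tendsto ((hl _).sub (hl _)).abs (hid.const_add _)
      (hm.mono fun _ h => h.lipX x y r),
    fun x y r => le_of_tendsto_of_tendsto ((hl _).sub (hl _)).abs (hid.const_add _)
      (hm.mono fun _ h => h.lipY x y r),
    fun x y r => le_of_tendsto_of_tendsto (((hl _).add (hl _)).sub ((hl _).const_mul 2)).abs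
      (hid.const_add _) (hm.mono fun _ h => h.secX x y r),
    fun x y r => le_of_tendsto_of_tendsto (((hl _).add (hl _)).sub ((hl _).const_mul 2)).abs
      (hid.const_add _) (hm.mono fun _ h => h.secY x y r)⟩

lemma abs_mul_laplace_quadrature_le (hu : FDBound B u) (h2 : ContDiff ℝ 2 u) {L h : ℝ} {N : ℕ}
    [NeZero N] (hL : 0 < L) (hN : h = L / N) (hp : IsPeriodic L u) :
    |h ^ 2 * ∑ i : ZMod N, ∑ j : ZMod N, u (i.val * h, j.val * h) *
      laplace u (i.val * h, j.val * h) - ∫ p, u p * laplace u p ∂(vol L)| ≤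
      10 * L ^ 2 * B ^ 2 * h ^ 2 := by
  have hl := hu.diffBound_laplace h2
  -- Here `5 = 1 + 2 + 2`: the Leibniz constant with `u` bounded by `B`, its Laplacian by `2 * B`,
  -- and all differences controlled by `B`.
  have key := abs_sum_sub_integral_vol_le (g := fun p => u p * laplace u p) (K := 5 * B ^ 2) hL hN
    (h2.continuous.mul (continuous_laplace h2))
    (fun x y => by simp only [(hp x y).1, (hp x y).2, (hp.laplace x y).1, (hp.laplace x y).2,
      and_self])
    (fun x y r => by
      have a1 := hu.diff.lipX x y r; have a2 := hu.diff.lipX x y (-r)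
      have b1 := hl.lipX x y r; have b2 := hl.lipX x y (-r)
      rw [abs_neg, ← sub_eq_add_neg] at a2 b2
      have := second_diff_mul_le (hu.bound (x, y)) (hu.abs_laplace_le h2 (x, y)) (r := r)
        (ap := u (x + r, y)) (am := u (x - r, y)) (bp := laplace u (x + r, y)) (bm := laplace u (x - r, y))
        (by linarith) (by linarith) (B := B) (B' := B)
        (by linarith) (by linarith) (by linarith [hu.diff.secX x y r])
        (by linarith [hl.secX x y r])
      linarith)
    (fun x y r => by
      have a1 := hu.diff.lipY x y r; have a2 := hu.diff.lipY x y (-r)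
      have b1 := hl.lipY x y r; have b2 := hl.lipY x y (-r)
      rw [abs_neg, ← sub_eq_add_neg] at a2 b2
      have := second_diff_mul_le (hu.bound (x, y)) (hu.abs_laplace_le h2 (x, y)) (r := r)
        (ap := u (x, y + r)) (am := u (x, y - r)) (bp := laplace u (x, y + r)) (bm := laplace u (x, y - r))
        (by linarith) (by linarith) (B := B) (B' := B)
        (by linarith) (by linarith) (by linarith [hu.diff.secY x y r])
        (by linarith [hl.secY x y r])
      linarith)
  exact key.trans (le_of_eq (by ring))

lemma abs_comp_quadrature_le (hu : FDBound B u) (h2 : ContDiff ℝ 2 u) {F : ℝ → ℝ}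
    (hF : ContDiff ℝ 2 F) {K : ℝ} (hK : LocalBound F B K) {L h : ℝ} {N : ℕ}
    [NeZero N] (hL : 0 < L) (hN : h = L / N) (hp : IsPeriodic L u) :
    |h ^ 2 * ∑ i : ZMod N, ∑ j : ZMod N, F (u (i.val * h, j.val * h)) -
      ∫ p, F (u p) ∂(vol L)| ≤ 2 * L ^ 2 * (K * B + 2 * K * B ^ 2) * h ^ 2 := by
  have hK0 := hK.nonneg
  have hm : ∀ p, u p ∈ Icc (-B) B := fun p => abs_le.1 (hu.bound p)
  have sec : ∀ p q q' r, |u q - u p| ≤ B * |r| → |u q' - u p| ≤ B * |r| →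
      |u q + u q' - 2 * u p| ≤ B * r ^ 2 →
      |F (u q) + F (u q') - 2 * F (u p)| ≤ (K * B + 2 * K * B ^ 2) * r ^ 2 := by
    intro p q q' r h1 h1' h2
    have t1 := abs_le.1 (hK.taylor _ (hm p) _ (hm q))
    have t2 := abs_le.1 (hK.taylor _ (hm p) _ (hm q'))
    have s1 : K * |u q - u p| ^ 2 ≤ K * (B * |r|) ^ 2 := by gcongr
    have s2 : K * |u q' - u p| ^ 2 ≤ K * (B * |r|) ^ 2 := by gcongr
    rw [mul_pow, sq_abs r] at s1 s2
    have t3 : |deriv F (u p) * (u q + u q' - 2 * u p)| ≤ K * (B * r ^ 2) := by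
      rw [abs_mul]
      exact mul_le_mul (hK.abs_deriv_le _ (hm p)) h2 (abs_nonneg _) hK0
    have t4 := abs_le.1 t3
    rw [abs_le]
    constructor <;> nlinarith [t1.1, t1.2, t2.1, t2.2, t4.1, t4.2]
  refine abs_sum_sub_integral_vol_le (g := fun p => F (u p)) hL hN
    (hF.continuous.comp h2.continuous)
    (fun x y => by simp only [(hp x y).1, (hp x y).2, and_self])
    (fun x y r => ?_) (fun x y r => ?_)
  · have a1 := hu.diff.lipX x y r; have a2 := hu.diff.lipX x y (-r)
    rw [abs_neg, ← sub_eq_add_neg] at a2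
    exact sec _ _ _ r (by linarith) (by linarith) (by linarith [hu.diff.secX x y r])
  · have a1 := hu.diff.lipY x y r; have a2 := hu.diff.lipY x y (-r)
    rw [abs_neg, ← sub_eq_add_neg] at a2
    exact sec _ _ _ r (by linarith) (by linarith) (by linarith [hu.diff.secY x y r])

/-- Green's formula, discrete and continuous, rewrites both Dirichlet terms as pairings of `u` with
its Laplacian, so no comparison of gradients is needed. In the constant, `11 = 10 + 1`: quadrature
plus the five-point approximation. -/
lemma abs_energyH_sub_energy_le (hu : FDBound B u) (h2 : ContDiff ℝ 2 u) {F : ℝ → ℝ}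
    (hF : ContDiff ℝ 2 F) {K : ℝ} (hK : LocalBound F B K) {L h ε : ℝ} {N : ℕ}
    [NeZero N] (hL : 0 < L) (hN : h = L / N) (hp : IsPeriodic L u) :
    |energyH h ε F (sample L N u) - energy L ε F u| ≤
      (ε ^ 2 / 2 * (11 * L ^ 2 * B ^ 2) + 2 * L ^ 2 * (K * B + 2 * K * B ^ 2)) * h ^ 2 := by
  have hB := hu.nonneg
  have hNpos : (0 : ℝ) < N := Nat.cast_pos.mpr (NeZero.pos N)
  have hh : 0 < h := by rw [hN]; positivity
  have h3 := hu.abs_comp_quadrature_le h2 hF hK hL hN hp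
  have h4 := hu.abs_mul_laplace_quadrature_le h2 hL hN hp
  have hgrad : gradSqTM h (sample L N u) = -innerM h (lapH h (sample L N u)) (sample L N u) := by
    rw [innerM_lapH _ _ hh.ne', gradSqTM_eq, neg_neg]
  set V : Grid N := sample L N (laplace u) with hV
  have h5 : innerM h V (sample L N u) = h ^ 2 * ∑ i : ZMod N, ∑ j : ZMod N,
      u (i.val * h, j.val * h) * laplace u (i.val * h, j.val * h) := by
    simp only [innerM, V, sample, ← hN, mul_comm]
  have h6 : |innerM h (lapH h (sample L N u) - V) (sample L N u)| ≤ L ^ 2 * B ^ 2 * h ^ 2 := by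
    refine (abs_innerM_le _ _).trans ?_
    have n1 : normM h (lapH h (sample L N u) - V) ≤ L * (B * h ^ 2) := by
      refine normM_le_of_abs_le hL.le hN (by positivity) fun i j => ?_
      rw [Pi.sub_apply, Pi.sub_apply, lapH_sample hN hp]
      simp only [V, sample, ← hN]
      exact hu.abs_lapD_sub_laplace_le h2 hh _
    have n2 : normM h (sample L N u) ≤ L * B :=
      normM_le_of_abs_le hL.le hN hB fun i j => hu.bound _
    calc _ ≤ L * (B * h ^ 2) * (L * B) := mul_le_mul n1 n2 (normM_nonneg _) (by positivity)
      _ = _ := by ring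
  rw [innerM_sub_left, h5] at h6
  have h7 := integral_grad_sq hL h2 hp
  rw [energyH, energy, hgrad, h7]
  have e : ∑ i : ZMod N, ∑ j : ZMod N, F (sample L N u i j) =
      ∑ i : ZMod N, ∑ j : ZMod N, F (u (i.val * h, j.val * h)) := by
    simp only [sample, ← hN]
  rw [e]
  set I := ∫ p, u p * laplace u p ∂(vol L)
  set S := h ^ 2 * ∑ i : ZMod N, ∑ j : ZMod N,
      u (i.val * h, j.val * h) * laplace u (i.val * h, j.val * h)
  set J := innerM h (lapH h (sample L N u)) (sample L N u)
  set A := h ^ 2 * ∑ i : ZMod N, ∑ j : ZMod N, F (u (i.val * h, j.val * h))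
  set A' := ∫ p, F (u p) ∂(vol L)
  have e2 : ε ^ 2 / 2 * -J + A - (ε ^ 2 / 2 * -I + A') =
      ε ^ 2 / 2 * (-(J - S) - (S - I)) + (A - A') := by ring
  rw [e2]
  have h8 : |-(J - S) - (S - I)| ≤ 11 * L ^ 2 * B ^ 2 * h ^ 2 := by
    have a := abs_le.1 h6; have b := abs_le.1 h4
    rw [abs_le]; constructor <;> linarith [a.1, a.2, b.1, b.2]
  refine (abs_add_le _ _).trans ?_
  rw [abs_mul, abs_of_nonneg (by positivity : 0 ≤ ε ^ 2 / 2)]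
  have h9 : ε ^ 2 / 2 * |-(J - S) - (S - I)| ≤ ε ^ 2 / 2 * (11 * L ^ 2 * B ^ 2 * h ^ 2) := by gcongr
  linarith

end FDBound

end

section

/-! ### Consistency in time -/

/-- A curve of grid functions that solves the Allen-Cahn equation with an approximate discrete
Laplacian `Λ`. -/
structure NodalCurve {N : ℕ} [NeZero N] (L T ε M h B K Q : ℝ) (F : ℝ → ℝ) (Φ Λ P : ℝ → Grid N) :
    Prop where
  mesh : h = L / N
  localBound : LocalBound F B K
  bound : ∀ t ∈ Icc 0 T, ∀ i j, |Φ t i j| ≤ B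
  lap_bound : ∀ t ∈ Icc 0 T, ∀ i j, |Λ t i j| ≤ 2 * B
  lapH_bound : ∀ t ∈ Icc 0 T, ∀ i j, |lapH h (Φ t) i j| ≤ 2 * B
  lap_sub : ∀ t ∈ Icc 0 T, ∀ i j, |lapH h (Φ t) i j - Λ t i j| ≤ B * h ^ 2
  lap_lip : ∀ s ∈ Icc 0 T, ∀ t ∈ Icc 0 T,
    normSqM h (lapH h (Φ t) - lapH h (Φ s)) ≤ Q * (|t - s| ^ 2 + h ^ 4)
  deriv_eq : ∀ t ∈ Icc 0 T, ∀ i j, P t i j = M * (ε ^ 2 * Λ t i j - deriv F (Φ t i j))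
  hasDeriv : ∀ t ∈ Icc 0 T, ∀ i j, HasDerivWithinAt (fun τ => Φ τ i j) (P t i j) (Icc 0 T) t

lemma exists_nodalCurve {L T ε M : ℝ} (hL : 0 < L) (hT : 0 < T) {F : ℝ → ℝ}
    (hF : ContDiff ℝ 2 F) {φ : ℝ → ℝ × ℝ → ℝ} (hsol : IsAllenCahnSolution L T ε M F φ)
    (hreg₂ : MemBochnerSobolev L T 1 2 2 φ) (hreg₃ : MemBochnerSobolev L T 0 4 ⊤ φ) :
    ∃ B K Q D : ℝ, 0 ≤ B ∧ 0 ≤ Q ∧ 0 ≤ D ∧ ∀ (N : ℕ) [NeZero N] (h : ℝ), h = L / N →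
      (∃ Λ P : ℝ → Grid N, NodalCurve L T ε M h B K Q F (fun t => sample L N (φ t)) Λ P) ∧
      ∀ t ∈ Icc 0 T, |energyH h ε F (sample L N (φ t)) - energy L ε F (φ t)| ≤ D * h ^ 2 := by
  obtain ⟨B, hB⟩ := exists_fdBound hL hT hsol hreg₃
  obtain ⟨Q, hQ0, hQ⟩ := exists_lapH_time_lipschitz hL hT hsol hreg₂ hreg₃
  obtain ⟨K, hK⟩ := exists_localBound hF B
  have hB0 : 0 ≤ B := (hB 0 ⟨le_rfl, hT.le⟩).nonneg
  have hK0 := hK.nonneg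
  refine ⟨B, K, Q, ε ^ 2 / 2 * (11 * L ^ 2 * B ^ 2) + 2 * L ^ 2 * (K * B + 2 * K * B ^ 2), hB0, hQ0,
    by positivity, fun N _ h hN => ⟨?_, fun t ht => ?_⟩⟩
  · have hNpos : (0 : ℝ) < N := Nat.cast_pos.mpr (NeZero.pos N)
    have hh : 0 < h := by rw [hN]; positivity
    refine ⟨fun t => sample L N (laplace (φ t)), fun t => sample L N fun p =>
      M * (ε ^ 2 * laplace (φ t) p - deriv F (φ t p)), hN, hK, fun t ht i j => (hB t ht).bound _,
      fun t ht i j => (hB t ht).abs_laplace_le (hsol.contDiff t ht) _, fun t ht i j => ?_,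
      fun t ht i j => ?_, hQ N h hN, fun t ht i j => rfl, fun t ht i j => ?_⟩
    · rw [lapH_sample hN (hsol.periodic t ht)]
      exact (hB t ht).abs_lapD_le hh _
    · rw [lapH_sample hN (hsol.periodic t ht)]
      simp only [sample, ← hN]
      exact (hB t ht).abs_lapD_sub_laplace_le (hsol.contDiff t ht) hh _
    · exact (hsol.equation t ht _).congr_deriv (by simp only [sample]; ring)
  · exact (hB t ht).abs_energyH_sub_energy_le (hsol.contDiff t ht) hF hK hL hN (hsol.periodic t ht)

/-! ### Time derivatives of functionals on grids -/

section Derivatives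

variable {N : ℕ} [NeZero N] {h : ℝ} {U : ℝ → Grid N} {U' : Grid N} {S : Set ℝ} {t : ℝ}

lemma hasDerivWithinAt_innerM (hU : ∀ i j, HasDerivWithinAt (fun τ => U τ i j) (U' i j) S t)
    (w : Grid N) : HasDerivWithinAt (fun τ => innerM h (U τ) w) (innerM h U' w) S t :=
  (HasDerivWithinAt.fun_sum fun i _ => HasDerivWithinAt.fun_sum fun j _ =>
    (hU i j).mul_const (w i j)).const_mul _

lemma hasDerivWithinAt_gradSqTM (hU : ∀ i j, HasDerivWithinAt (fun τ => U τ i j) (U' i j) S t) :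
    HasDerivWithinAt (fun τ => gradSqTM h (U τ)) (2 * gradIn h (U t) U') S t := by
  have h1 := (HasDerivWithinAt.fun_sum (u := Finset.univ) fun i _ =>
    HasDerivWithinAt.fun_sum (u := Finset.univ) fun j _ =>
      (((hU (i + 1) j).fun_sub (hU i j)).div_const h).fun_pow 2).const_mul (h ^ 2)
  have h2 := (HasDerivWithinAt.fun_sum (u := Finset.univ) fun i _ =>
    HasDerivWithinAt.fun_sum (u := Finset.univ) fun j _ =>
      (((hU i (j + 1)).fun_sub (hU i j)).div_const h).fun_pow 2).const_mul (h ^ 2)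
  refine (h1.fun_add h2).congr_deriv ?_
  simp only [gradIn, innerM, diffX, diffY, Finset.mul_sum, mul_add]
  congr 1 <;>
  · refine Finset.sum_congr rfl fun i _ => Finset.sum_congr rfl fun j _ => ?_
    push_cast
    ring

lemma hasDerivWithinAt_energyH {F : ℝ → ℝ} (hF : Differentiable ℝ F) (hh : h ≠ 0) (ε : ℝ)
    (hU : ∀ i j, HasDerivWithinAt (fun τ => U τ i j) (U' i j) S t) :
    HasDerivWithinAt (fun τ => energyH h ε F (U τ))
      (innerM h (fun i j => -ε ^ 2 * lapH h (U t) i j + deriv F (U t i j)) U') S t := by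
  have h1 := (hasDerivWithinAt_gradSqTM (h := h) hU).const_mul (ε ^ 2 / 2)
  have h2 := (HasDerivWithinAt.fun_sum (u := Finset.univ) fun i _ =>
    HasDerivWithinAt.fun_sum (u := Finset.univ) fun j _ =>
      (hF (U t i j)).hasDerivAt.comp_hasDerivWithinAt t (hU i j)).const_mul (h ^ 2)
  refine (h1.fun_add h2).congr_deriv ?_
  have e : (fun i j => -ε ^ 2 * lapH h (U t) i j + deriv F (U t i j) : Grid N) =
      (-ε ^ 2) • lapH h (U t) + fun i j => deriv F (U t i j) := by ext i j; rfl
  rw [e, innerM_add_left, innerM_smul_left, innerM_lapH _ _ hh]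
  simp only [innerM]
  ring

end Derivatives

namespace NodalCurve

variable {N : ℕ} [NeZero N] {L T ε M h B K Q : ℝ} {F : ℝ → ℝ} {Φ Λ P : ℝ → Grid N}

/-- Bound for the time derivative. -/
def velBound (ε M B K : ℝ) : ℝ := M * (ε ^ 2 * (2 * B) + K)

/-- Lipschitz constant of the time derivative. -/
def velLip (L ε M B K Q : ℝ) : ℝ :=
  M * (ε ^ 2 * (√Q + 2 * L * B) + L * (K * velBound ε M B K))

lemma h_pos (hc : NodalCurve L T ε M h B K Q F Φ Λ P) (hL : 0 < L) : 0 < h := by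
  have hNpos : (0 : ℝ) < N := Nat.cast_pos.mpr (NeZero.pos N)
  rw [hc.mesh]; positivity

lemma abs_vel_le (hc : NodalCurve L T ε M h B K Q F Φ Λ P) (hM : 0 < M) {t : ℝ}
    (ht : t ∈ Icc 0 T) (i j : ZMod N) : |P t i j| ≤ velBound ε M B K := by
  rw [hc.deriv_eq t ht, abs_mul, abs_of_pos hM, velBound]
  gcongr
  refine (abs_sub _ _).trans ?_
  rw [abs_mul, abs_of_nonneg (sq_nonneg ε)]
  gcongr
  · exact hc.lap_bound t ht i j
  · exact hc.localBound.abs_deriv_le _ (abs_le.1 (hc.bound t ht i j))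

lemma abs_sub_le (hc : NodalCurve L T ε M h B K Q F Φ Λ P) (hM : 0 < M) {s t : ℝ}
    (hs : s ∈ Icc 0 T) (ht : t ∈ Icc 0 T) (i j : ZMod N) :
    |Φ t i j - Φ s i j| ≤ velBound ε M B K * |t - s| :=
  Convex.norm_image_sub_le_of_norm_hasDerivWithin_le (fun τ hτ => hc.hasDeriv τ hτ i j)
    (fun _ hτ => hc.abs_vel_le hM hτ i j) (convex_Icc _ _) hs ht

lemma normM_lapH_sub_le (hc : NodalCurve L T ε M h B K Q F Φ Λ P) (hQ : 0 ≤ Q) {s t : ℝ}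
    (hs : s ∈ Icc 0 T) (ht : t ∈ Icc 0 T) :
    normM h (lapH h (Φ t) - lapH h (Φ s)) ≤ √Q * (|t - s| + h ^ 2) := by
  refine Real.sqrt_le_iff.2 ⟨by positivity, (hc.lap_lip s hs t ht).trans ?_⟩
  rw [mul_pow, Real.sq_sqrt hQ]
  gcongr
  have : 0 ≤ |t - s| * h ^ 2 := by positivity
  nlinarith

/-- The equation expresses the velocity through the sampled Laplacian. Replacing that by `lapH`
costs `O(h²)` at each time and makes `lap_lip` available; the nonlinear term is Lipschitz. -/
lemma normM_vel_sub_le (hc : NodalCurve L T ε M h B K Q F Φ Λ P) (hL : 0 < L) (hM : 0 < M)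
    (hB : 0 ≤ B) (hQ : 0 ≤ Q) {s t : ℝ} (hs : s ∈ Icc 0 T) (ht : t ∈ Icc 0 T) :
    normM h (P t - P s) ≤ velLip L ε M B K Q * (|t - s| + h ^ 2) := by
  have hK := hc.localBound.nonneg
  have hV : 0 ≤ velBound ε M B K := by unfold velBound; positivity
  set E : ℝ → Grid N := fun τ => lapH h (Φ τ) - Λ τ
  set G : ℝ → Grid N := fun τ i j => deriv F (Φ τ i j)
  have e : P t - P s = M • (ε ^ 2 • (lapH h (Φ t) - lapH h (Φ s) - (E t - E s)) - (G t - G s)) := by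
    ext i j
    simp only [Pi.sub_apply, Pi.smul_apply, smul_eq_mul, hc.deriv_eq t ht, hc.deriv_eq s hs, E, G]
    ring
  have hE : ∀ τ ∈ Icc 0 T, normM h (E τ) ≤ L * (B * h ^ 2) := fun τ hτ =>
    normM_le_of_abs_le hL.le hc.mesh (by positivity) (hc.lap_sub τ hτ)
  have hG : normM h (G t - G s) ≤ L * (K * (velBound ε M B K * |t - s|)) := by
    refine normM_le_of_abs_le hL.le hc.mesh (by positivity) fun i j => ?_
    refine (hc.localBound.deriv_lip _ (abs_le.1 (hc.bound s hs i j)) _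
      (abs_le.1 (hc.bound t ht i j))).trans ?_
    gcongr
    exact hc.abs_sub_le hM hs ht i j
  have h1 := normM_sub_le (h := h) (ε ^ 2 • (lapH h (Φ t) - lapH h (Φ s) - (E t - E s))) (G t - G s)
  have h2 := normM_sub_le (h := h) (lapH h (Φ t) - lapH h (Φ s)) (E t - E s)
  have h3 := normM_sub_le (h := h) (E t) (E s)
  have h4 := hc.normM_lapH_sub_le hQ hs ht
  rw [normM_smul, abs_of_nonneg (sq_nonneg ε)] at h1
  rw [e, normM_smul, abs_of_pos hM, velLip, mul_assoc]
  gcongr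
  have h5 : normM h (lapH h (Φ t) - lapH h (Φ s) - (E t - E s)) ≤
      (√Q + 2 * L * B) * (|t - s| + h ^ 2) := by
    have := hE t ht
    have := hE s hs
    have : 0 ≤ L * B * |t - s| := by positivity
    linarith
  have h6 : L * (K * (velBound ε M B K * |t - s|)) ≤
      L * (K * velBound ε M B K) * (|t - s| + h ^ 2) := by
    have : 0 ≤ L * (K * velBound ε M B K) * h ^ 2 := by positivity
    linarith
  have h7 := mul_le_mul_of_nonneg_left h5 (sq_nonneg ε)
  linarith

/-- The difference quotient in time. -/
def quot (Φ : ℝ → Grid N) (t dt : ℝ) : Grid N := (1 / dt) • (Φ (t + dt) - Φ t)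

lemma normM_quot_sub_vel_le (hc : NodalCurve L T ε M h B K Q F Φ Λ P) (hL : 0 < L) (hM : 0 < M)
    (hB : 0 ≤ B) (hQ : 0 ≤ Q) {t dt : ℝ} (ht : 0 ≤ t) (hdt : 0 < dt) (htT : t + dt ≤ T) :
    normM h (quot Φ t dt - P t) ≤ velLip L ε M B K Q * (h ^ 2 + dt) := by
  have hK := hc.localBound.nonneg
  have hV : 0 ≤ velLip L ε M B K Q := by unfold velLip velBound; positivity
  have hsub : Icc t (t + dt) ⊆ Icc 0 T := Icc_subset_Icc ht htT
  have htm : t ∈ Icc 0 T := hsub ⟨le_rfl, by linarith⟩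
  set v := quot Φ t dt - P t with hv
  -- Pairing with `v`, the very vector to be estimated, reduces the claim to a scalar mean value
  -- inequality with `‖v‖²` on the left and `‖v‖` on the right.
  have hmvt := Convex.norm_image_sub_le_of_norm_hasDerivWithin_le
    (f := fun τ => innerM h (fun i j => Φ τ i j - τ * P t i j) v)
    (f' := fun τ => innerM h (P τ - P t) v) (s := Icc t (t + dt)) (x := t) (y := t + dt)
    (C := velLip L ε M B K Q * (h ^ 2 + dt) * normM h v)
    (fun τ hτ => hasDerivWithinAt_innerM (fun i j => by
      have := ((hc.hasDeriv τ (hsub hτ) i j).mono hsub).sub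
        (((hasDerivAt_id τ).mul_const (P t i j)).hasDerivWithinAt)
      exact this.congr_deriv (by simp)) v)
    (fun τ hτ => by
      refine (abs_innerM_le _ _).trans (mul_le_mul_of_nonneg_right ?_ (normM_nonneg _))
      refine (hc.normM_vel_sub_le hL hM hB hQ htm (hsub hτ)).trans ?_
      rw [abs_of_nonneg (by linarith [hτ.1]), add_comm]
      gcongr
      linarith [hτ.2])
    (convex_Icc _ _) ⟨le_rfl, by linarith⟩ ⟨by linarith, le_rfl⟩
  rw [← innerM_sub_left, add_sub_cancel_left, Real.norm_eq_abs, Real.norm_eq_abs,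
    abs_of_pos hdt] at hmvt
  have e : ((fun i j => Φ (t + dt) i j - (t + dt) * P t i j) - fun i j => Φ t i j - t * P t i j :
      Grid N) = dt • v := by
    ext i j
    simp only [v, quot, Pi.sub_apply, Pi.smul_apply, smul_eq_mul]
    field_simp
    ring
  rw [e, innerM_smul_left, abs_mul, abs_of_pos hdt] at hmvt
  have h1 : normM h v * normM h v = innerM h v v := by rw [← sq, normM_sq]; rfl
  rw [← h1, abs_of_nonneg (mul_nonneg (normM_nonneg _) (normM_nonneg _))] at hmvt
  rcases (normM_nonneg (h := h) v).eq_or_lt with h0 | h0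
  · rw [← h0]; positivity
  · have h2 : (dt * normM h v) * normM h v ≤
        (dt * normM h v) * (velLip L ε M B K Q * (h ^ 2 + dt)) := by linarith
    exact le_of_mul_le_mul_left h2 (by positivity)

lemma normM_vel_le (hc : NodalCurve L T ε M h B K Q F Φ Λ P) (hL : 0 < L) (hM : 0 < M)
    (hB : 0 ≤ B) {t : ℝ} (ht : t ∈ Icc 0 T) : normM h (P t) ≤ L * velBound ε M B K := by
  have hK := hc.localBound.nonneg
  exact normM_le_of_abs_le hL.le hc.mesh (by unfold velBound; positivity)
    (hc.abs_vel_le hM ht)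

lemma normM_quot_le (hc : NodalCurve L T ε M h B K Q F Φ Λ P) (hL : 0 < L) (hM : 0 < M)
    (hB : 0 ≤ B) {t dt : ℝ} (ht : 0 ≤ t) (hdt : 0 < dt) (htT : t + dt ≤ T) :
    normM h (quot Φ t dt) ≤ L * velBound ε M B K := by
  have hK := hc.localBound.nonneg
  refine normM_le_of_abs_le hL.le hc.mesh (by unfold velBound; positivity) fun i j => ?_
  have := hc.abs_sub_le hM (s := t) (t := t + dt) ⟨ht, by linarith⟩ ⟨by linarith, htT⟩ i j
  rw [add_sub_cancel_left, abs_of_pos hdt] at this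
  simp only [quot, Pi.smul_apply, Pi.sub_apply, smul_eq_mul]
  rw [abs_mul, abs_of_pos (by positivity), one_div, inv_mul_le_iff₀ hdt]
  linarith

/-- Truncation error of the scheme. -/
lemma normM_trunc_le (hc : NodalCurve L T ε M h B K Q F Φ Λ P) (hL : 0 < L) (hM : 0 < M)
    (hB : 0 ≤ B) (hQ : 0 ≤ Q) (s : ℝ) {t dt : ℝ} (ht : 0 ≤ t) (hdt : 0 < dt) (htT : t + dt ≤ T) :
    normM h (fun i j => 1 / M * quot Φ t dt i j - ε ^ 2 * lapH h (Φ t) i j + deriv F (Φ t i j) -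
        s * ε ^ 2 * (lapH h (Φ (t + dt)) i j - lapH h (Φ t) i j)) ≤
      (1 / M * velLip L ε M B K Q + ε ^ 2 * (L * B) + |s| * ε ^ 2 * √Q) * (h ^ 2 + dt) := by
  have htm : t ∈ Icc 0 T := ⟨ht, by linarith⟩
  have htm' : t + dt ∈ Icc 0 T := ⟨by linarith, htT⟩
  have e : (fun i j => 1 / M * quot Φ t dt i j - ε ^ 2 * lapH h (Φ t) i j + deriv F (Φ t i j) -
        s * ε ^ 2 * (lapH h (Φ (t + dt)) i j - lapH h (Φ t) i j) : Grid N) =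
      (1 / M) • (quot Φ t dt - P t) - ε ^ 2 • (lapH h (Φ t) - Λ t) -
        (s * ε ^ 2) • (lapH h (Φ (t + dt)) - lapH h (Φ t)) := by
    ext i j
    simp only [Pi.sub_apply, Pi.smul_apply, smul_eq_mul, hc.deriv_eq t htm]
    field_simp
    ring
  rw [e]
  have h1 := normM_sub_le (h := h) ((1 / M) • (quot Φ t dt - P t) - ε ^ 2 • (lapH h (Φ t) - Λ t))
    ((s * ε ^ 2) • (lapH h (Φ (t + dt)) - lapH h (Φ t)))
  have h2 := normM_sub_le (h := h) ((1 / M) • (quot Φ t dt - P t)) (ε ^ 2 • (lapH h (Φ t) - Λ t))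
  rw [normM_smul, normM_smul] at h2
  rw [normM_smul] at h1
  have h3 := hc.normM_quot_sub_vel_le hL hM hB hQ ht hdt htT
  have h4 : normM h (lapH h (Φ t) - Λ t) ≤ L * (B * h ^ 2) :=
    normM_le_of_abs_le hL.le hc.mesh (by positivity) (hc.lap_sub t htm)
  have h5 := hc.normM_lapH_sub_le hQ htm htm'
  rw [add_sub_cancel_left, abs_of_pos hdt] at h5
  rw [abs_of_pos (by positivity : 0 < 1 / M), abs_of_nonneg (sq_nonneg ε)] at h2
  rw [abs_mul, abs_of_nonneg (sq_nonneg ε)] at h1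
  have g3 := mul_le_mul_of_nonneg_left h3 (by positivity : 0 ≤ 1 / M)
  have g4 := mul_le_mul_of_nonneg_left h4 (sq_nonneg ε)
  have g5 := mul_le_mul_of_nonneg_left h5 (by positivity : 0 ≤ |s| * ε ^ 2)
  have g6 : 0 ≤ ε ^ 2 * (L * B) * dt := by positivity
  nlinarith

/-- Discrete energy balance along the exact solution. -/
lemma abs_energy_balance_le (hc : NodalCurve L T ε M h B K Q F Φ Λ P) (hF : Differentiable ℝ F)
    (hL : 0 < L) (hM : 0 < M) (hB : 0 ≤ B) (hQ : 0 ≤ Q) {t dt : ℝ} (ht : 0 ≤ t) (hdt : 0 < dt)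
    (htT : t + dt ≤ T) :
    |energyH h ε F (Φ (t + dt)) - energyH h ε F (Φ t) + dt / M * normSqM h (quot Φ t dt)| ≤
      (4 / M * velLip L ε M B K Q * (L * velBound ε M B K) +
        ε ^ 2 * (L * B) * (L * velBound ε M B K)) * (dt * (h ^ 2 + dt)) := by
  have hK := hc.localBound.nonneg
  have hh := hc.h_pos hL
  set V := L * velBound ε M B K with hVdef
  set D := velLip L ε M B K Q with hDdef
  have hV : 0 ≤ V := by simp only [V]; unfold velBound; positivity
  have hD : 0 ≤ D := by simp only [D]; unfold velLip velBound; positivity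
  have hsub : Icc t (t + dt) ⊆ Icc 0 T := Icc_subset_Icc ht htT
  have htm : t ∈ Icc 0 T := hsub ⟨le_rfl, by linarith⟩
  have diffSq : ∀ u v : Grid N, |normSqM h u - normSqM h v| ≤
      normM h (u - v) * (normM h u + normM h v) := by
    intro u v
    have e : normSqM h u - normSqM h v = innerM h (u - v) (u + v) := by
      rw [innerM_sub_left, innerM_add_right, innerM_add_right, innerM_comm v u]
      simp only [normSqM]; ring
    rw [e]
    exact (abs_innerM_le _ _).trans
      (mul_le_mul_of_nonneg_left (normM_add_le _ _) (normM_nonneg _))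
  -- By the equation, the energy decays at the rate `‖P τ‖² / M` up to the consistency error of the
  -- Laplacian, and freezing the rate at time `t` costs `O(h² + dt)`.
  have hder : ∀ τ ∈ Icc t (t + dt),
      |innerM h (fun i j => -ε ^ 2 * lapH h (Φ τ) i j + deriv F (Φ τ i j)) (P τ) +
        1 / M * normSqM h (P t)| ≤
        (2 / M * D * V + ε ^ 2 * (L * B) * V) * (h ^ 2 + dt) := by
    intro τ hτ
    have e : (fun i j => -ε ^ 2 * lapH h (Φ τ) i j + deriv F (Φ τ i j) : Grid N) =
        -((1 / M) • P τ) - ε ^ 2 • (lapH h (Φ τ) - Λ τ) := by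
      ext i j
      simp only [Pi.sub_apply, Pi.smul_apply, Pi.neg_apply, smul_eq_mul, hc.deriv_eq τ (hsub hτ)]
      field_simp
      ring
    rw [e, innerM_sub_left, innerM_neg_left, innerM_smul_left, innerM_smul_left]
    have h1 := diffSq (P τ) (P t)
    have h2 := hc.normM_vel_sub_le hL hM hB hQ htm (hsub hτ)
    rw [abs_of_nonneg (by linarith [hτ.1])] at h2
    have h3 := hc.normM_vel_le hL hM hB (hsub hτ)
    have h4 := hc.normM_vel_le hL hM hB htm
    have h5 : normM h (lapH h (Φ τ) - Λ τ) ≤ L * (B * h ^ 2) :=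
      normM_le_of_abs_le hL.le hc.mesh (by positivity) (hc.lap_sub τ (hsub hτ))
    have h6 : |innerM h (lapH h (Φ τ) - Λ τ) (P τ)| ≤ L * (B * h ^ 2) * V :=
      (abs_innerM_le _ _).trans (mul_le_mul h5 h3 (normM_nonneg _) (by positivity))
    have h7 : |normSqM h (P τ) - normSqM h (P t)| ≤ (D * (h ^ 2 + dt)) * (V + V) := by
      refine h1.trans (mul_le_mul (h2.trans ?_) (add_le_add h3 h4)
        (add_nonneg (normM_nonneg _) (normM_nonneg _)) (by positivity))
      rw [add_comm]
      gcongr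
      linarith [hτ.2]
    have e2 : -(1 / M * innerM h (P τ) (P τ)) - ε ^ 2 * innerM h (lapH h (Φ τ) - Λ τ) (P τ) +
        1 / M * normSqM h (P t) = -(1 / M * (normSqM h (P τ) - normSqM h (P t))) -
          ε ^ 2 * innerM h (lapH h (Φ τ) - Λ τ) (P τ) := by
      simp only [normSqM]; ring
    rw [e2]
    refine (abs_sub _ _).trans ?_
    rw [abs_neg, abs_mul, abs_mul, abs_of_pos (by positivity : 0 < 1 / M),
      abs_of_nonneg (sq_nonneg ε)]
    have g1 := mul_le_mul_of_nonneg_left h7 (by positivity : 0 ≤ 1 / M)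
    have g2 := mul_le_mul_of_nonneg_left h6 (sq_nonneg ε)
    have g3 : 0 ≤ ε ^ 2 * (L * B) * V * dt := by positivity
    have g4 : 1 / M * (D * (h ^ 2 + dt) * (V + V)) = 2 / M * D * V * (h ^ 2 + dt) := by ring
    nlinarith
  have hmvt := Convex.norm_image_sub_le_of_norm_hasDerivWithin_le
    (f := fun τ => energyH h ε F (Φ τ) + τ * (1 / M * normSqM h (P t)))
    (f' := fun τ => innerM h (fun i j => -ε ^ 2 * lapH h (Φ τ) i j + deriv F (Φ τ i j)) (P τ) +
        1 / M * normSqM h (P t)) (s := Icc t (t + dt)) (x := t) (y := t + dt)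
    (fun τ hτ => by
      have h1 := hasDerivWithinAt_energyH hF hh.ne' ε
        (fun i j => (hc.hasDeriv τ (hsub hτ) i j).mono hsub)
      have h2 := h1.fun_add ((hasDerivAt_id τ).mul_const (1 / M * normSqM h (P t))).hasDerivWithinAt
      exact h2.congr_deriv (by simp))
    hder (convex_Icc _ _) ⟨le_rfl, by linarith⟩ ⟨by linarith, le_rfl⟩
  rw [add_sub_cancel_left, Real.norm_eq_abs, Real.norm_eq_abs, abs_of_pos hdt] at hmvt
  have h8 : |normSqM h (quot Φ t dt) - normSqM h (P t)| ≤ (D * (h ^ 2 + dt)) * (V + V) :=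
    (diffSq _ _).trans (mul_le_mul (hc.normM_quot_sub_vel_le hL hM hB hQ ht hdt htT)
      (add_le_add (hc.normM_quot_le hL hM hB ht hdt htT) (hc.normM_vel_le hL hM hB htm))
      (add_nonneg (normM_nonneg _) (normM_nonneg _)) (by positivity))
  have e : energyH h ε F (Φ (t + dt)) - energyH h ε F (Φ t) + dt / M * normSqM h (quot Φ t dt) =
      (energyH h ε F (Φ (t + dt)) + (t + dt) * (1 / M * normSqM h (P t)) -
        (energyH h ε F (Φ t) + t * (1 / M * normSqM h (P t)))) +
      dt / M * (normSqM h (quot Φ t dt) - normSqM h (P t)) := by ring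
  rw [e]
  refine (abs_add_le _ _).trans ?_
  rw [abs_mul, abs_of_pos (by positivity : 0 < dt / M)]
  have g1 := mul_le_mul_of_nonneg_left h8 (by positivity : 0 ≤ dt / M)
  have e2 : dt / M * (D * (h ^ 2 + dt) * (V + V)) = 2 / M * D * V * (dt * (h ^ 2 + dt)) := by ring
  have e3 : (4 / M * D * V + ε ^ 2 * (L * B) * V) * (dt * (h ^ 2 + dt)) =
    (2 / M * D * V + ε ^ 2 * (L * B) * V) * (h ^ 2 + dt) * dt +
      2 / M * D * V * (dt * (h ^ 2 + dt)) := by ring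
  linarith

end NodalCurve

end

section

/-! ### One step of the scheme -/

open NodalCurve (quot)

/-- The exact solution on the grid is consistent with the scheme, with constant `b`. -/
structure Consistent {N : ℕ} [NeZero N] (L T ε M s C₀ h b : ℝ) (F : ℝ → ℝ) (Φ : ℝ → Grid N)
    (R : ℝ → ℝ) : Prop where
  mesh : h = L / N
  bound : ∀ t ∈ Icc 0 T, ∀ i j, |Φ t i j| ≤ b
  lap : ∀ t ∈ Icc 0 T, normM h (lapH h (Φ t)) ≤ b
  grad : ∀ t ∈ Icc 0 T, gradSqTM h (Φ t) ≤ b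
  energy : ∀ t ∈ Icc 0 T, |energyH h ε F (Φ t) + C₀ - R t| ≤ b * h ^ 2
  quot : ∀ t dt, 0 ≤ t → 0 < dt → t + dt ≤ T → normM h (quot Φ t dt) ≤ b
  trunc : ∀ t dt, 0 ≤ t → 0 < dt → t + dt ≤ T →
    normM h (fun i j => 1 / M * NodalCurve.quot Φ t dt i j - ε ^ 2 * lapH h (Φ t) i j +
      deriv F (Φ t i j) - s * ε ^ 2 * (lapH h (Φ (t + dt)) i j - lapH h (Φ t) i j)) ≤
      b * (h ^ 2 + dt)
  balance : ∀ t dt, 0 ≤ t → 0 < dt → t + dt ≤ T →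
    |energyH h ε F (Φ (t + dt)) - energyH h ε F (Φ t) +
      dt / M * normSqM h (NodalCurve.quot Φ t dt)| ≤ b * (dt * (h ^ 2 + dt))

/-- One step `(φ, R) → (φ', R')` of the scheme with energy `E` and `ξ = R' / E`. -/
structure Step {N : ℕ} [NeZero N] (h dt ε M s ξ E R R' : ℝ) (F : ℝ → ℝ) (φ φ' : Grid N) :
    Prop where
  phi : (1 / M) • ((1 / dt) • (φ' - φ)) = (s * ε ^ 2) • (lapH h φ' - lapH h φ) +
    ξ • (ε ^ 2 • lapH h φ - fun i j => deriv F (φ i j))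
  R_eq : R' - R = -(dt / M) * normSqM h ((1 / dt) • (φ' - φ))
  xi : R' = ξ * E

/-- The weights are chosen so that half of the dissipation `normSqM h v / M` survives absorption. -/
lemma innerM_young {N : ℕ} [NeZero N] {h M : ℝ} (hM : 0 < M) (u v : Grid N) :
    innerM h u v ≤ 1 / (2 * M) * normSqM h v + M / 2 * normSqM h u := by
  have h1 := normSqM_nonneg (h := h) (v + (-M) • u)
  rw [normSqM_add, innerM_smul_right, normSqM_smul, innerM_comm v u] at h1
  have h2 : 0 ≤ 1 / (2 * M) * (normSqM h v + 2 * (-M * innerM h u v) + (-M) ^ 2 * normSqM h u) :=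
    mul_nonneg (by positivity) h1
  have e : 1 / (2 * M) * (normSqM h v + 2 * (-M * innerM h u v) + (-M) ^ 2 * normSqM h u) =
      1 / (2 * M) * normSqM h v + M / 2 * normSqM h u - innerM h u v := by
    field_simp; ring
  linarith

lemma sum_abs_le_normM {N : ℕ} [NeZero N] {L h : ℝ} (hL : 0 < L) (hN : h = L / N) (u : Grid N) :
    h ^ 2 * ∑ i, ∑ j, |u i j| ≤ L * normM h u := by
  have h1 := innerM_le (h := h) (fun i j => |u i j|) (fun _ _ => 1)
  have h2 : normM h (fun i j => |u i j|) = normM h u := by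
    simp only [normM, normSqM, innerM, abs_mul_abs_self]
  have h3 : normM h (fun _ _ => 1 : Grid N) ≤ L * 1 :=
    normM_le_of_abs_le hL.le hN one_pos.le (fun _ _ => by simp)
  rw [h2] at h1
  simp only [innerM, mul_one] at h1 h3
  have := mul_le_mul_of_nonneg_left h3 (normM_nonneg (h := h) u)
  linarith

namespace Step

variable {N : ℕ} [NeZero N] {L h dt ε M s ξ E R R' : ℝ} {F : ℝ → ℝ} {φ φ' : Grid N}

/-- Lower bound for `ξ`. -/
lemma le_xi_mul (hst : Step h dt ε M s ξ E R R' F φ φ') (hL : 0 < L) (hN : h = L / N)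
    (hdt : 0 < dt) (hM : 0 < M) (hs : 0 < s) (hξ : 0 ≤ ξ) {T Ξ Em g k : ℝ} (hdT : dt ≤ T)
    (hξΞ : ξ ≤ Ξ) (hE : E ≤ Em) (hg : gradSqTM h φ ≤ g) (hk : ∀ i j, |deriv F (φ i j)| ≤ k) :
    R ≤ ξ * (Em + Ξ * (ε ^ 2 * g / (2 * s) + M * T * (L ^ 2 * k ^ 2))) := by
  have hNpos : (0 : ℝ) < N := Nat.cast_pos.mpr (NeZero.pos N)
  have hh : h ≠ 0 := by rw [hN]; positivity
  set d := (1 / dt) • (φ' - φ) with hd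
  have hlap : lapH h φ' - lapH h φ = dt • lapH h d := by
    rw [hd, lapH_smul, lapH_sub, smul_smul, mul_one_div_cancel hdt.ne', one_smul]
  have hphi : (1 / M) • d = _ := hst.phi
  have hReq : R' - R = -(dt / M) * normSqM h d := hst.R_eq
  clear_value d
  set f : Grid N := fun i j => deriv F (φ i j) with hf
  -- The scheme tested with the discrete velocity `d`.
  have h1 : 1 / M * normSqM h d = -(s * ε ^ 2 * dt * gradSqTM h d) - ξ * ε ^ 2 * gradIn h φ d -
      ξ * innerM h f d := by
    have := congrArg (fun u => innerM h u d) hphi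
    beta_reduce at this
    rw [hlap, innerM_smul_left, innerM_add_left, innerM_smul_left, innerM_smul_left,
      innerM_smul_left, innerM_sub_left, innerM_smul_left, innerM_lapH _ _ hh,
      innerM_lapH _ _ hh] at this
    rw [normSqM, this, gradSqTM_eq]
    ring
  -- Completing the square lets the stabilising term absorb the cross term at a cost of order `ξ² /
  -- dt`. The dissipation in one step carries a factor `dt`, so it is of order `ξ²`.
  have h2 : 0 ≤ s * ε ^ 2 * dt * gradSqTM h (d + (ξ / (2 * s * dt)) • φ) :=
    mul_nonneg (by positivity) (gradSqTM_nonneg _)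
  rw [gradSqTM_add, gradIn_smul_right, gradSqTM_smul (ξ / (2 * s * dt)) φ, gradIn_comm] at h2
  have e2 : s * ε ^ 2 * dt * (gradSqTM h d + 2 * (ξ / (2 * s * dt) * gradIn h φ d) +
      (ξ / (2 * s * dt)) ^ 2 * gradSqTM h φ) = s * ε ^ 2 * dt * gradSqTM h d +
      ξ * ε ^ 2 * gradIn h φ d + ξ ^ 2 * (ε ^ 2 * gradSqTM h φ / (4 * s * dt)) := by
    field_simp
    ring
  rw [e2] at h2
  have h3 := innerM_young hM (h := h) ((-ξ) • f) d
  rw [innerM_smul_left, normSqM_smul] at h3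
  have h4 : normSqM h f ≤ L ^ 2 * k ^ 2 := normSqM_le_of_abs_le hN hk
  have h5 : 1 / (2 * M) * normSqM h d ≤
      ξ ^ 2 * (ε ^ 2 * gradSqTM h φ / (4 * s * dt) + M / 2 * normSqM h f) := by
    have : 1 / M * normSqM h d = 2 * (1 / (2 * M) * normSqM h d) := by field_simp
    linarith
  have h6 : dt / M * normSqM h d ≤ ξ ^ 2 * (ε ^ 2 * gradSqTM h φ / (2 * s) + M * dt * normSqM h f) := by
    have := mul_le_mul_of_nonneg_left h5 (by positivity : 0 ≤ 2 * dt)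
    have e3 : 2 * dt * (1 / (2 * M) * normSqM h d) = dt / M * normSqM h d := by field_simp
    have e4 : 2 * dt * (ξ ^ 2 * (ε ^ 2 * gradSqTM h φ / (4 * s * dt) + M / 2 * normSqM h f)) =
        ξ ^ 2 * (ε ^ 2 * gradSqTM h φ / (2 * s) + M * dt * normSqM h f) := by field_simp; ring
    linarith
  have hf0 := normSqM_nonneg (h := h) f
  have hG0 := gradSqTM_nonneg (h := h) φ
  have hT : 0 < T := by linarith
  have h7 : ε ^ 2 * gradSqTM h φ / (2 * s) + M * dt * normSqM h f ≤
      ε ^ 2 * g / (2 * s) + M * T * (L ^ 2 * k ^ 2) := by gcongr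
  have h8 : 0 ≤ ε ^ 2 * g / (2 * s) + M * T * (L ^ 2 * k ^ 2) := by
    have : 0 ≤ g := hG0.trans hg
    positivity
  -- One of the two factors `ξ` is replaced by `Ξ`; as `R' = ξ * E` is also linear in `ξ`, so is the
  -- resulting upper bound for `R`.
  have h9 : dt / M * normSqM h d ≤
      ξ * (Ξ * (ε ^ 2 * g / (2 * s) + M * T * (L ^ 2 * k ^ 2))) := by
    refine h6.trans ?_
    rw [sq, mul_assoc]
    have : 0 ≤ Ξ := hξ.trans hξΞ
    gcongr
  have h10 : R' ≤ ξ * Em := by rw [hst.xi]; gcongr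
  linarith

/-- The residual of the error equation. -/
def residual (h M ε s ξ dt t : ℝ) (F : ℝ → ℝ) (φ : Grid N) (Φ : ℝ → Grid N) : Grid N :=
  (ξ - 1) • (ε ^ 2 • lapH h (Φ t) - fun i j => deriv F (Φ t i j)) -
    ξ • (fun i j => deriv F (φ i j) - deriv F (Φ t i j)) -
    fun i j => 1 / M * quot Φ t dt i j - ε ^ 2 * lapH h (Φ t) i j +
      deriv F (Φ t i j) - s * ε ^ 2 * (lapH h (Φ (t + dt)) i j - lapH h (Φ t) i j)

lemma error_eq (hst : Step h dt ε M s ξ E R R' F φ φ') (Φ : ℝ → Grid N) (t : ℝ) :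
    (1 / M) • ((1 / dt) • ((φ' - Φ (t + dt)) - (φ - Φ t))) =
      (s * ε ^ 2) • (lapH h (φ' - Φ (t + dt)) - lapH h (φ - Φ t)) +
        (ξ * ε ^ 2) • lapH h (φ - Φ t) + residual h M ε s ξ dt t F φ Φ := by
  have h1 := hst.phi
  ext i j
  have h2 := congrFun (congrFun h1 i) j
  simp only [lapH_sub, residual, quot, Pi.sub_apply, Pi.smul_apply, Pi.add_apply, smul_eq_mul]
    at h2 ⊢
  linarith

/-- Energy estimate for the error. -/
lemma energy_step (hst : Step h dt ε M s ξ E R R' F φ φ') (hh : h ≠ 0) (hdt : 0 < dt) (hM : 0 < M)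
    {c Ξ : ℝ} (hc : 0 < c) (hcξ : c ≤ ξ) (hξΞ : ξ ≤ Ξ) (hξs : ξ ≤ 2 * s) (Φ : ℝ → Grid N) (t : ℝ) :
    dt / (2 * M * Ξ) * normSqM h ((1 / dt) • ((φ' - Φ (t + dt)) - (φ - Φ t))) +
      ε ^ 2 / 2 * (gradSqTM h (φ' - Φ (t + dt)) - gradSqTM h (φ - Φ t)) ≤
      dt * (M / (2 * c)) * normSqM h (residual h M ε s ξ dt t F φ Φ) := by
  have heq := hst.error_eq Φ t
  set e := φ - Φ t with he
  set e' := φ' - Φ (t + dt) with he'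
  set a := (1 / dt) • (e' - e) with ha
  set q := residual h M ε s ξ dt t F φ Φ
  have hξ : 0 < ξ := hc.trans_le hcξ
  have hea : e' = e + dt • a := by
    rw [ha, smul_smul, mul_one_div_cancel hdt.ne', one_smul, add_sub_cancel]
  have hlap : lapH h e' - lapH h e = dt • lapH h a := by
    rw [ha, lapH_smul, ← lapH_sub, smul_smul, mul_one_div_cancel hdt.ne', one_smul]
  have hG : gradSqTM h e' = gradSqTM h e + 2 * (dt * gradIn h e a) + dt ^ 2 * gradSqTM h a := by
    rw [hea, gradSqTM_add, gradIn_smul_right, gradSqTM_smul]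
  clear_value a
  have h1 := congrArg (fun u => innerM h u a) heq
  beta_reduce at h1
  rw [hlap, innerM_smul_left, innerM_add_left, innerM_add_left, innerM_smul_left,
    innerM_smul_left, innerM_smul_left, innerM_lapH _ _ hh, innerM_lapH _ _ hh,
    ← gradSqTM_eq] at h1
  have h2 := innerM_young hM (h := h) q a
  have hA := normSqM_nonneg (h := h) a
  have hGa := gradSqTM_nonneg (h := h) a
  have hq := normSqM_nonneg (h := h) q
  change 1 / M * normSqM h a = _ at h1
  have e1 : 1 / M * normSqM h a = 2 * (1 / (2 * M) * normSqM h a) := by field_simp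
  have h3 : 1 / (2 * M) * normSqM h a + s * ε ^ 2 * dt * gradSqTM h a + ξ * ε ^ 2 * gradIn h e a ≤
      M / 2 * normSqM h q := by linarith
  -- This is where the condition on the stabilising constant is used.
  have h4 : 0 ≤ (s - ξ / 2) * (ε ^ 2 * dt * gradSqTM h a) :=
    mul_nonneg (by linarith) (by positivity)
  have h5 : 1 / (2 * M) * normSqM h a + ξ * (ε ^ 2 * (dt / 2 * gradSqTM h a + gradIn h e a)) ≤
      M / 2 * normSqM h q := by linarith
  -- Division by `ξ` frees the gradient difference of step-dependent weights, so that it telescopes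
  -- over the steps.
  have h6 := mul_le_mul_of_nonneg_left h5 (by positivity : 0 ≤ dt / ξ)
  have e2 : dt / ξ * (1 / (2 * M) * normSqM h a +
      ξ * (ε ^ 2 * (dt / 2 * gradSqTM h a + gradIn h e a))) =
      dt / (2 * M * ξ) * normSqM h a + ε ^ 2 / 2 * (gradSqTM h e' - gradSqTM h e) := by
    rw [hG]; field_simp; ring
  have e3 : dt / ξ * (M / 2 * normSqM h q) = dt * (M / (2 * ξ)) * normSqM h q := by
    field_simp
  rw [e2, e3] at h6
  have h7 : dt / (2 * M * Ξ) * normSqM h a ≤ dt / (2 * M * ξ) * normSqM h a := by gcongr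
  have h8 : dt * (M / (2 * ξ)) * normSqM h q ≤ dt * (M / (2 * c)) * normSqM h q := by gcongr
  linarith

/-- The discrete `H²` seminorm of the error grows only through the residuals. -/
lemma lap_step (hst : Step h dt ε M s ξ E R R' F φ φ') (hM : 0 < M) (hε : 0 < ε) (hs : 0 < s)
    (hξ : 0 ≤ ξ) (hξs : ξ ≤ 2 * s) (Φ : ℝ → Grid N) (t : ℝ) :
    normM h (lapH h (φ' - Φ (t + dt))) ≤ normM h (lapH h (φ - Φ t)) +
      1 / (s * ε ^ 2) * (1 / M * normM h ((1 / dt) • ((φ' - Φ (t + dt)) - (φ - Φ t))) +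
        normM h (residual h M ε s ξ dt t F φ Φ)) := by
  have heq := hst.error_eq Φ t
  set e := φ - Φ t with he
  set e' := φ' - Φ (t + dt) with he'
  set a := (1 / dt) • (e' - e) with ha
  set q := residual h M ε s ξ dt t F φ Φ
  -- The error equation solved for the new Laplacian; `0 ≤ ξ ≤ 2 * s` makes the amplification factor
  -- at most `1` in modulus.
  have h1 : lapH h e' = ((s - ξ) / s) • lapH h e + (1 / (s * ε ^ 2)) • ((1 / M) • a - q) := by
    rw [heq]
    ext i j
    simp only [Pi.sub_apply, Pi.smul_apply, Pi.add_apply, smul_eq_mul]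
    field_simp
    ring
  have h2 := normM_add_le (h := h) (((s - ξ) / s) • lapH h e)
    ((1 / (s * ε ^ 2)) • ((1 / M) • a - q))
  have h3 := normM_sub_le (h := h) ((1 / M) • a) q
  rw [normM_smul, normM_smul, abs_of_pos (by positivity : 0 < 1 / (s * ε ^ 2))] at h2
  rw [normM_smul, abs_of_pos (by positivity : 0 < 1 / M)] at h3
  have h4 : |(s - ξ) / s| ≤ 1 := by
    rw [abs_div, abs_of_pos hs, div_le_one hs, abs_le]
    constructor <;> linarith
  have h5 := mul_le_mul_of_nonneg_right h4 (normM_nonneg (h := h) (lapH h e))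
  have h6 := mul_le_mul_of_nonneg_left h3 (by positivity : 0 ≤ 1 / (s * ε ^ 2))
  rw [h1]
  linarith

/-- Error equation for the auxiliary variable. -/
lemma scalar_step (hst : Step h dt ε M s ξ E R R' F φ φ') (hM : 0 < M) {T C₀ b t : ℝ}
    {Φ : ℝ → Grid N} {Re : ℝ → ℝ} (hΦ : Consistent L T ε M s C₀ h b F Φ Re) (ht : 0 ≤ t)
    (hdt : 0 < dt) (htT : t + dt ≤ T) (hb : 0 ≤ b) {Rm S : ℝ}
    (hRm : |R' - (energyH h ε F (Φ (t + dt)) + C₀)| ≤ Rm)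
    (hS : (R' - (energyH h ε F (Φ (t + dt)) + C₀)) ^ 2 + (h ^ 2 + dt) ^ 2 ≤ S) :
    (R' - (energyH h ε F (Φ (t + dt)) + C₀)) ^ 2 - (R - (energyH h ε F (Φ t) + C₀)) ^ 2 ≤
      dt * ((2 * Rm / M + 1) * normSqM h ((1 / dt) • ((φ' - Φ (t + dt)) - (φ - Φ t))) +
        (4 * b ^ 2 / M ^ 2 + b) * S) := by
  set r := R - (energyH h ε F (Φ t) + C₀) with hr
  set r' := R' - (energyH h ε F (Φ (t + dt)) + C₀) with hr'
  set a := (1 / dt) • ((φ' - Φ (t + dt)) - (φ - Φ t)) with ha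
  set δ := h ^ 2 + dt with hδ
  have hδ0 : 0 ≤ δ := by positivity
  have hd : (1 / dt) • (φ' - φ) = a + quot Φ t dt := by
    ext i j
    simp only [a, quot, Pi.sub_apply, Pi.smul_apply, Pi.add_apply, smul_eq_mul]
    ring
  have h1 := hst.R_eq
  rw [hd, normSqM_add] at h1
  have h2 := abs_le.1 (hΦ.balance t dt ht hdt htT)
  set A := normSqM h a with hA
  have hA0 : 0 ≤ A := normSqM_nonneg a
  have h3 : |innerM h a (quot Φ t dt)| ≤ normM h a * b :=
    (abs_innerM_le _ _).trans (mul_le_mul_of_nonneg_left (hΦ.quot t dt ht hdt htT) (normM_nonneg _))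
  clear_value a
  set α := normM h a with hα
  have hα0 : 0 ≤ α := normM_nonneg a
  have hαA : α ^ 2 = A := normM_sq a
  have h4 : |r' - r| ≤ dt * (A / M + 2 * b / M * α + b * δ) := by
    have h3' := abs_le.1 h3
    have e : r' - r = -(dt / M) * A - 2 * (dt / M) * innerM h a (quot Φ t dt) -
        (energyH h ε F (Φ (t + dt)) - energyH h ε F (Φ t) +
          dt / M * normSqM h (quot Φ t dt)) := by
      simp only [hr, hr']; linarith
    have p : 0 < dt / M := by positivity
    have e5 : dt * (A / M + 2 * b / M * α + b * δ) =
        dt / M * A + 2 * (dt / M) * (α * b) + b * (dt * δ) := by field_simp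
    have pA : 0 ≤ dt / M * A := by positivity
    have m1 := mul_le_mul_of_nonneg_left h3'.1 p.le
    have m2 := mul_le_mul_of_nonneg_left h3'.2 p.le
    have m1' : -(dt / M * (α * b)) ≤ dt / M * innerM h a (quot Φ t dt) := by rwa [← mul_neg]
    rw [e, e5, abs_le]
    obtain ⟨h21, h22⟩ := h2
    rw [mul_assoc 2 (dt / M) (innerM h a (quot Φ t dt)), mul_assoc 2 (dt / M) (α * b)]
    generalize dt / M * innerM h a (quot Φ t dt) = x at *
    generalize dt / M * (α * b) = x2 at *
    generalize energyH h ε F (Φ (t + dt)) - energyH h ε F (Φ t) +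
          dt / M * normSqM h (quot Φ t dt) = x3 at *
    generalize b * (dt * δ) = x4 at *
    rw [neg_mul]
    generalize dt / M * A = x5 at *
    clear * - m1' m2 h21 h22 pA
    constructor <;> linarith
  have h5 : r' ^ 2 - r ^ 2 ≤ 2 * |r'| * |r' - r| := by
    have := le_abs_self (r' * (r' - r))
    rw [abs_mul] at this
    have := sq_nonneg (r' - r)
    linarith
  have h6 : 2 * |r'| * |r' - r| ≤ 2 * |r'| * (dt * (A / M + 2 * b / M * α + b * δ)) := by gcongr
  -- The term quadratic in the velocity error is handled with the a priori bound `Rm`, so its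
  -- coefficient is not small; the weight `η` in `errEnergy` compensates for this.
  have h7 : 2 * |r'| * (A / M) ≤ 2 * Rm / M * A := by
    have : |r'| * (2 * (A / M)) ≤ Rm * (2 * (A / M)) :=
      mul_le_mul_of_nonneg_right hRm (by positivity)
    have e6 : 2 * Rm / M * A = Rm * (2 * (A / M)) := by ring
    linarith
  have h8 : 2 * |r'| * (2 * b / M * α) ≤ A + 4 * b ^ 2 / M ^ 2 * r' ^ 2 := by
    have := sq_nonneg (α - 2 * b / M * |r'|)
    have e7 : (α - 2 * b / M * |r'|) ^ 2 = A - 2 * |r'| * (2 * b / M * α) +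
        4 * b ^ 2 / M ^ 2 * r' ^ 2 := by
      rw [← hαA, ← sq_abs r']; field_simp; ring
    linarith
  have h9 : 2 * |r'| * (b * δ) ≤ b * (r' ^ 2 + δ ^ 2) := by
    have h91 : 2 * |r'| * δ ≤ r' ^ 2 + δ ^ 2 := by
      have := sq_nonneg (|r'| - δ)
      rw [← sq_abs r']; linarith
    have h92 := mul_le_mul_of_nonneg_left h91 hb
    linarith
  have h10 : 4 * b ^ 2 / M ^ 2 * r' ^ 2 ≤ 4 * b ^ 2 / M ^ 2 * S := by
    gcongr
    have := sq_nonneg δ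
    linarith
  have h11 : b * (r' ^ 2 + δ ^ 2) ≤ b * S := by gcongr
  calc r' ^ 2 - r ^ 2 ≤ dt * (2 * |r'| * (A / M) + 2 * |r'| * (2 * b / M * α) +
        2 * |r'| * (b * δ)) := by linarith
    _ ≤ dt * (2 * Rm / M * A + (A + 4 * b ^ 2 / M ^ 2 * S) + b * S) := by
        refine mul_le_mul_of_nonneg_left ?_ hdt.le
        linarith
    _ = _ := by ring

end Step

end

section

/-! ### The stability estimate for one step -/

open NodalCurve (quot)

section Energy

variable {N : ℕ} [NeZero N] {L h ε B k : ℝ} {F : ℝ → ℝ}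

lemma sum_const_zmod (hN : h = L / N) (c : ℝ) : h ^ 2 * ∑ _i : ZMod N, ∑ _j : ZMod N, c = L ^ 2 * c := by
  have hNpos : (0 : ℝ) < N := Nat.cast_pos.mpr (NeZero.pos N)
  simp only [Finset.sum_const, Finset.card_univ, ZMod.card, nsmul_eq_mul]
  rw [hN]
  field_simp

lemma abs_sum_le {f : ℝ → ℝ} (hN : h = L / N) {u : Grid N} (hu : ∀ i j, |f (u i j)| ≤ k) :
    |h ^ 2 * ∑ i, ∑ j, f (u i j)| ≤ L ^ 2 * k := by
  rw [← sum_const_zmod hN k, abs_mul, abs_of_nonneg (sq_nonneg h)]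
  refine mul_le_mul_of_nonneg_left ?_ (sq_nonneg h)
  refine (Finset.abs_sum_le_sum_abs _ _).trans (Finset.sum_le_sum fun i _ => ?_)
  exact (Finset.abs_sum_le_sum_abs _ _).trans (Finset.sum_le_sum fun j _ => hu i j)

lemma abs_energyH_le (hN : h = L / N) {u : Grid N} (hu : ∀ i j, |F (u i j)| ≤ k) :
    |energyH h ε F u| ≤ ε ^ 2 / 2 * gradSqTM h u + L ^ 2 * k := by
  refine (abs_add_le _ _).trans (add_le_add ?_ (abs_sum_le hN hu))
  rw [abs_of_nonneg (mul_nonneg (by positivity) (gradSqTM_nonneg u))]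

lemma abs_gradIn_le (u v : Grid N) : |gradIn h u v| ≤ √(gradSqTM h u) * √(gradSqTM h v) := by
  rw [← Real.sqrt_mul (gradSqTM_nonneg u)]
  exact Real.abs_le_sqrt (gradIn_sq_le u v)

lemma abs_energyH_sub_le (hL : 0 < L) (hN : h = L / N) (hk : LocalBound F B k) {u v : Grid N}
    (hu : ∀ i j, |u i j| ≤ B) (hv : ∀ i j, |v i j| ≤ B) :
    |energyH h ε F u - energyH h ε F v| ≤
      ε ^ 2 / 2 * (2 * (√(gradSqTM h v) * √(gradSqTM h (u - v))) + gradSqTM h (u - v)) +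
        k * (L * normM h (u - v)) := by
  have h1 : gradSqTM h u = gradSqTM h v + 2 * gradIn h v (u - v) + gradSqTM h (u - v) := by
    rw [← gradSqTM_add, add_sub_cancel]
  have h2 := abs_le.1 (abs_gradIn_le (h := h) v (u - v))
  have h3 : |h ^ 2 * ∑ i, ∑ j, F (u i j) - h ^ 2 * ∑ i, ∑ j, F (v i j)| ≤
      k * (L * normM h (u - v)) := by
    refine le_trans ?_ (mul_le_mul_of_nonneg_left (sum_abs_le_normM hL hN (u - v)) hk.nonneg)
    rw [← mul_sub, abs_mul, abs_of_nonneg (sq_nonneg h), mul_left_comm]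
    refine mul_le_mul_of_nonneg_left ?_ (sq_nonneg h)
    rw [← Finset.sum_sub_distrib, Finset.mul_sum]
    refine (Finset.abs_sum_le_sum_abs _ _).trans (Finset.sum_le_sum fun i _ => ?_)
    rw [← Finset.sum_sub_distrib, Finset.mul_sum]
    exact (Finset.abs_sum_le_sum_abs _ _).trans (Finset.sum_le_sum fun j _ =>
      hk.lip _ (abs_le.1 (hv i j)) _ (abs_le.1 (hu i j)))
  have e : energyH h ε F u - energyH h ε F v =
      ε ^ 2 / 2 * (2 * gradIn h v (u - v) + gradSqTM h (u - v)) +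
        (h ^ 2 * ∑ i, ∑ j, F (u i j) - h ^ 2 * ∑ i, ∑ j, F (v i j)) := by
    simp only [energyH, h1]; ring
  rw [e]
  refine (abs_add_le _ _).trans (add_le_add ?_ h3)
  rw [abs_mul, abs_of_nonneg (by positivity : 0 ≤ ε ^ 2 / 2)]
  refine mul_le_mul_of_nonneg_left (abs_le.2 ?_) (by positivity)
  have := gradSqTM_nonneg (h := h) (u - v)
  constructor <;> linarith [h2.1, h2.2]

end Energy

namespace Step

variable {N : ℕ} [NeZero N] {L T C₀ K₁ b k h dt t ε M s ξ Ξ R R' : ℝ} {F Re : ℝ → ℝ}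
  {φ φ' : Grid N} {Φ : ℝ → Grid N}

/-- The constant in the estimate of `ξ - 1`. -/
def xiConst (L T ε M b k K₁ : ℝ) : ℝ :=
  (1 + b ^ 2 / M + b * T + b * L ^ 2 + ε ^ 2 / 2 * (2 * √b + 1) + k * L) / K₁

/-- Since `(ξ - 1) * E = R' - E`, the deviation splits into the new scalar error, the energy
increment of the exact solution over one step, and the energy difference between `φ` and `Φ t`. The
common bound `σ` lets all of them be collected in one constant. -/
lemma abs_xi_sub_one_le (hst : Step h dt ε M s ξ (energyH h ε F φ + C₀) R R' F φ φ')
    (hΦ : Consistent L T ε M s C₀ h b F Φ Re) (hk : LocalBound F (b + 1) k) (hL : 0 < L)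
    (hM : 0 < M) (hK₁ : 0 < K₁) (hb : 0 ≤ b) (ht : 0 ≤ t) (hdt : 0 < dt) (htT : t + dt ≤ T)
    (hE : K₁ ≤ energyH h ε F φ + C₀) (he : ∀ i j, |(φ - Φ t) i j| ≤ 1)
    (hG : gradSqTM h (φ - Φ t) ≤ 1) {σ : ℝ}
    (hr : |R' - (energyH h ε F (Φ (t + dt)) + C₀)| ≤ σ) (hGσ : √(gradSqTM h (φ - Φ t)) ≤ σ)
    (hYσ : normM h (φ - Φ t) ≤ σ) (hδ : h ^ 2 + dt ≤ σ) :
    |ξ - 1| ≤ xiConst L T ε M b k K₁ * σ := by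
  have htm : t ∈ Icc 0 T := ⟨ht, by linarith⟩
  set E := energyH h ε F φ + C₀ with hEdef
  have hE0 : 0 < E := hK₁.trans_le hE
  have hh : h ^ 2 ≤ L ^ 2 := by
    have hNpos : (1 : ℝ) ≤ N := Nat.one_le_cast.mpr (NeZero.pos N)
    have h0 : 0 ≤ h := by rw [hΦ.mesh]; positivity
    have h1 : h ≤ L := by rw [hΦ.mesh]; exact div_le_self hL.le hNpos
    gcongr
  have h1 : |energyH h ε F (Φ (t + dt)) - energyH h ε F (Φ t)| ≤
      dt / M * b ^ 2 + b * (dt * (h ^ 2 + dt)) := by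
    have a1 := abs_le.1 (hΦ.balance t dt ht hdt htT)
    have a2 : normSqM h (quot Φ t dt) ≤ b ^ 2 := by
      rw [← normM_sq]; exact pow_le_pow_left₀ (normM_nonneg _) (hΦ.quot t dt ht hdt htT) 2
    have a3 := normSqM_nonneg (h := h) (quot Φ t dt)
    have a4 := mul_le_mul_of_nonneg_left a2 (by positivity : 0 ≤ dt / M)
    have a5 : 0 ≤ dt / M * normSqM h (quot Φ t dt) := by positivity
    rw [abs_le]
    constructor <;> linarith [a1.1, a1.2]
  have h2 : |energyH h ε F φ - energyH h ε F (Φ t)| ≤ _ := abs_energyH_sub_le (ε := ε) hL hΦ.mesh hk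
    (u := φ) (v := Φ t) (fun i j => by
      have a1 := abs_add_le ((φ - Φ t) i j) (Φ t i j)
      have a2 : (φ - Φ t) i j + Φ t i j = φ i j := by simp
      rw [a2] at a1
      linarith [he i j, hΦ.bound t htm i j])
    (fun i j => (hΦ.bound t htm i j).trans (by linarith))
  have hσ : 0 ≤ σ := (abs_nonneg _).trans hr
  set g := gradSqTM h (φ - Φ t) with hg
  have hg0 : 0 ≤ g := gradSqTM_nonneg _
  have h3 : g ≤ σ := by
    have : g ≤ √g := by
      have a1 := Real.sq_sqrt hg0
      have a2 : √g ≤ 1 := Real.sqrt_le_one.2 hG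
      have a3 := mul_le_mul_of_nonneg_left a2 (Real.sqrt_nonneg g)
      linarith [sq (√g)]
    exact this.trans hGσ
  have h4 : √(gradSqTM h (Φ t)) * √g ≤ √b * σ :=
    mul_le_mul (Real.sqrt_le_sqrt (hΦ.grad t htm)) hGσ (Real.sqrt_nonneg _) (Real.sqrt_nonneg _)
  have hk0 := hk.nonneg
  have h5 : |energyH h ε F φ - energyH h ε F (Φ t)| ≤
      ε ^ 2 / 2 * (2 * (√b * σ) + σ) + k * (L * σ) := by
    refine h2.trans ?_
    gcongr
  have h6 : dt / M * b ^ 2 + b * (dt * (h ^ 2 + dt)) ≤ b ^ 2 / M * σ + (b * T + b * L ^ 2) * σ := by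
    have a1 : dt ≤ σ := by linarith [sq_nonneg h]
    have a2 : dt / M * b ^ 2 ≤ b ^ 2 / M * σ := by
      rw [div_mul_eq_mul_div, div_mul_eq_mul_div, mul_comm dt]; gcongr
    have a3 : dt * (h ^ 2 + dt) ≤ σ * (L ^ 2 + T) := by
      gcongr
      linarith
    have a4 := mul_le_mul_of_nonneg_left a3 hb
    linarith
  have h7 : |R' - E| ≤ K₁ * (xiConst L T ε M b k K₁ * σ) := by
    have e : R' - E = (R' - (energyH h ε F (Φ (t + dt)) + C₀)) +
        (energyH h ε F (Φ (t + dt)) - energyH h ε F (Φ t)) -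
        (energyH h ε F φ - energyH h ε F (Φ t)) := by simp only [hEdef]; ring
    have e2 : K₁ * (xiConst L T ε M b k K₁ * σ) =
        (1 + b ^ 2 / M + b * T + b * L ^ 2 + ε ^ 2 / 2 * (2 * √b + 1) + k * L) * σ := by
      rw [xiConst]; field_simp
    have a1 := abs_sub ((R' - (energyH h ε F (Φ (t + dt)) + C₀)) +
        (energyH h ε F (Φ (t + dt)) - energyH h ε F (Φ t)))
        (energyH h ε F φ - energyH h ε F (Φ t))
    have a2 := abs_add_le (R' - (energyH h ε F (Φ (t + dt)) + C₀))
        (energyH h ε F (Φ (t + dt)) - energyH h ε F (Φ t))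
    rw [e2, e]
    linarith
  have h8 : R' - E = (ξ - 1) * E := by rw [hst.xi]; ring
  rw [h8, abs_mul, abs_of_pos hE0] at h7
  have h9 : K₁ * |ξ - 1| ≤ |ξ - 1| * E := by
    rw [mul_comm]; exact mul_le_mul_of_nonneg_left hE (abs_nonneg _)
  exact le_of_mul_le_mul_left (h9.trans h7) hK₁

/-- The constant in the estimate of the residual. -/
def resConst (L ε b k Ξ c : ℝ) : ℝ := c * (ε ^ 2 * b + L * k) + Ξ * k + b

/-- The three parts of the residual are of size `|ξ - 1|`, the nonlinear error, and the truncation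
error. The radius `b + 1` in `LocalBound` contains both solutions because the error is at most `1`.
-/
lemma normM_residual_le (hΦ : Consistent L T ε M s C₀ h b F Φ Re) (hk : LocalBound F (b + 1) k)
    (hL : 0 < L) (hb : 0 ≤ b) (ht : 0 ≤ t) (hdt : 0 < dt) (htT : t + dt ≤ T)
    (hξ : 0 ≤ ξ) (hξΞ : ξ ≤ Ξ) (he : ∀ i j, |(φ - Φ t) i j| ≤ 1) {σ c : ℝ}
    (hξ1 : |ξ - 1| ≤ c * σ) (hYσ : normM h (φ - Φ t) ≤ σ) (hδ : h ^ 2 + dt ≤ σ) :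
    normM h (residual h M ε s ξ dt t F φ Φ) ≤ resConst L ε b k Ξ c * σ := by
  have htm : t ∈ Icc 0 T := ⟨ht, by linarith⟩
  have hk0 := hk.nonneg
  have hbd : ∀ i j, |Φ t i j| ≤ b + 1 := fun i j => (hΦ.bound t htm i j).trans (by linarith)
  have hφ : ∀ i j, |φ i j| ≤ b + 1 := fun i j => by
    have a1 := abs_add_le ((φ - Φ t) i j) (Φ t i j)
    have a2 : (φ - Φ t) i j + Φ t i j = φ i j := by simp
    rw [a2] at a1
    linarith [he i j, hΦ.bound t htm i j]
  have h1 : normM h (ε ^ 2 • lapH h (Φ t) - fun i j => deriv F (Φ t i j)) ≤ ε ^ 2 * b + L * k := by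
    refine (normM_sub_le _ _).trans (add_le_add ?_ ?_)
    · rw [normM_smul, abs_of_nonneg (sq_nonneg ε)]
      exact mul_le_mul_of_nonneg_left (hΦ.lap t htm) (sq_nonneg ε)
    · exact normM_le_of_abs_le hL.le hΦ.mesh hk0 fun i j =>
        hk.abs_deriv_le _ (abs_le.1 (hbd i j))
  have h2 : normM h (fun i j => deriv F (φ i j) - deriv F (Φ t i j)) ≤ k * normM h (φ - Φ t) :=
    normM_le_mul hk0 fun i j => hk.deriv_lip _ (abs_le.1 (hbd i j)) _ (abs_le.1 (hφ i j))
  have h3 := hΦ.trunc t dt ht hdt htT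
  have h4 := normM_sub_le (h := h) ((ξ - 1) • (ε ^ 2 • lapH h (Φ t) - fun i j => deriv F (Φ t i j)))
    (ξ • (fun i j => deriv F (φ i j) - deriv F (Φ t i j)))
  rw [normM_smul, normM_smul, abs_of_nonneg hξ] at h4
  refine (normM_sub_le _ _).trans ?_
  have h5 : |ξ - 1| * normM h (ε ^ 2 • lapH h (Φ t) - fun i j => deriv F (Φ t i j)) ≤
      c * σ * (ε ^ 2 * b + L * k) :=
    mul_le_mul hξ1 h1 (normM_nonneg _) ((abs_nonneg _).trans hξ1)
  have h6 : ξ * normM h (fun i j => deriv F (φ i j) - deriv F (Φ t i j)) ≤ Ξ * (k * σ) :=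
    mul_le_mul hξΞ (h2.trans (by gcongr)) (normM_nonneg _) (hξ.trans hξΞ)
  have h7 := mul_le_mul_of_nonneg_left hδ hb
  have e : resConst L ε b k Ξ c * σ =
      c * σ * (ε ^ 2 * b + L * k) + Ξ * (k * σ) + b * σ := by rw [resConst]; ring
  rw [e]
  linarith

lemma normSqM_step (hdt : 0 < dt) (hdT : dt ≤ T) (e e' : Grid N) :
    normSqM h e' - normSqM h e ≤ dt * ((1 + T) * normSqM h ((1 / dt) • (e' - e)) + normSqM h e) := by
  set a := (1 / dt) • (e' - e) with ha
  have hea : e' = e + dt • a := by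
    rw [ha, smul_smul, mul_one_div_cancel hdt.ne', one_smul, add_sub_cancel]
  clear_value a
  have h1 := innerM_young (h := h) one_pos a e
  have h2 := normSqM_nonneg (h := h) a
  rw [hea, normSqM_add, innerM_smul_right, normSqM_smul, innerM_comm]
  have h3 := mul_le_mul_of_nonneg_left h1 (by positivity : 0 ≤ 2 * dt)
  have h4 := mul_le_mul_of_nonneg_left hdT (by positivity : 0 ≤ dt * normSqM h a)
  linarith

end Step

end

/-! ### One-step stability in the weighted error energy -/

section

/-- The quantity controlled by the stability estimate. -/
def errEnergy {N : ℕ} [NeZero N] (ε η h r : ℝ) (e : Grid N) : ℝ :=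
  ε ^ 2 / 2 * gradSqTM h e + η * (r ^ 2 + normSqM h e)

section ErrEnergy

variable {N : ℕ} [NeZero N] {ε η h r : ℝ} {e : Grid N}

lemma errEnergy_nonneg (hη : 0 ≤ η) : 0 ≤ errEnergy ε η h r e :=
  add_nonneg (mul_nonneg (by positivity) (gradSqTM_nonneg e))
    (mul_nonneg hη (add_nonneg (sq_nonneg r) (normSqM_nonneg e)))

lemma gradSqTM_le_errEnergy (hε : 0 < ε) (hη : 0 ≤ η) :
    gradSqTM h e ≤ 2 / ε ^ 2 * errEnergy ε η h r e := by
  have h1 : 0 ≤ 2 / ε ^ 2 * (η * (r ^ 2 + normSqM h e)) :=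
    mul_nonneg (by positivity) (mul_nonneg hη (add_nonneg (sq_nonneg r) (normSqM_nonneg e)))
  have e1 : 2 / ε ^ 2 * errEnergy ε η h r e =
      gradSqTM h e + 2 / ε ^ 2 * (η * (r ^ 2 + normSqM h e)) := by
    rw [errEnergy]; field_simp
  linarith

lemma add_le_errEnergy (hη : 0 < η) : r ^ 2 + normSqM h e ≤ 1 / η * errEnergy ε η h r e := by
  have h1 : 0 ≤ 1 / η * (ε ^ 2 / 2 * gradSqTM h e) :=
    mul_nonneg (by positivity) (mul_nonneg (by positivity) (gradSqTM_nonneg e))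
  have e1 : 1 / η * errEnergy ε η h r e =
      1 / η * (ε ^ 2 / 2 * gradSqTM h e) + (r ^ 2 + normSqM h e) := by
    rw [errEnergy]; field_simp
  linarith

lemma sq_le_errEnergy (hη : 0 < η) : r ^ 2 ≤ 1 / η * errEnergy ε η h r e := by
  have := add_le_errEnergy (ε := ε) (h := h) (r := r) (e := e) hη
  linarith [normSqM_nonneg (h := h) e]

lemma normSqM_le_errEnergy (hη : 0 < η) : normSqM h e ≤ 1 / η * errEnergy ε η h r e := by
  have := add_le_errEnergy (ε := ε) (h := h) (r := r) (e := e) hη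
  linarith [sq_nonneg r]

end ErrEnergy

/-- Stability of one step of the scheme near the exact solution. -/
lemma Step.exists_estimate {L T ε M s C₀ K₁ b k Ξ ρ Rm : ℝ} {F : ℝ → ℝ} (hL : 0 < L) (hT : 0 < T)
    (hε : 0 < ε) (hM : 0 < M) (hs : 0 < s) (hK₁ : 0 < K₁) (hb : 0 ≤ b) (hΞ : 0 < Ξ) (hρ : 0 < ρ)
    (hRm0 : 0 ≤ Rm) (hΞs : Ξ ≤ 2 * s) (hk : LocalBound F (b + 1) k) :
    ∃ c₁ η κ ζ : ℝ, 0 < c₁ ∧ 0 < η ∧ 0 ≤ κ ∧ 0 ≤ ζ ∧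
      ∀ (N : ℕ) [NeZero N] (h dt t ξ R R' : ℝ) (φ φ' : Grid N) (Φ : ℝ → Grid N) (Re : ℝ → ℝ),
        Step h dt ε M s ξ (energyH h ε F φ + C₀) R R' F φ φ' →
        Consistent L T ε M s C₀ h b F Φ Re → 0 ≤ t → 0 < dt → t + dt ≤ T →
        K₁ ≤ energyH h ε F φ + C₀ → 0 ≤ ξ → ξ ≤ Ξ → ρ ≤ R →
        |R' - (energyH h ε F (Φ (t + dt)) + C₀)| ≤ Rm → (∀ i j, |(φ - Φ t) i j| ≤ 1) →
        gradSqTM h (φ - Φ t) ≤ 1 →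
        ∀ X X' A δ : ℝ,
          X = errEnergy ε η h (R - (energyH h ε F (Φ t) + C₀)) (φ - Φ t) →
          X' = errEnergy ε η h (R' - (energyH h ε F (Φ (t + dt)) + C₀)) (φ' - Φ (t + dt)) →
          A = normSqM h ((1 / dt) • ((φ' - Φ (t + dt)) - (φ - Φ t))) → δ = h ^ 2 + dt →
          X' + c₁ * (dt * A) ≤ X + κ * dt * (X' + X + δ ^ 2) ∧
          normM h (lapH h (φ' - Φ (t + dt))) ≤ normM h (lapH h (φ - Φ t)) +
            ζ * (√A + √(X' + X + δ ^ 2)) := by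
  have hk0 := hk.nonneg
  -- `D` bounds the factor of `ξ` in `Step.le_xi_mul`, so that `c = ρ / D` is a lower bound for `ξ`;
  -- the summand `K₁` makes it positive.
  set D := ε ^ 2 / 2 * (2 * (b + 1)) + L ^ 2 * k + |C₀| + K₁ +
    Ξ * (ε ^ 2 * (2 * (b + 1)) / (2 * s) + M * T * (L ^ 2 * k ^ 2)) with hD
  have hD0 : 0 < D := by positivity
  set c := ρ / D
  have hc0 : 0 < c := by positivity
  set Cξ := xiConst L T ε M b k K₁
  have hCξ : 0 ≤ Cξ := by simp only [Cξ, xiConst]; positivity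
  set Cq := resConst L ε b k Ξ Cξ
  have hCq : 0 ≤ Cq := by simp only [Cq, resConst]; positivity
  -- `θ` is the total coefficient of `dt * A` in the estimates for `r²` and `‖e‖²`. The choice of
  -- `η` makes their share half of the dissipation `dt / (2 * M * Ξ) * A`, and the other half is
  -- `c₁`.
  set θ := 2 * Rm / M + 2 + T with hθ
  have hθ0 : 0 < θ := by positivity
  set η := 1 / (4 * M * Ξ * θ) with hη
  have hη0 : 0 < η := by positivity
  set κ₀ := M / (2 * c) * Cq ^ 2 + η * (1 + 4 * b ^ 2 / M ^ 2 + b) with hκ₀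
  have hκ₀0 : 0 ≤ κ₀ := by positivity
  set w := 1 + 2 / ε ^ 2 + 1 / η with hw
  have hw0 : 0 ≤ w := by positivity
  refine ⟨1 / (4 * M * Ξ), η, κ₀ * w, 1 / (s * ε ^ 2) * (1 / M + Cq * √w), by positivity, hη0,
    by positivity, by positivity, ?_⟩
  intro N _ h dt t ξ R R' φ φ' Φ Re hst hΦ ht hdt htT hE hξ hξΞ hρR hRm he hG X X' A δ hX hX' hA hδ
  have htm : t ∈ Icc 0 T := ⟨ht, by linarith⟩
  have hNpos : (0 : ℝ) < N := Nat.cast_pos.mpr (NeZero.pos N)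
  have hh : h ≠ 0 := by rw [hΦ.mesh]; positivity
  have hdT : dt ≤ T := by linarith
  have hφ : ∀ i j, |φ i j| ≤ b + 1 := fun i j => by
    have a1 := abs_add_le ((φ - Φ t) i j) (Φ t i j)
    have a2 : (φ - Φ t) i j + Φ t i j = φ i j := by simp
    rw [a2] at a1
    linarith [he i j, hΦ.bound t htm i j]
  have hgφ : gradSqTM h φ ≤ 2 * (b + 1) := by
    have a1 := gradSqTM_add_le (h := h) (Φ t) (φ - Φ t)
    rw [add_sub_cancel] at a1
    linarith [hΦ.grad t htm]
  -- lower bound for `ξ`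
  have hcξ : c ≤ ξ := by
    have a1 : energyH h ε F φ + C₀ ≤ ε ^ 2 / 2 * (2 * (b + 1)) + L ^ 2 * k + |C₀| + K₁ := by
      have b1 := abs_energyH_le (h := h) (ε := ε) (F := F) hΦ.mesh fun i j =>
        hk.abs_le _ (abs_le.1 (hφ i j))
      have b2 : ε ^ 2 / 2 * gradSqTM h φ ≤ ε ^ 2 / 2 * (2 * (b + 1)) := by gcongr
      linarith [le_abs_self (energyH h ε F φ), le_abs_self C₀]
    have a2 := hst.le_xi_mul hL hΦ.mesh hdt hM hs hξ hdT hξΞ a1 hgφ fun i j =>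
      hk.abs_deriv_le _ (abs_le.1 (hφ i j))
    rw [div_le_iff₀ hD0]
    exact hρR.trans a2
  set e := φ - Φ t with hedef
  set e' := φ' - Φ (t + dt) with hedef'
  set r := R - (energyH h ε F (Φ t) + C₀) with hr
  set r' := R' - (energyH h ε F (Φ (t + dt)) + C₀) with hr'
  -- The scalar error enters at the new time, because `ξ` contains `R'`. Hence the final estimate
  -- has `X'` on the right and Gronwall's inequality must be used in implicit form.
  set S := r' ^ 2 + gradSqTM h e + normSqM h e + δ ^ 2 with hS
  have hg0 := gradSqTM_nonneg (h := h) e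
  have hY0 := normSqM_nonneg (h := h) e
  have hA0 : 0 ≤ A := by rw [hA]; exact normSqM_nonneg _
  have hδ0 : 0 ≤ δ := by rw [hδ]; positivity
  have hS0 : 0 ≤ S := by positivity
  have hq : normM h (residual h M ε s ξ dt t F φ Φ) ≤ Cq * √S := by
    have b1 : |r'| ≤ √S := Real.abs_le_sqrt (by linarith [sq_nonneg δ])
    have b2 : √(gradSqTM h e) ≤ √S :=
      Real.sqrt_le_sqrt (by linarith [sq_nonneg δ, sq_nonneg r'])
    have b3 : normM h e ≤ √S := Real.sqrt_le_sqrt (by linarith [sq_nonneg δ, sq_nonneg r'])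
    have b4 : h ^ 2 + dt ≤ √S := by
      rw [← hδ]; exact Real.le_sqrt_of_sq_le (by linarith [sq_nonneg r'])
    exact normM_residual_le hΦ hk hL hb ht hdt htT hξ hξΞ he
      (hst.abs_xi_sub_one_le hΦ hk hL hM hK₁ hb ht hdt htT hE he hG b1 b2 b3 b4) b3 b4
  have hq2 : normSqM h (residual h M ε s ξ dt t F φ Φ) ≤ Cq ^ 2 * S := by
    rw [← normM_sq, ← Real.sq_sqrt hS0, ← mul_pow]
    exact pow_le_pow_left₀ (normM_nonneg _) hq 2
  have hX0 : 0 ≤ X := by rw [hX]; exact errEnergy_nonneg hη0.le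
  have hX'0 : 0 ≤ X' := by rw [hX']; exact errEnergy_nonneg hη0.le
  have hSw : S ≤ w * (X' + X + δ ^ 2) := by
    have b1 : r' ^ 2 ≤ 1 / η * X' := by rw [hX']; exact sq_le_errEnergy hη0
    have b2 : gradSqTM h e ≤ 2 / ε ^ 2 * X := by rw [hX]; exact gradSqTM_le_errEnergy hε hη0.le
    have b3 : normSqM h e ≤ 1 / η * X := by rw [hX]; exact normSqM_le_errEnergy hη0
    have b4 : 0 ≤ 1 / η := by positivity
    have b5 : 0 ≤ 2 / ε ^ 2 := by positivity
    have c1 := mul_nonneg b4 (sq_nonneg δ)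
    have c2 := mul_nonneg b5 (sq_nonneg δ)
    have c3 := mul_nonneg b5 hX'0
    have e1 : w * (X' + X + δ ^ 2) = X' + X + δ ^ 2 + (2 / ε ^ 2 * X' + 2 / ε ^ 2 * X +
      2 / ε ^ 2 * δ ^ 2) + (1 / η * X' + 1 / η * X + 1 / η * δ ^ 2) := by rw [hw]; ring
    linarith
  refine ⟨?_, ?_⟩
  · have s1 := hst.energy_step hh hdt hM hc0 hcξ hξΞ (hξΞ.trans hΞs) Φ t
    have s2 := normSqM_step (h := h) hdt hdT e e'
    have s3 := hst.scalar_step hM hΦ ht hdt htT hb hRm (S := S) (by rw [← hδ]; linarith)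
    rw [← hA] at s1 s2 s3
    have s4 := mul_le_mul_of_nonneg_left s2 hη0.le
    have s5 := mul_le_mul_of_nonneg_left s3 hη0.le
    have s6 : dt * (M / (2 * c)) * normSqM h (residual h M ε s ξ dt t F φ Φ) ≤
        dt * (M / (2 * c)) * (Cq ^ 2 * S) := mul_le_mul_of_nonneg_left hq2 (by positivity)
    have s7 : η * (dt * normSqM h e) ≤ η * (dt * S) := by
      have : normSqM h e ≤ S := by linarith [sq_nonneg δ, sq_nonneg r']
      gcongr
    have s8 : κ₀ * dt * S ≤ κ₀ * dt * (w * (X' + X + δ ^ 2)) :=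
      mul_le_mul_of_nonneg_left hSw (by positivity)
    have e1 : η * θ = 1 / (4 * M * Ξ) := by rw [hη]; field_simp
    have e2 : dt / (2 * M * Ξ) * A = 2 * (1 / (4 * M * Ξ) * (dt * A)) := by field_simp; ring
    have e3 : X' - X = ε ^ 2 / 2 * (gradSqTM h e' - gradSqTM h e) + η * (r' ^ 2 - r ^ 2) +
        η * (normSqM h e' - normSqM h e) := by
      rw [hX, hX', errEnergy, errEnergy]; ring
    have e4 : η * (dt * ((1 + T) * A + normSqM h e)) + η * (dt * ((2 * Rm / M + 1) * A +
        (4 * b ^ 2 / M ^ 2 + b) * S)) = 1 / (4 * M * Ξ) * (dt * A) + η * (dt * normSqM h e) +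
        η * (4 * b ^ 2 / M ^ 2 + b) * dt * S := by rw [← e1, hθ]; ring
    have e5 : κ₀ * dt * S = dt * (M / (2 * c)) * (Cq ^ 2 * S) + η * (dt * S) +
        η * (4 * b ^ 2 / M ^ 2 + b) * dt * S := by rw [hκ₀]; ring
    have e6 : κ₀ * dt * (w * (X' + X + δ ^ 2)) = κ₀ * w * dt * (X' + X + δ ^ 2) := by ring
    linarith
  · have s1 := hst.lap_step hM hε hs hξ (hξΞ.trans hΞs) Φ t
    have s2 : √S ≤ √w * √(X' + X + δ ^ 2) := by
      rw [← Real.sqrt_mul hw0]; exact Real.sqrt_le_sqrt hSw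
    have s3 : normM h ((1 / dt) • (e' - e)) = √A := by rw [hA]; rfl
    rw [s3] at s1
    refine s1.trans ?_
    have s4 : 1 / M * √A + normM h (residual h M ε s ξ dt t F φ Φ) ≤
        (1 / M + Cq * √w) * (√A + √(X' + X + δ ^ 2)) := by
      have b1 := mul_le_mul_of_nonneg_left s2 hCq
      have b2 : 0 ≤ Cq * √w * √A := by positivity
      have b3 : 0 ≤ 1 / M * √(X' + X + δ ^ 2) := by positivity
      linarith
    have s5 := mul_le_mul_of_nonneg_left s4 (by positivity : 0 ≤ 1 / (s * ε ^ 2))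
    linarith

end

section

/-! ### Discrete Gronwall inequality and the bootstrap -/

/-- The implicit term is absorbed through `(1 + x) / (1 - x) ≤ 1 + 4 * x` for `0 ≤ x ≤ 1/2`. The
accumulated dissipation is part of the quantity that is propagated. -/
lemma discrete_gronwall {X A : ℕ → ℝ} {c κ dt T D : ℝ} {m : ℕ} (hc : 0 ≤ c) (hdt : 0 < dt)
    (hκ : 0 ≤ κ) (hκdt : κ * dt ≤ 1 / 2) (hmT : m * dt ≤ T) (hX : ∀ n, 0 ≤ X n)
    (hA : ∀ n, 0 ≤ A n) (hD : 0 ≤ D)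
    (hstep : ∀ n < m, X (n + 1) + c * (dt * A n) ≤ X n + κ * dt * (X (n + 1) + X n + D)) :
    X m + c * ∑ l ∈ Finset.range m, dt * A l ≤ Real.exp (4 * κ * T) * (X 0 + D) := by
  have hsum : ∀ n, 0 ≤ ∑ l ∈ Finset.range n, dt * A l := fun n =>
    Finset.sum_nonneg fun l _ => mul_nonneg hdt.le (hA l)
  have key : ∀ n ≤ m, X n + c * ∑ l ∈ Finset.range n, dt * A l + D ≤
      (1 + 4 * (κ * dt)) ^ n * (X 0 + D) := by
    intro n
    induction n with
    | zero => intro _; simp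
    | succ n ih =>
      intro hn
      have h1 := ih (by omega)
      have h2 := hstep n (by omega)
      rw [Finset.sum_range_succ, mul_add]
      set σ := ∑ l ∈ Finset.range n, dt * A l
      have hσ : 0 ≤ c * σ := mul_nonneg hc (hsum n)
      set x := κ * dt with hx
      have hx0 : 0 ≤ x := by positivity
      have hcA : 0 ≤ c * (dt * A n) := mul_nonneg hc (mul_nonneg hdt.le (hA n))
      set W := X n + c * σ + D with hW
      set W' := X (n + 1) + (c * σ + c * (dt * A n)) + D with hW'
      have hW0 : 0 ≤ W := add_nonneg (add_nonneg (hX n) hσ) hD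
      have h3 : W' ≤ W + x * (W' + W) := by
        have : x * (X (n + 1) + X n + D) ≤ x * (W' + W) :=
          mul_le_mul_of_nonneg_left (by linarith) hx0
        linarith
      have h4 : W' ≤ (1 + 4 * x) * W := by
        have h5 : (1 - x) * W' ≤ (1 - x) * ((1 + 4 * x) * W) := by
          have : 0 ≤ (2 * x) * (1 - 2 * x) * W :=
            mul_nonneg (mul_nonneg (by linarith) (by linarith)) hW0
          linarith
        exact le_of_mul_le_mul_left h5 (by linarith)
      calc W' ≤ (1 + 4 * x) * W := h4
        _ ≤ (1 + 4 * x) * ((1 + 4 * x) ^ n * (X 0 + D)) := by gcongr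
        _ = _ := by ring
  have h1 := key m le_rfl
  have h2 : (1 + 4 * (κ * dt)) ^ m ≤ Real.exp (4 * κ * T) := by
    have h3 : 1 + 4 * (κ * dt) ≤ Real.exp (4 * (κ * dt)) := by
      linarith [Real.add_one_le_exp (4 * (κ * dt))]
    refine (pow_le_pow_left₀ (by positivity) h3 m).trans ?_
    rw [← Real.exp_nat_mul]
    refine Real.exp_le_exp.2 ?_
    have := mul_le_mul_of_nonneg_left hmT hκ
    linarith
  have h3 := mul_le_mul_of_nonneg_right h2 (add_nonneg (hX 0) hD)
  linarith

/-- The `H²` seminorm stays bounded: for `h² ≤ dt` by summation, otherwise by an inverse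
inequality. -/
lemma lap_bound_of_sum {X A Z : ℕ → ℝ} {c ζ dt T C₃ C₄ h : ℝ} {m : ℕ} (hc : 0 < c) (hζ : 0 ≤ ζ)
    (hdt : 0 < dt) (hT : 0 ≤ T) (hmT : m * dt ≤ T) (hX0 : ∀ n, 0 ≤ X n) (hA : ∀ n, 0 ≤ A n)
    (hC₃ : 0 ≤ C₃) (hC₄ : 0 ≤ C₄) (hh : 0 < h)
    (hX : ∀ n ≤ m, X n ≤ C₃ * (h ^ 2 + dt) ^ 2)
    (hsum : c * ∑ l ∈ Finset.range m, dt * A l ≤ C₃ * (h ^ 2 + dt) ^ 2) (hZ0 : Z 0 = 0)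
    (hstep : ∀ n < m, Z (n + 1) ≤ Z n + ζ * (√(A n) + √(X (n + 1) + X n + (h ^ 2 + dt) ^ 2)))
    (hinv : h ^ 2 * Z m ≤ C₄ * (h ^ 2 + dt)) :
    Z m ≤ 2 * (ζ * (C₃ / c + (2 * C₃ + 3) * T)) + 2 * C₄ := by
  set δ := h ^ 2 + dt with hδ
  have hδ0 : 0 < δ := by positivity
  rcases le_total (h ^ 2) dt with hle | hle
  -- Scaling by `δ * dt` allows `δ * √A ≤ A + δ²` in each step. The resulting sum is `O(δ²)`, and `δ
  -- ≤ 2 * dt` permits division by `δ * dt`.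
  · have key : ∀ n ≤ m, δ * (dt * Z n) ≤
        ζ * ∑ l ∈ Finset.range n, (dt * A l + dt * ((2 * C₃ + 3) * δ ^ 2)) := by
      intro n
      induction n with
      | zero => intro _; simp [hZ0]
      | succ n ih =>
        intro hn
        have h1 := ih (by omega)
        have h2 := hstep n (by omega)
        rw [Finset.sum_range_succ, mul_add]
        have h3 : δ * √(A n) ≤ A n + δ ^ 2 := by
          have a1 := Real.sq_sqrt (hA n)
          have a2 := sq_nonneg (√(A n) - δ)
          have a3 := sq_nonneg (√(A n))
          linarith [sq_nonneg δ]
        have h4 : δ * √(X (n + 1) + X n + δ ^ 2) ≤ (2 * C₃ + 2) * δ ^ 2 := by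
          have a0 : 0 ≤ X (n + 1) + X n + δ ^ 2 :=
            add_nonneg (add_nonneg (hX0 _) (hX0 _)) (sq_nonneg _)
          have a1 := Real.sq_sqrt a0
          have a2 := sq_nonneg (√(X (n + 1) + X n + δ ^ 2) - δ)
          have a3 := hX (n + 1) hn
          have a4 := hX n (by omega)
          have a5 : 0 ≤ C₃ * δ ^ 2 := by positivity
          linarith [sq_nonneg δ]
        have h5 := mul_le_mul_of_nonneg_left h2 (by positivity : 0 ≤ δ * dt)
        have h6 := mul_le_mul_of_nonneg_left (add_le_add h3 h4) (by positivity : 0 ≤ ζ * dt)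
        linarith
    have h1 := key m le_rfl
    rw [Finset.sum_add_distrib, Finset.sum_const, Finset.card_range, nsmul_eq_mul] at h1
    have h2 : ∑ l ∈ Finset.range m, dt * A l ≤ C₃ / c * δ ^ 2 := by
      rw [div_mul_eq_mul_div, le_div_iff₀ hc]; linarith
    have h3 : m * (dt * ((2 * C₃ + 3) * δ ^ 2)) ≤ T * ((2 * C₃ + 3) * δ ^ 2) := by
      rw [← mul_assoc]; gcongr
    have h4 : δ * (dt * Z m) ≤ δ * (dt * (2 * (ζ * (C₃ / c + (2 * C₃ + 3) * T)))) := by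
      have a1 := mul_le_mul_of_nonneg_left (add_le_add h2 h3) hζ
      have a2 : δ ≤ 2 * dt := by linarith
      have a3 : 0 ≤ ζ * (C₃ / c + (2 * C₃ + 3) * T) := by positivity
      have a4 := mul_le_mul_of_nonneg_left a2 (mul_nonneg a3 hδ0.le)
      linarith
    have h5 := le_of_mul_le_mul_left (le_of_mul_le_mul_left h4 hδ0) hdt
    linarith
  · have h1 : h ^ 2 * Z m ≤ h ^ 2 * (2 * C₄) := by
      have : δ ≤ 2 * h ^ 2 := by linarith
      have := mul_le_mul_of_nonneg_left this hC₄
      linarith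
    have h2 := le_of_mul_le_mul_left h1 (by positivity)
    have h3 : 0 ≤ 2 * (ζ * (C₃ / c + (2 * C₃ + 3) * T)) := by positivity
    linarith

/-- The parameter of `sq_le_of_lapH` is taken to be `δ`: it balances the `L²` and `H¹` parts, of
size `δ² / δ`, against `δ` times the merely bounded `H²` part. -/
lemma abs_le_one_of_lapH {N : ℕ} [NeZero N] {L h δ W Z : ℝ} {e : Grid N} (hL : 0 < L)
    (hN : h = L / N) (hδ0 : 0 < δ) (hδ1 : δ ≤ 1) (hW : 0 ≤ W)
    (hY : (1 / L + 1) * normSqM h e + gradSqTM h e ≤ W * δ ^ 2)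
    (hG : (1 / L + 1) * gradSqTM h e ≤ W * δ ^ 2) (hZ : normM h (lapH h e) ≤ Z)
    (hδ : δ * ((1 / L + 2) * W + Z ^ 2) ≤ 1) (i j : ZMod N) : |e i j| ≤ 1 := by
  have h1 := sq_le_of_lapH hL hδ0 hN e i j
  have h2 : normSqM h (lapH h e) ≤ Z ^ 2 := by
    rw [← normM_sq]; exact pow_le_pow_left₀ (normM_nonneg _) hZ 2
  have h3 := mul_le_mul_of_nonneg_left hY (by positivity : 0 ≤ 1 / L + 1 / δ)
  have h4 := mul_le_mul_of_nonneg_left (add_le_add hG h2) hδ0.le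
  have e1 : (1 / L + 1 / δ) * (W * δ ^ 2) = 1 / L * W * δ ^ 2 + W * δ := by field_simp
  have h5 : δ ^ 2 ≤ δ := by rw [sq]; exact mul_le_of_le_one_left hδ0.le hδ1
  have h6 := mul_le_mul_of_nonneg_left h5 (by positivity : 0 ≤ 1 / L * W)
  have h7 : W * δ ^ 2 * δ ≤ W * δ := by
    have : W * δ ^ 2 ≤ W * 1 := by
      refine mul_le_mul_of_nonneg_left (h5.trans hδ1) hW
    have := mul_le_mul_of_nonneg_right this hδ0.le
    linarith
  exact (sq_le_one_iff_abs_le_one _).1 (by linarith)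

/-! ### Solutions of the scheme -/

namespace IsPSSAVSolution

variable {N Nt : ℕ} [NeZero N] {h dt ε M s C₀ R0 K₁ : ℝ} {F : ℝ → ℝ} {φ0 : Grid N}
  {φh μh : ℕ → Grid N} {Rh : ℕ → ℝ}

lemma step (hsch : IsPSSAVSolution h dt Nt ε M s C₀ F φ0 R0 φh μh Rh) (hM : 0 < M)
    (hdt : 0 < dt) (hK₁ : 0 < K₁) {n : ℕ} (hn : n < Nt) (hE : K₁ ≤ energyH h ε F (φh n) + C₀) :
    Step h dt ε M s (Rh (n + 1) / (energyH h ε F (φh n) + C₀)) (energyH h ε F (φh n) + C₀) (Rh n)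
      (Rh (n + 1)) F (φh n) (φh (n + 1)) where
  phi := by
    ext i j
    have h1 := hsch.phi_eq n hn i j
    have h2 := hsch.mu_eq n hn i j
    rw [h2] at h1
    simp only [Pi.sub_apply, Pi.smul_apply, Pi.add_apply, smul_eq_mul]
    have h3 : 1 / dt * (φh (n + 1) i j - φh n i j) = (φh (n + 1) i j - φh n i j) / dt := by ring
    rw [h3, h1]
    have h4 : ∀ x, 1 / M * (-M * x) = -x := fun x => by field_simp
    rw [h4]
    ring
  R_eq := by
    have h1 := hsch.R_eq n hn
    have e : (fun i j => (φh (n + 1) i j - φh n i j) / dt : Grid N) =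
        (1 / dt) • (φh (n + 1) - φh n) := by
      ext i j
      simp only [Pi.sub_apply, Pi.smul_apply, smul_eq_mul]; ring
    rw [e, div_eq_iff hdt.ne'] at h1
    rw [h1, normSqM]
    ring
  xi := by rw [div_mul_cancel₀ _ (hK₁.trans_le hE).ne']

lemma R_succ_le (hsch : IsPSSAVSolution h dt Nt ε M s C₀ F φ0 R0 φh μh Rh) (hM : 0 < M)
    (hdt : 0 < dt) {n : ℕ} (hn : n < Nt) : Rh (n + 1) ≤ Rh n := by
  have h1 := hsch.R_eq n hn
  rw [div_eq_iff hdt.ne'] at h1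
  have h2 := normSqM_nonneg (h := h) (fun i j => (φh (n + 1) i j - φh n i j) / dt : Grid N)
  have h3 : 0 ≤ 1 / M * normSqM h (fun i j => (φh (n + 1) i j - φh n i j) / dt : Grid N) * dt := by
    positivity
  rw [normSqM] at h3
  linarith

lemma R_le (hsch : IsPSSAVSolution h dt Nt ε M s C₀ F φ0 R0 φh μh Rh) (hM : 0 < M)
    (hdt : 0 < dt) {n : ℕ} (hn : n ≤ Nt) : Rh n ≤ R0 := by
  induction n with
  | zero => exact hsch.init_R.le
  | succ n ih => exact (hsch.R_succ_le hM hdt (by omega)).trans (ih (by omega))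

lemma R_pos (hsch : IsPSSAVSolution h dt Nt ε M s C₀ F φ0 R0 φh μh Rh) (hR0 : 0 < R0)
    {n : ℕ} (hn : n ≤ Nt) : 0 < Rh n := by
  cases n with
  | zero => rw [hsch.init_R]; exact hR0
  | succ n => exact hsch.pos n (by omega)

end IsPSSAVSolution

end

/-! ### Convergence for fine discretisations, and consistency of the exact solution -/

section

/-- Error estimate for fine discretisations. -/
lemma exists_error_bound {L T ε M s C₀ K₁ b k R0 ρ : ℝ} {F : ℝ → ℝ} (hL : 0 < L) (hT : 0 < T)
    (hε : 0 < ε) (hM : 0 < M) (hK₁ : 0 < K₁) (hb : 0 ≤ b) (hR0 : 0 < R0) (hρ : 0 < ρ)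
    (hs : R0 / (2 * K₁) ≤ s) (hk : LocalBound F (b + 1) k) :
    ∃ C δ₀ : ℝ, 0 ≤ C ∧ 0 < δ₀ ∧
      ∀ (N : ℕ) [NeZero N] (Nt : ℕ) (h dt : ℝ) (Φ : ℝ → Grid N) (Re : ℝ → ℝ)
        (φh μh : ℕ → Grid N) (Rh : ℕ → ℝ),
        Consistent L T ε M s C₀ h b F Φ Re → 0 < dt → Nt * dt ≤ T → (∀ t ∈ Icc 0 T, ρ ≤ Re t) →
        IsPSSAVSolution h dt Nt ε M s C₀ F (Φ 0) R0 φh μh Rh → R0 = Re 0 →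
        (∀ n < Nt, K₁ ≤ energyH h ε F (φh n) + C₀) → h ^ 2 + dt ≤ δ₀ → ∀ m ≤ Nt,
        (∑ l ∈ Finset.range m, dt * normSqM h ((1 / dt) •
            ((φh (l + 1) - Φ ((l + 1 : ℕ) * dt)) - (φh l - Φ (l * dt))))) +
          gradSqTM h (φh m - Φ (m * dt)) + normSqM h (φh m - Φ (m * dt)) +
          (Rh m - (energyH h ε F (Φ (m * dt)) + C₀)) ^ 2 ≤ C * (h ^ 2 + dt) ^ 2 := by
  have hk0 := hk.nonneg
  have hs0 : 0 < s := lt_of_lt_of_le (by positivity) hs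
  have hΞs : R0 / K₁ ≤ 2 * s := by
    have : R0 / K₁ = 2 * (R0 / (2 * K₁)) := by field_simp
    linarith
  set Rm := R0 + (ε ^ 2 / 2 * b + L ^ 2 * k + |C₀|) with hRm
  obtain ⟨c, η, κ, ζ, hc, hη, hκ, hζ, hest⟩ := Step.exists_estimate (Rm := Rm) hL hT hε hM hs0 hK₁
    hb (div_pos hR0 hK₁) (half_pos hρ) (by positivity) hΞs hk
  -- The Gronwall constant: `η * b ^ 2` comes from the initial scalar error, which is pure
  -- quadrature error, and `1` from the forcing `δ ^ 2`.
  set C₃ := Real.exp (4 * κ * T) * (η * b ^ 2 + 1) with hC₃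
  have hC₃0 : 0 ≤ C₃ := by positivity
  set W := (1 / L + 1) * (C₃ / η) + (1 / L + 2) * (2 / ε ^ 2 * C₃) with hW
  have hW0 : 0 ≤ W := by positivity
  set Zb := 2 * (ζ * (C₃ / c + (2 * C₃ + 3) * T)) + 2 * (8 * √(C₃ / η)) with hZb
  set q₁ := (1 / L + 2) * W + Zb ^ 2
  set q₂ := 2 / ε ^ 2 * C₃
  set q₃ := (√(C₃ / η) + b) * (2 / ρ)
  have hq₁ : 0 ≤ q₁ := by positivity
  have hq₂ : 0 ≤ q₂ := by positivity
  have hq₃ : 0 ≤ q₃ := by positivity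
  -- Smallness of `δ` ensures at once `δ ≤ 1`, the Gronwall condition on `κ * dt`, nodal errors at
  -- most `1`, gradient error at most `1`, and `R_h ≥ ρ / 2`.
  refine ⟨C₃ / c + 2 / ε ^ 2 * C₃ + C₃ / η, 1 / (1 + 2 * κ + q₁ + q₂ + q₃), by positivity,
    by positivity, ?_⟩
  intro N _ Nt h dt Φ Re φh μh Rh hΦ hdt hNT hRe hsch hR0e hE hδ
  have hNpos : (0 : ℝ) < N := Nat.cast_pos.mpr (NeZero.pos N)
  have hh : 0 < h := by rw [hΦ.mesh]; positivity
  set δ := h ^ 2 + dt with hδdef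
  have hδ0 : 0 < δ := by positivity
  rw [le_div_iff₀ (by positivity)] at hδ
  have p1 : 0 ≤ δ * κ := by positivity
  have p2 : 0 ≤ δ * q₁ := by positivity
  have p3 : 0 ≤ δ * q₂ := by positivity
  have p4 : 0 ≤ δ * q₃ := by positivity
  have d1 : δ ≤ 1 := by linarith
  have d2 : κ * dt ≤ 1 / 2 := by
    have : κ * dt ≤ κ * δ := mul_le_mul_of_nonneg_left (by linarith [sq_nonneg h]) hκ
    linarith
  have d3 : δ * q₁ ≤ 1 := by linarith
  have d4 : q₂ * δ ^ 2 ≤ 1 := by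
    have : (δ * q₂) * δ ≤ 1 * 1 := mul_le_mul (by linarith) d1 hδ0.le one_pos.le
    linarith
  have d5 : (√(C₃ / η) + b) * δ ≤ ρ / 2 := by
    have e : δ * q₃ = ((√(C₃ / η) + b) * δ) / (ρ / 2) := by simp only [q₃]; field_simp
    have : δ * q₃ ≤ 1 := by linarith
    rwa [e, div_le_one (by positivity)] at this
  set e : ℕ → Grid N := fun n => φh n - Φ (n * dt) with he
  set r : ℕ → ℝ := fun n => Rh n - (energyH h ε F (Φ (n * dt)) + C₀) with hr
  set X : ℕ → ℝ := fun n => errEnergy ε η h (r n) (e n) with hX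
  set A : ℕ → ℝ := fun n => normSqM h ((1 / dt) • (e (n + 1) - e n)) with hA
  set Z : ℕ → ℝ := fun n => normM h (lapH h (e n)) with hZ
  have hX0 : ∀ n, 0 ≤ X n := fun n => errEnergy_nonneg hη.le
  have hA0 : ∀ n, 0 ≤ A n := fun n => normSqM_nonneg _
  have htime : ∀ n ≤ Nt, (n : ℝ) * dt ∈ Icc 0 T := fun n hn =>
    ⟨by positivity, le_trans (mul_le_mul_of_nonneg_right (Nat.cast_le.2 hn) hdt.le) hNT⟩
  have he0 : e 0 = 0 := by simp [he, hsch.init_phi]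
  have hXinit : X 0 ≤ η * b ^ 2 * δ ^ 2 := by
    have h1 := hΦ.energy 0 ⟨le_rfl, hT.le⟩
    have h2 : |r 0| ≤ b * δ := by
      have h3 : r 0 = -(energyH h ε F (Φ 0) + C₀ - Re 0) := by
        simp only [hr, hsch.init_R, hR0e, Nat.cast_zero, zero_mul]; ring
      rw [h3, abs_neg]
      exact h1.trans (mul_le_mul_of_nonneg_left (by linarith) hb)
    have h4 : r 0 ^ 2 ≤ (b * δ) ^ 2 := by rw [← sq_abs (r 0)]; gcongr
    have h5 : X 0 = η * r 0 ^ 2 := by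
      simp only [hX, he0, errEnergy, gradSqTM, normSqM, innerM, Pi.zero_apply]
      simp
    rw [h5]
    have := mul_le_mul_of_nonneg_left h4 hη.le
    linarith
  have hlocal : ∀ n < Nt, (∀ i j, |e n i j| ≤ 1) → gradSqTM h (e n) ≤ 1 → ρ / 2 ≤ Rh n →
      X (n + 1) + c * (dt * A n) ≤ X n + κ * dt * (X (n + 1) + X n + δ ^ 2) ∧
      Z (n + 1) ≤ Z n + ζ * (√(A n) + √(X (n + 1) + X n + δ ^ 2)) := by
    intro n hn g1 g2 g3
    have ht := htime n hn.le
    have hcast : ((n + 1 : ℕ) : ℝ) * dt = n * dt + dt := by push_cast; ring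
    have ht' := htime (n + 1) hn
    rw [hcast] at ht'
    have hE0 : 0 < energyH h ε F (φh n) + C₀ := hK₁.trans_le (hE n hn)
    have hR' := hsch.R_le hM hdt (n := n + 1) hn
    have hR'0 := hsch.pos n hn
    have hξ : Rh (n + 1) / (energyH h ε F (φh n) + C₀) ≤ R0 / K₁ :=
      div_le_div₀ hR0.le hR' hK₁ (hE n hn)
    have hRm' : |Rh (n + 1) - (energyH h ε F (Φ (n * dt + dt)) + C₀)| ≤ Rm := by
      have h1 := abs_energyH_le (h := h) (ε := ε) (F := F) (u := Φ (n * dt + dt)) hΦ.mesh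
        fun i j => hk.abs_le _ (abs_le.1 ((hΦ.bound _ ht' i j).trans (by linarith)))
      have h2 : ε ^ 2 / 2 * gradSqTM h (Φ (n * dt + dt)) ≤ ε ^ 2 / 2 * b := by
        gcongr; exact hΦ.grad _ ht'
      have h3 := abs_sub (Rh (n + 1)) (energyH h ε F (Φ (n * dt + dt)) + C₀)
      have h4 := abs_add_le (energyH h ε F (Φ (n * dt + dt))) C₀
      rw [abs_of_pos hR'0] at h3
      linarith
    have := hest N h dt (n * dt) _ (Rh n) (Rh (n + 1)) (φh n) (φh (n + 1)) Φ Re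
      (hsch.step hM hdt hK₁ hn (hE n hn)) hΦ ht.1 hdt ht'.2 (hE n hn) (div_pos hR'0 hE0).le hξ g3
      hRm' g1 g2 (X n) (X (n + 1)) (A n) δ rfl (by simp only [hX, hr, he, hcast])
      (by simp only [hA, he, hcast]) rfl
    simpa only [hZ, he, hcast] using this
  -- The smallness conditions are required only strictly before `m`, and the conclusion is at `m`;
  -- this gap drives the induction in `hgood`.
  have hbound : ∀ m ≤ Nt, (∀ n < m, (∀ i j, |e n i j| ≤ 1) ∧ gradSqTM h (e n) ≤ 1 ∧ ρ / 2 ≤ Rh n) →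
      X m + c * ∑ l ∈ Finset.range m, dt * A l ≤ C₃ * δ ^ 2 := by
    intro m hm hgood
    have h1 := discrete_gronwall hc.le hdt hκ d2 (htime m hm).2 hX0 hA0 (sq_nonneg δ) fun n hn =>
      (hlocal n (by omega) (hgood n hn).1 (hgood n hn).2.1 (hgood n hn).2.2).1
    refine h1.trans ?_
    have h2 : Real.exp (4 * κ * T) * (X 0 + δ ^ 2) ≤
      Real.exp (4 * κ * T) * ((η * b ^ 2 + 1) * δ ^ 2) :=
      mul_le_mul_of_nonneg_left (by linarith) (Real.exp_pos _).le
    linarith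
  have hsum0 : ∀ m, 0 ≤ c * ∑ l ∈ Finset.range m, dt * A l := fun m =>
    mul_nonneg hc.le (Finset.sum_nonneg fun l _ => mul_nonneg hdt.le (hA0 l))
  have hgood : ∀ m ≤ Nt, (∀ i j, |e m i j| ≤ 1) ∧ gradSqTM h (e m) ≤ 1 ∧ ρ / 2 ≤ Rh m := by
    intro m
    induction m using Nat.strong_induction_on with
    | _ m ih =>
      intro hm
      have hprev : ∀ n < m, (∀ i j, |e n i j| ≤ 1) ∧ gradSqTM h (e n) ≤ 1 ∧ ρ / 2 ≤ Rh n :=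
        fun n hn => ih n hn (by omega)
      have hXall : ∀ n ≤ m, X n ≤ C₃ * δ ^ 2 := fun n hn => by
        have := hbound n (by omega) fun l hl => hprev l (by omega)
        linarith [hsum0 n]
      have hXm := hXall m le_rfl
      have hY : normSqM h (e m) ≤ C₃ / η * δ ^ 2 := by
        have h1 : normSqM h (e m) ≤ 1 / η * X m := normSqM_le_errEnergy hη
        have h2 := mul_le_mul_of_nonneg_left hXm (by positivity : 0 ≤ 1 / η)
        have h3 : 1 / η * (C₃ * δ ^ 2) = C₃ / η * δ ^ 2 := by ring
        linarith
      have hG : gradSqTM h (e m) ≤ q₂ * δ ^ 2 := by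
        have h1 : gradSqTM h (e m) ≤ 2 / ε ^ 2 * X m := gradSqTM_le_errEnergy hε hη.le
        have h2 := mul_le_mul_of_nonneg_left hXm (by positivity : 0 ≤ 2 / ε ^ 2)
        simp only [q₂]
        linarith
      have hnorm : normM h (e m) ≤ √(C₃ / η) * δ := by
        refine Real.sqrt_le_iff.2 ⟨by positivity, ?_⟩
        rw [mul_pow, Real.sq_sqrt (by positivity)]
        exact hY
      -- Membership in the sup-norm ball is recovered from the `H²` bound, which in turn only needs
      -- the steps before `m`.
      have hZm : Z m ≤ Zb := by
        refine lap_bound_of_sum (X := X) (A := A) hc hζ hdt hT.le (htime m hm).2 hX0 hA0 hC₃0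
          (by positivity) hh hXall ?_ ?_ (fun n hn => (hlocal n (by omega) (hprev n hn).1
            (hprev n hn).2.1 (hprev n hn).2.2).2) ?_
        · have := hbound m hm hprev
          linarith [hX0 m]
        · simp only [hZ, he0, normM, normSqM, innerM, lapH, Pi.zero_apply]
          simp
        · have h1 := mul_le_mul_of_nonneg_left (normM_lapH_le hh (e m)) (sq_nonneg h)
          have h2 : h ^ 2 * (8 / h ^ 2 * normM h (e m)) = 8 * normM h (e m) := by field_simp
          simp only [hZ]
          linarith
      refine ⟨abs_le_one_of_lapH hL hΦ.mesh hδ0 d1 hW0 ?_ ?_ hZm d3, hG.trans d4, ?_⟩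
      · have h1 := mul_le_mul_of_nonneg_left hY (by positivity : 0 ≤ 1 / L + 1)
        have h2 : 0 ≤ (1 / L + 1) * (q₂ * δ ^ 2) := by positivity
        simp only [W]
        linarith
      · have h1 := mul_le_mul_of_nonneg_left hG (by positivity : 0 ≤ 1 / L + 1)
        have h2 : 0 ≤ (1 / L + 1) * (C₃ / η) * δ ^ 2 := by positivity
        have h3 : 0 ≤ q₂ * δ ^ 2 := by positivity
        simp only [W]
        linarith
      · have h1 : |r m| ≤ √(C₃ / η) * δ := by
          have h2 : r m ^ 2 ≤ 1 / η * X m := sq_le_errEnergy hη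
          have h3 := mul_le_mul_of_nonneg_left hXm (by positivity : 0 ≤ 1 / η)
          have h4 : 1 / η * (C₃ * δ ^ 2) = C₃ / η * δ ^ 2 := by ring
          refine abs_le_of_sq_le_sq ?_ (by positivity)
          rw [mul_pow, Real.sq_sqrt (by positivity)]
          linarith
        have h5 := abs_le.1 h1
        have h6 := abs_le.1 (hΦ.energy _ (htime m hm))
        have h7 := hRe _ (htime m hm)
        have h8 : b * h ^ 2 ≤ b * δ := mul_le_mul_of_nonneg_left (by linarith) hb
        have h9 : r m = Rh m - (energyH h ε F (Φ (m * dt)) + C₀) := rfl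
        linarith [h5.1, h6.1]
  intro m hm
  have h1 := hbound m hm fun n hn => hgood n (by omega)
  have h2 : gradSqTM h (e m) ≤ 2 / ε ^ 2 * X m := gradSqTM_le_errEnergy hε hη.le
  have h3 : r m ^ 2 + normSqM h (e m) ≤ 1 / η * X m := add_le_errEnergy hη
  have h4 : X m ≤ C₃ * δ ^ 2 := by linarith [hsum0 m]
  have h5 := mul_le_mul_of_nonneg_left h4 (by positivity : 0 ≤ 2 / ε ^ 2)
  have h6 := mul_le_mul_of_nonneg_left h4 (by positivity : 0 ≤ 1 / η)
  have h7 : ∑ l ∈ Finset.range m, dt * A l ≤ C₃ / c * δ ^ 2 := by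
    rw [div_mul_eq_mul_div, le_div_iff₀ hc]; linarith [hX0 m]
  have h8 : 1 / η * (C₃ * δ ^ 2) = C₃ / η * δ ^ 2 := by ring
  change ∑ l ∈ Finset.range m, dt * A l + gradSqTM h (e m) + normSqM h (e m) + r m ^ 2 ≤ _
  linarith

/-- The exact solution is consistent with the scheme. -/
lemma exists_consistent {L T ε M : ℝ} (hL : 0 < L) (hT : 0 < T) (hM : 0 < M) {F : ℝ → ℝ}
    (hF : ContDiff ℝ 2 F) {φ : ℝ → ℝ × ℝ → ℝ} (hsol : IsAllenCahnSolution L T ε M F φ)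
    (hreg₂ : MemBochnerSobolev L T 1 2 2 φ) (hreg₃ : MemBochnerSobolev L T 0 4 ⊤ φ) (s C₀ : ℝ) :
    ∃ b : ℝ, 0 ≤ b ∧ ∀ (N : ℕ) [NeZero N] (h : ℝ), h = L / N →
      Consistent L T ε M s C₀ h b F (fun t => sample L N (φ t))
        (fun t => energy L ε F (φ t) + C₀) := by
  obtain ⟨B, K, Q, D, hB, hQ, hD, H⟩ := exists_nodalCurve hL hT hF hsol hreg₂ hreg₃
  -- The grid with one node serves only to extract `0 ≤ K`.
  obtain ⟨⟨Λ₀, P₀, hc₀⟩, -⟩ := H 1 (L / (1 : ℕ)) rfl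
  have hK := hc₀.localBound.nonneg
  have hv : 0 ≤ NodalCurve.velBound ε M B K := by unfold NodalCurve.velBound; positivity
  have hvl : 0 ≤ NodalCurve.velLip L ε M B K Q := by unfold NodalCurve.velLip; positivity
  set b₁ := L * NodalCurve.velBound ε M B K
  set b₂ := 1 / M * NodalCurve.velLip L ε M B K Q + ε ^ 2 * (L * B) + |s| * ε ^ 2 * √Q
  set b₃ := 4 / M * NodalCurve.velLip L ε M B K Q * (L * NodalCurve.velBound ε M B K) +
        ε ^ 2 * (L * B) * (L * NodalCurve.velBound ε M B K)
  set b₄ := L * (2 * B)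
  set b₅ := L * (2 * B) * (L * B)
  have h1 : 0 ≤ b₁ := by positivity
  have h2 : 0 ≤ b₂ := by positivity
  have h3 : 0 ≤ b₃ := by positivity
  have h4 : 0 ≤ b₄ := by positivity
  have h5 : 0 ≤ b₅ := by positivity
  refine ⟨B + D + b₁ + b₂ + b₃ + b₄ + b₅, by positivity, fun N _ h hN => ?_⟩
  obtain ⟨⟨Λ, P, hc⟩, hen⟩ := H N h hN
  have hh := hc.h_pos hL
  have hlap : ∀ t ∈ Icc 0 T, normM h (lapH h (sample L N (φ t))) ≤ b₄ := fun t ht =>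
    normM_le_of_abs_le hL.le hN (by positivity) (hc.lapH_bound t ht)
  refine ⟨hN, fun t ht i j => (hc.bound t ht i j).trans (by linarith), fun t ht =>
    (hlap t ht).trans (by linarith), fun t ht => ?_, fun t ht => ?_, fun t dt ht hdt htT =>
    (hc.normM_quot_le hL hM hB ht hdt htT).trans (by linarith), fun t dt ht hdt htT =>
    (hc.normM_trunc_le hL hM hB hQ s ht hdt htT).trans ?_, fun t dt ht hdt htT =>
    (hc.abs_energy_balance_le (hF.differentiable two_ne_zero) hL hM hB hQ ht hdt htT).trans ?_⟩
  · refine (gradSqTM_le_lapH hh.ne' _).trans ?_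
    have a1 : normM h (sample L N (φ t)) ≤ L * B :=
      normM_le_of_abs_le hL.le hN hB (hc.bound t ht)
    have a2 : normM h (lapH h (sample L N (φ t))) * normM h (sample L N (φ t)) ≤ b₅ :=
      mul_le_mul (hlap t ht) a1 (normM_nonneg _) (by positivity)
    exact a2.trans (by linarith)
  · have e : energyH h ε F (sample L N (φ t)) + C₀ - (energy L ε F (φ t) + C₀) =
        energyH h ε F (sample L N (φ t)) - energy L ε F (φ t) := by ring
    rw [e]
    exact (hen t ht).trans (mul_le_mul_of_nonneg_right (by linarith) (sq_nonneg h))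
  · exact mul_le_mul_of_nonneg_right (by linarith) (by positivity)
  · exact mul_le_mul_of_nonneg_right (by linarith) (by positivity)

/-- A function that is consistent with the energies on all grids is Lipschitz in time. -/
lemma abs_energy_sub_le {L T ε M s C₀ b : ℝ} {F : ℝ → ℝ} {Re : ℝ → ℝ} (hM : 0 < M)
    (hb : 0 ≤ b) {Φ : (N : ℕ) → ℝ → Grid N}
    (hΦ : ∀ (N : ℕ) [NeZero N], Consistent L T ε M s C₀ (L / N) b F (Φ N) Re) {t dt : ℝ}
    (ht : 0 ≤ t) (hdt : 0 < dt) (htT : t + dt ≤ T) :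
    |Re (t + dt) - Re t| ≤ (b ^ 2 / M + b * T) * dt := by
  have htm : t ∈ Icc 0 T := ⟨ht, by linarith⟩
  have htm' : t + dt ∈ Icc 0 T := ⟨by linarith, htT⟩
  -- The discrete balance law holds on every grid with the same `b`; refining the grid with `dt`
  -- fixed removes the spatial error.
  have h1 : ∀ n : ℕ, |Re (t + dt) - Re t| ≤ (b ^ 2 / M + b * T) * dt +
      (2 * b + b * dt) * (L / (n + 1 : ℕ)) ^ 2 := by
    intro n
    have hc := hΦ (n + 1)
    set h := L / (n + 1 : ℕ)
    have a1 := abs_le.1 (hc.balance t dt ht hdt htT)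
    have a2 := abs_le.1 (hc.energy t htm)
    have a3 := abs_le.1 (hc.energy (t + dt) htm')
    have a4 : normSqM h (NodalCurve.quot (Φ (n + 1)) t dt) ≤ b ^ 2 := by
      rw [← normM_sq]; exact pow_le_pow_left₀ (normM_nonneg _) (hc.quot t dt ht hdt htT) 2
    have a5 := mul_le_mul_of_nonneg_left a4 (by positivity : 0 ≤ dt / M)
    have a6 : 0 ≤ dt / M * normSqM h (NodalCurve.quot (Φ (n + 1)) t dt) :=
      mul_nonneg (by positivity) (normSqM_nonneg _)
    have a7 : b * (dt * dt) ≤ b * (dt * T) := by gcongr; linarith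
    have a8 : dt / M * b ^ 2 = b ^ 2 / M * dt := by ring
    have a9 : 0 ≤ b ^ 2 / M * dt := by positivity
    rw [abs_le]
    constructor <;> linarith [a1.1, a1.2, a2.1, a2.2, a3.1, a3.2]
  have h2 : Filter.Tendsto (fun n : ℕ => (b ^ 2 / M + b * T) * dt +
      (2 * b + b * dt) * (L / (n + 1 : ℕ)) ^ 2) Filter.atTop
      (nhds ((b ^ 2 / M + b * T) * dt + (2 * b + b * dt) * 0 ^ 2)) :=
    ((((tendsto_const_div_atTop_nhds_zero_nat L).comp (Filter.tendsto_add_atTop_nat 1)).pow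
      2).const_mul _).const_add _
  have h3 := ge_of_tendsto' h2 h1
  simpa using h3

/-- The function is Lipschitz in time by consistency, hence attains a positive minimum. This is the
`ρ` that keeps `ξ` away from zero. -/
lemma exists_pos_le {L T ε M s C₀ b : ℝ} {F : ℝ → ℝ} {Re : ℝ → ℝ} (hT : 0 < T)
    (hM : 0 < M) (hb : 0 ≤ b) {Φ : (N : ℕ) → ℝ → Grid N}
    (hΦ : ∀ (N : ℕ) [NeZero N], Consistent L T ε M s C₀ (L / N) b F (Φ N) Re)
    (hpos : ∀ t ∈ Icc 0 T, 0 < Re t) : ∃ ρ : ℝ, 0 < ρ ∧ ∀ t ∈ Icc 0 T, ρ ≤ Re t := by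
  set c := b ^ 2 / M + b * T
  have hc : 0 ≤ c := by positivity
  have hle : ∀ x ∈ Icc 0 T, ∀ y ∈ Icc 0 T, x ≤ y → |Re x - Re y| ≤ c * |x - y| := by
    intro x hx y hy hxy
    rcases hxy.eq_or_lt with rfl | hlt
    · simp
    · have := abs_energy_sub_le hM hb hΦ hx.1 (sub_pos.2 hlt) (by linarith [hy.2])
      rw [add_sub_cancel] at this
      rw [abs_sub_comm, abs_sub_comm x, abs_of_pos (sub_pos.2 hlt)]
      exact this
  have hcont : ContinuousOn Re (Icc 0 T) := by
    refine LipschitzOnWith.continuousOn (K := c.toNNReal) (LipschitzOnWith.of_dist_le_mul ?_)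
    intro x hx y hy
    rw [Real.coe_toNNReal _ hc, Real.dist_eq, Real.dist_eq]
    rcases le_total x y with hxy | hxy
    · exact hle x hx y hy hxy
    · rw [abs_sub_comm, abs_sub_comm x]
      exact hle y hy x hx hxy
  obtain ⟨x, hx, hmin⟩ := isCompact_Icc.exists_isMinOn ⟨0, le_rfl, hT.le⟩ hcont
  exact ⟨Re x, hpos x hx, fun t ht => hmin ht⟩

end

section

/-! ### Coarse discretisations -/

/-- The analogue of `Step.lap_step` for the numerical solution itself, which needs no closeness to
the exact one. -/
lemma Step.normM_lapH_le {N : ℕ} [NeZero N] {h dt ε M s ξ E R R' : ℝ} {F : ℝ → ℝ} {φ φ' : Grid N}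
    (hst : Step h dt ε M s ξ E R R' F φ φ') (hM : 0 < M) (hε : 0 < ε) (hs : 0 < s)
    (hξ : 0 ≤ ξ) (hξs : ξ ≤ 2 * s) :
    normM h (lapH h φ') ≤ normM h (lapH h φ) +
      1 / (s * ε ^ 2) * (1 / M * normM h ((1 / dt) • (φ' - φ)) +
        ξ * normM h (fun i j => deriv F (φ i j))) := by
  have heq := hst.phi
  set a := (1 / dt) • (φ' - φ) with ha
  clear_value a
  set f : Grid N := fun i j => deriv F (φ i j) with hf
  have h1 : lapH h φ' = ((s - ξ) / s) • lapH h φ + (1 / (s * ε ^ 2)) • ((1 / M) • a + ξ • f) := by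
    rw [heq]
    ext i j
    simp only [Pi.sub_apply, Pi.smul_apply, Pi.add_apply, smul_eq_mul]
    field_simp
    ring
  have h2 := normM_add_le (h := h) (((s - ξ) / s) • lapH h φ)
    ((1 / (s * ε ^ 2)) • ((1 / M) • a + ξ • f))
  have h3 := normM_add_le (h := h) ((1 / M) • a) (ξ • f)
  rw [normM_smul, normM_smul, abs_of_pos (by positivity : 0 < 1 / (s * ε ^ 2))] at h2
  rw [normM_smul, normM_smul, abs_of_pos (by positivity : 0 < 1 / M), abs_of_nonneg hξ] at h3
  have h4 : |(s - ξ) / s| ≤ 1 := by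
    rw [abs_div, abs_of_pos hs, div_le_one hs, abs_le]
    constructor <;> linarith
  have h5 := mul_le_mul_of_nonneg_right h4 (normM_nonneg (h := h) (lapH h φ))
  have h6 := mul_le_mul_of_nonneg_left h3 (by positivity : 0 ≤ 1 / (s * ε ^ 2))
  rw [h1]
  linarith

/-- Finitely many steps of the scheme with a time step that is bounded below are bounded in the
discrete `H²` seminorm. -/
lemma exists_lapH_bound {L ε M s C₀ K₁ b R0 : ℝ} {F : ℝ → ℝ} (hF : ContDiff ℝ 2 F) (hL : 0 < L)
    (hε : 0 < ε) (hM : 0 < M) (hK₁ : 0 < K₁) (hb : 0 ≤ b) (hR0 : 0 < R0)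
    (hs : R0 / (2 * K₁) ≤ s) {y dt₀ : ℝ} (hy : 0 ≤ y) (hdt₀ : 0 < dt₀) (n : ℕ) :
    ∃ z : ℝ, 0 ≤ z ∧ ∀ (N : ℕ) [NeZero N] (Nt : ℕ) (h dt : ℝ) (φ0 : Grid N) (φh μh : ℕ → Grid N)
      (Rh : ℕ → ℝ), h = L / N → dt₀ ≤ dt →
      IsPSSAVSolution h dt Nt ε M s C₀ F φ0 R0 φh μh Rh → normM h (lapH h φ0) ≤ b →
      (∀ n < Nt, K₁ ≤ energyH h ε F (φh n) + C₀) → (∀ n ≤ Nt, normM h (φh n) ≤ y) → n ≤ Nt →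
      normM h (lapH h (φh n)) ≤ z := by
  have hs0 : 0 < s := lt_of_lt_of_le (by positivity) hs
  have hΞs : R0 / K₁ ≤ 2 * s := by
    have : R0 / K₁ = 2 * (R0 / (2 * K₁)) := by field_simp
    linarith
  induction n with
  | zero =>
    refine ⟨b, hb, fun N _ Nt h dt φ0 φh μh Rh hN hdt hsch hlap hE hφ hn => ?_⟩
    rw [hsch.init_phi]; exact hlap
  | succ n ih =>
    obtain ⟨z, hz, H⟩ := ih
    -- The right side of `sq_le_of_lapH` with `l = 1`. It gives a sup bound at step `n`, hence a
    -- bound for `F'` there; the constants may grow with `n` in an uncontrolled way.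
    set q := (1 / L + 1) * ((1 / L + 1) * y ^ 2 + z * y) + 1 * ((1 / L + 1) * (z * y) + z ^ 2)
    obtain ⟨k, hk⟩ := exists_localBound hF (√q)
    have hk0 := hk.nonneg
    refine ⟨z + 1 / (s * ε ^ 2) * (1 / M * (1 / dt₀ * (2 * y)) + R0 / K₁ * (L * k)),
      by positivity, fun N _ Nt h dt φ0 φh μh Rh hN hdt hsch hlap hE hφ hn => ?_⟩
    have hNpos : (0 : ℝ) < N := Nat.cast_pos.mpr (NeZero.pos N)
    have hh : h ≠ 0 := by rw [hN]; positivity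
    have hdt0 : 0 < dt := hdt₀.trans_le hdt
    have hZ := H N Nt h dt φ0 φh μh Rh hN hdt hsch hlap hE hφ (by omega)
    have hY := hφ n (by omega)
    have hG : gradSqTM h (φh n) ≤ z * y :=
      (gradSqTM_le_lapH hh _).trans (mul_le_mul hZ hY (normM_nonneg _) hz)
    have hsup : ∀ i j, |φh n i j| ≤ √q := fun i j => by
      refine Real.abs_le_sqrt ((sq_le_of_lapH hL one_pos hN (φh n) i j).trans ?_)
      rw [← normM_sq, ← normM_sq, div_one]
      have a1 := pow_le_pow_left₀ (normM_nonneg _) hY 2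
      have a2 := pow_le_pow_left₀ (normM_nonneg _) hZ 2
      simp only [q]
      gcongr
    have hE0 : 0 < energyH h ε F (φh n) + C₀ := hK₁.trans_le (hE n hn)
    have hR' := hsch.R_le hM hdt0 (n := n + 1) hn
    have hR'0 := hsch.pos n hn
    have hξ : Rh (n + 1) / (energyH h ε F (φh n) + C₀) ≤ R0 / K₁ :=
      div_le_div₀ hR0.le hR' hK₁ (hE n hn)
    have h1 := (hsch.step hM hdt0 hK₁ hn (hE n hn)).normM_lapH_le hM hε hs0 (div_pos hR'0 hE0).le
      (hξ.trans hΞs)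
    refine h1.trans ?_
    have h2 : normM h ((1 / dt) • (φh (n + 1) - φh n)) ≤ 1 / dt₀ * (2 * y) := by
      rw [normM_smul, abs_of_pos (by positivity)]
      have a1 := normM_sub_le (h := h) (φh (n + 1)) (φh n)
      have a2 := hφ (n + 1) hn
      refine mul_le_mul (one_div_le_one_div_of_le hdt₀ hdt) (by linarith) (normM_nonneg _)
        (by positivity)
    have h3 : normM h (fun i j => deriv F (φh n i j)) ≤ L * k :=
      normM_le_of_abs_le hL.le hN hk0 fun i j => hk.abs_deriv_le _ (abs_le.1 (hsup i j))
    have h4 := normM_nonneg (h := h) (fun i j => deriv F (φh n i j))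
    gcongr

/-- The energy law of the scheme, telescoped. It controls the velocities without any smallness
assumption. -/
lemma IsPSSAVSolution.sum_le {N Nt : ℕ} [NeZero N] {h dt ε M s C₀ R0 : ℝ} {F : ℝ → ℝ}
    {φ0 : Grid N} {φh μh : ℕ → Grid N} {Rh : ℕ → ℝ}
    (hsch : IsPSSAVSolution h dt Nt ε M s C₀ F φ0 R0 φh μh Rh) (hM : 0 < M) (hdt : 0 < dt)
    {n : ℕ} (hn : n ≤ Nt) :
    ∑ l ∈ Finset.range n, dt * normSqM h ((1 / dt) • (φh (l + 1) - φh l)) = M * (R0 - Rh n) := by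
  induction n with
  | zero => simp [hsch.init_R]
  | succ n ih =>
    rw [Finset.sum_range_succ, ih (by omega)]
    have h1 := hsch.R_eq n hn
    have e : (fun i j => (φh (n + 1) i j - φh n i j) / dt : Grid N) =
        (1 / dt) • (φh (n + 1) - φh n) := by
      ext i j
      simp only [Pi.sub_apply, Pi.smul_apply, smul_eq_mul]; ring
    rw [e, div_eq_iff hdt.ne'] at h1
    change Rh (n + 1) - Rh n = -(1 / M) * normSqM h _ * dt at h1
    have h2 : M * (Rh (n + 1) - Rh n) =
      -(dt * normSqM h ((1 / dt) • (φh (n + 1) - φh n))) := by rw [h1]; field_simp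
    linarith

/-- The errors are bounded for coarse discretisations. -/
lemma exists_coarse_bound {L T ε M s C₀ K₁ b k R0 δ₀ : ℝ} {F : ℝ → ℝ} (hF : ContDiff ℝ 2 F)
    (hL : 0 < L) (hT : 0 < T) (hε : 0 < ε) (hM : 0 < M) (hK₁ : 0 < K₁) (hb : 0 ≤ b)
    (hR0 : 0 < R0) (hs : R0 / (2 * K₁) ≤ s) (hk : LocalBound F b k) (hδ₀ : 0 < δ₀) :
    ∃ C : ℝ, 0 ≤ C ∧
      ∀ (N : ℕ) [NeZero N] (Nt : ℕ) (h dt : ℝ) (Φ : ℝ → Grid N) (Re : ℝ → ℝ)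
        (φh μh : ℕ → Grid N) (Rh : ℕ → ℝ),
        Consistent L T ε M s C₀ h b F Φ Re → 0 < dt → Nt * dt ≤ T →
        IsPSSAVSolution h dt Nt ε M s C₀ F (Φ 0) R0 φh μh Rh →
        (∀ n < Nt, K₁ ≤ energyH h ε F (φh n) + C₀) → δ₀ ≤ h ^ 2 + dt → ∀ m ≤ Nt,
        (∑ l ∈ Finset.range m, dt * normSqM h ((1 / dt) •
            ((φh (l + 1) - Φ ((l + 1 : ℕ) * dt)) - (φh l - Φ (l * dt))))) +
          gradSqTM h (φh m - Φ (m * dt)) + normSqM h (φh m - Φ (m * dt)) +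
          (Rh m - (energyH h ε F (Φ (m * dt)) + C₀)) ^ 2 ≤ C := by
  have hk0 := hk.nonneg
  set σ := 2 * (M * R0) + 2 * (T * b ^ 2) with hσ
  -- The error norm is at most the sum of `dt * ‖a‖ ≤ dt * (1 + ‖a‖²)` over the steps.
  set y := T + σ with hy
  have hy0 : 0 ≤ y := by positivity
  set Rm := R0 + (ε ^ 2 / 2 * b + L ^ 2 * k + |C₀|) with hRm
  choose z hz0 hz using fun n => exists_lapH_bound (C₀ := C₀) hF hL hε hM hK₁ hb hR0 hs
    (show 0 ≤ y + L * b by positivity) (half_pos hδ₀) n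
  -- The largest possible number of steps when `dt ≥ δ₀ / 2`; only finitely many of the constants `z
  -- n` matter then.
  set n₀ := ⌈T / (δ₀ / 2)⌉₊
  set zm := ∑ n ∈ Finset.range (n₀ + 1), z n
  have hzm : 0 ≤ zm := Finset.sum_nonneg fun n _ => hz0 n
  refine ⟨σ + (8 / (δ₀ / 2) * y ^ 2 + (zm + b) * y) + y ^ 2 + Rm ^ 2, by positivity, ?_⟩
  intro N _ Nt h dt Φ Re φh μh Rh hΦ hdt hNT hsch hE hδ m hm
  have hNpos : (0 : ℝ) < N := Nat.cast_pos.mpr (NeZero.pos N)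
  have hh : 0 < h := by rw [hΦ.mesh]; positivity
  have htime : ∀ n ≤ Nt, (n : ℝ) * dt ∈ Icc 0 T := fun n hn =>
    ⟨by positivity, le_trans (mul_le_mul_of_nonneg_right (Nat.cast_le.2 hn) hdt.le) hNT⟩
  set e : ℕ → Grid N := fun n => φh n - Φ (n * dt) with he
  set a : ℕ → Grid N := fun n => (1 / dt) • (e (n + 1) - e n) with ha
  have he0 : e 0 = 0 := by simp [he, hsch.init_phi]
  have hA : ∀ n ≤ Nt, ∑ l ∈ Finset.range n, dt * normSqM h (a l) ≤ σ := by
    intro n hn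
    have h1 : ∀ l ∈ Finset.range n, dt * normSqM h (a l) ≤
        2 * (dt * normSqM h ((1 / dt) • (φh (l + 1) - φh l))) + 2 * (dt * b ^ 2) := by
      intro l hl
      have hl' : l + 1 ≤ Nt := by have := Finset.mem_range.1 hl; omega
      have hcast : ((l + 1 : ℕ) : ℝ) * dt = l * dt + dt := by push_cast; ring
      have ht := htime l (by omega)
      have ht' := htime (l + 1) hl'
      rw [hcast] at ht'
      have e1 : a l = (1 / dt) • (φh (l + 1) - φh l) + (-1 : ℝ) • NodalCurve.quot Φ (l * dt) dt := by
        ext i j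
        simp only [ha, he, hcast, NodalCurve.quot, Pi.sub_apply, Pi.smul_apply, Pi.add_apply,
          smul_eq_mul]
        ring
      have h2 := normSqM_add_le (h := h) ((1 / dt) • (φh (l + 1) - φh l))
        ((-1 : ℝ) • NodalCurve.quot Φ (l * dt) dt)
      rw [← e1, normSqM_smul (-1) (NodalCurve.quot Φ (l * dt) dt)] at h2
      have h3 : normSqM h (NodalCurve.quot Φ (l * dt) dt) ≤ b ^ 2 := by
        rw [← normM_sq]
        exact pow_le_pow_left₀ (normM_nonneg _) (hΦ.quot _ dt ht.1 hdt ht'.2) 2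
      have h4 := mul_le_mul_of_nonneg_left h2 hdt.le
      have h5 := mul_le_mul_of_nonneg_left h3 hdt.le
      linarith
    refine (Finset.sum_le_sum h1).trans ?_
    rw [Finset.sum_add_distrib, ← Finset.mul_sum, hsch.sum_le hM hdt hn, Finset.sum_const,
      Finset.card_range, nsmul_eq_mul]
    have h2 := mul_pos hM (hsch.R_pos hR0 hn)
    have h3 := mul_le_mul_of_nonneg_right (htime n hn).2 (sq_nonneg b)
    linarith
  have hnorm : ∀ n ≤ Nt, normM h (e n) ≤ y := by
    intro n hn
    have key : ∀ n ≤ Nt, normM h (e n) ≤ ∑ l ∈ Finset.range n, (dt + dt * normSqM h (a l)) := by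
      intro n
      induction n with
      | zero =>
        intro _
        simp [he0, normM, normSqM, innerM]
      | succ n ih =>
        intro hn
        rw [Finset.sum_range_succ]
        have h1 := ih (by omega)
        have e1 : e (n + 1) = e n + dt • a n := by
          simp only [ha, smul_smul, mul_one_div_cancel hdt.ne', one_smul, add_sub_cancel]
        have h2 := normM_add_le (h := h) (e n) (dt • a n)
        rw [← e1, normM_smul, abs_of_pos hdt] at h2
        have h3 : normM h (a n) ≤ 1 + normSqM h (a n) := by
          rw [← normM_sq]
          have := sq_nonneg (normM h (a n) - 1)
          have := sq_nonneg (normM h (a n))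
          linarith
        have h4 := mul_le_mul_of_nonneg_left h3 hdt.le
        linarith
    refine (key n hn).trans ?_
    rw [Finset.sum_add_distrib, Finset.sum_const, Finset.card_range, nsmul_eq_mul]
    linarith [hA n hn, (htime n hn).2]
  have hY : normSqM h (e m) ≤ y ^ 2 := by
    rw [← normM_sq]; exact pow_le_pow_left₀ (normM_nonneg _) (hnorm m hm) 2
  have hR : (Rh m - (energyH h ε F (Φ (m * dt)) + C₀)) ^ 2 ≤ Rm ^ 2 := by
    rw [sq_le_sq, abs_of_nonneg (by positivity : 0 ≤ Rm)]
    have h1 := abs_energyH_le (h := h) (ε := ε) (F := F) (u := Φ (m * dt)) hΦ.mesh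
      fun i j => hk.abs_le _ (abs_le.1 (hΦ.bound _ (htime m hm) i j))
    have h2 : ε ^ 2 / 2 * gradSqTM h (Φ (m * dt)) ≤ ε ^ 2 / 2 * b := by
      gcongr; exact hΦ.grad _ (htime m hm)
    have h3 := abs_sub (Rh m) (energyH h ε F (Φ (m * dt)) + C₀)
    have h4 := abs_add_le (energyH h ε F (Φ (m * dt))) C₀
    rw [abs_of_pos (hsch.R_pos hR0 hm)] at h3
    have h5 := hsch.R_le hM hdt hm
    linarith
  have hG : gradSqTM h (e m) ≤ 8 / (δ₀ / 2) * y ^ 2 + (zm + b) * y := by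
    -- A coarse mesh makes the inverse inequality harmless; otherwise the time step is large and the
    -- step-dependent `H²` bounds are available.
    rcases le_total (δ₀ / 2) (h ^ 2) with hle | hle
    · have h1 := gradSqTM_le_normSqM hh (e m)
      have h2 : 8 / h ^ 2 * normSqM h (e m) ≤ 8 / (δ₀ / 2) * y ^ 2 := by
        have := normSqM_nonneg (h := h) (e m)
        gcongr
      have h3 : 0 ≤ (zm + b) * y := by positivity
      linarith
    · have hdt' : δ₀ / 2 ≤ dt := by linarith
      have hΦnorm : ∀ n ≤ Nt, normM h (φh n) ≤ y + L * b := by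
        intro n hn
        have h1 := normM_add_le (h := h) (e n) (Φ (n * dt))
        have h2 : normM h (Φ (n * dt)) ≤ L * b :=
          normM_le_of_abs_le hL.le hΦ.mesh hb (hΦ.bound _ (htime n hn))
        simp only [he, sub_add_cancel] at h1
        linarith [hnorm n hn]
      have hm₀ : m ≤ n₀ := by
        have h1 : (m : ℝ) ≤ T / (δ₀ / 2) := by
          rw [le_div_iff₀ (half_pos hδ₀)]
          exact (mul_le_mul_of_nonneg_left hdt' (Nat.cast_nonneg m)).trans (htime m hm).2
        exact_mod_cast h1.trans (Nat.le_ceil _)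
      have h1 := hz m N Nt h dt _ φh μh Rh hΦ.mesh hdt' hsch (hΦ.lap 0 ⟨le_rfl, hT.le⟩) hE hΦnorm hm
      have h2 : z m ≤ zm :=
        Finset.single_le_sum (fun n _ => hz0 n) (Finset.mem_range.2 (by omega))
      have h3 : normM h (lapH h (e m)) ≤ zm + b := by
        have := normM_sub_le (h := h) (lapH h (φh m)) (lapH h (Φ (m * dt)))
        simp only [he]
        rw [lapH_sub]
        linarith [hΦ.lap _ (htime m hm)]
      have h4 := (gradSqTM_le_lapH hh.ne' (e m)).trans
        (mul_le_mul h3 (hnorm m hm) (normM_nonneg _) (by positivity))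
      have h5 : 0 ≤ 8 / (δ₀ / 2) * y ^ 2 := by positivity
      linarith
  exact add_le_add (add_le_add (add_le_add (hA m hm) hG) hY) hR

end

end PSSAV

end

theorem mainTheorem1
    (L T ε M C₀ : ℝ) (hL : 0 < L) (hT : 0 < T) (hε : 0 < ε) (hM : 0 < M)
    (F : ℝ → ℝ) (hF : ContDiff ℝ 2 F)
    (φ : ℝ → ℝ × ℝ → ℝ)
    (hsol : PSSAV.IsAllenCahnSolution L T ε M F φ)
    (hreg₁ : PSSAV.MemBochnerSobolev L T 2 0 2 φ)
    (hreg₂ : PSSAV.MemBochnerSobolev L T 1 2 2 φ)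
    (hreg₃ : PSSAV.MemBochnerSobolev L T 0 4 ⊤ φ)
    (hpos : ∀ t ∈ Set.Icc 0 T, 0 < PSSAV.energy L ε F (φ t) + C₀)
    (s K₁ : ℝ) (hK₁ : 0 < K₁)
    (hs : (PSSAV.energy L ε F (φ 0) + C₀) / (2 * K₁) ≤ s) :
    ∃ C : ℝ, 0 < C ∧
      ∀ (Nxy : ℕ) [NeZero Nxy] (Nt : ℕ), 0 < Nt →
      ∀ h dt : ℝ, h = L / Nxy → dt = T / Nt →
      ∀ (φh μh : ℕ → PSSAV.Grid Nxy) (Rh : ℕ → ℝ),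
        PSSAV.IsPSSAVSolution h dt Nt ε M s C₀ F
          (PSSAV.sample L Nxy (φ 0)) (PSSAV.energy L ε F (φ 0) + C₀) φh μh Rh →
        (∀ n < Nt, K₁ ≤ PSSAV.energyH h ε F (φh n) + C₀) →
        ∀ k < Nt,
          (∑ n ∈ Finset.Icc 1 k, dt * PSSAV.normSqM h (PSSAV.dtErrPhi L dt φ φh n)) +
              PSSAV.gradSqTM h (PSSAV.errPhi L dt φ φh (k + 1)) +
              PSSAV.normSqM h (PSSAV.errPhi L dt φ φh (k + 1)) +
              |PSSAV.errR L dt ε C₀ F φ Rh (k + 1)| ^ 2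
            ≤ C * (h ^ 4 + dt ^ 2) := by
  have hR0 := hpos 0 ⟨le_rfl, hT.le⟩
  obtain ⟨b, hb, hcons⟩ := PSSAV.exists_consistent hL hT hM hF hsol hreg₂ hreg₃ s C₀
  obtain ⟨ρ, hρ, hρle⟩ := PSSAV.exists_pos_le hT hM hb
    (fun N _ => hcons N (L / N) rfl) hpos
  obtain ⟨k₁, hk₁⟩ := PSSAV.exists_localBound hF (b + 1)
  obtain ⟨k₂, hk₂⟩ := PSSAV.exists_localBound hF b
  obtain ⟨C₁, δ₀, hC₁, hδ₀, hfine⟩ :=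
    PSSAV.exists_error_bound (C₀ := C₀) hL hT hε hM hK₁ hb hR0 hρ hs hk₁
  obtain ⟨C₂, hC₂, hcoarse⟩ :=
    PSSAV.exists_coarse_bound (C₀ := C₀) hF hL hT hε hM hK₁ hb hR0 hs hk₂ hδ₀
  -- One factor `2` comes from splitting the scalar error, the other from `δ ^ 2 ≤ 2 * (h ^ 4 + dt ^
  -- 2)`. For coarse discretisations the bound `C₂` is at most `C₂ / δ₀ ^ 2 * δ ^ 2`.
  refine ⟨4 * (C₁ + C₂ / δ₀ ^ 2 + b ^ 2) + 1, by positivity, ?_⟩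
  intro Nxy _ Nt hNt h dt hN hdt φh μh Rh hsch hE k hk
  have hNt0 : (0 : ℝ) < Nt := Nat.cast_pos.mpr hNt
  have hdt0 : 0 < dt := by rw [hdt]; positivity
  have hNT : Nt * dt = T := by rw [hdt]; field_simp
  have hΦ := hcons Nxy h hN
  set δ := h ^ 2 + dt with hδ
  have hδ0 : 0 < δ := by positivity
  set r := Rh (k + 1) - (PSSAV.energyH h ε F (PSSAV.sample L Nxy (φ ((k + 1 : ℕ) * dt))) + C₀) with hr
  have key : (∑ l ∈ Finset.range (k + 1), dt * PSSAV.normSqM h (PSSAV.dtErrPhi L dt φ φh l)) +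
      PSSAV.gradSqTM h (PSSAV.errPhi L dt φ φh (k + 1)) +
      PSSAV.normSqM h (PSSAV.errPhi L dt φ φh (k + 1)) + r ^ 2 ≤ (C₁ + C₂ / δ₀ ^ 2) * δ ^ 2 := by
    have e : ∀ l, PSSAV.dtErrPhi L dt φ φh l = (1 / dt) •
        ((φh (l + 1) - PSSAV.sample L Nxy (φ ((l + 1 : ℕ) * dt))) -
          (φh l - PSSAV.sample L Nxy (φ (l * dt)))) := by
      intro l
      ext i j
      simp only [PSSAV.dtErrPhi, PSSAV.errPhi, Pi.sub_apply, Pi.smul_apply, smul_eq_mul]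
      ring
    simp only [e]
    rcases le_total δ δ₀ with hle | hle
    · refine (hfine Nxy Nt h dt _ _ φh μh Rh hΦ hdt0 hNT.le hρle hsch rfl hE hle (k + 1) hk).trans ?_
      have : 0 ≤ C₂ / δ₀ ^ 2 * δ ^ 2 := by positivity
      linarith
    · refine (hcoarse Nxy Nt h dt _ _ φh μh Rh hΦ hdt0 hNT.le hsch hE hle (k + 1) hk).trans ?_
      have h1 : C₂ ≤ C₂ / δ₀ ^ 2 * δ ^ 2 := by
        have h2 : C₂ / δ₀ ^ 2 * δ₀ ^ 2 ≤ C₂ / δ₀ ^ 2 * δ ^ 2 := by gcongr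
        rwa [div_mul_cancel₀ _ (by positivity)] at h2
      have : 0 ≤ C₁ * δ ^ 2 := by positivity
      linarith
  -- The range up to `k + 1` also contains the nonnegative term of index `0`, which the claimed sum
  -- omits.
  have hsum : ∑ n ∈ Finset.Icc 1 k, dt * PSSAV.normSqM h (PSSAV.dtErrPhi L dt φ φh n) ≤
      ∑ l ∈ Finset.range (k + 1), dt * PSSAV.normSqM h (PSSAV.dtErrPhi L dt φ φh l) := by
    refine Finset.sum_le_sum_of_subset_of_nonneg (fun n hn => ?_) fun l _ _ =>
      mul_nonneg hdt0.le (PSSAV.normSqM_nonneg _)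
    have := Finset.mem_Icc.1 hn
    exact Finset.mem_range.2 (by omega)
  -- The exact energy replaces the discrete energy of the sampled solution only here, at a single
  -- time, where the quadrature error `O(h²)` is harmless.
  have hrR : |PSSAV.errR L dt ε C₀ F φ Rh (k + 1)| ^ 2 ≤ 2 * r ^ 2 + 2 * (b ^ 2 * δ ^ 2) := by
    have ht : ((k + 1 : ℕ) : ℝ) * dt ∈ Set.Icc 0 T :=
      ⟨by positivity, by rw [← hNT]; exact mul_le_mul_of_nonneg_right (Nat.cast_le.2 hk) hdt0.le⟩
    set q := PSSAV.energyH h ε F (PSSAV.sample L Nxy (φ ((k + 1 : ℕ) * dt))) + C₀ -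
      (PSSAV.energy L ε F (φ ((k + 1 : ℕ) * dt)) + C₀) with hq
    have h1 : |q| ≤ b * δ := (hΦ.energy _ ht).trans
      (mul_le_mul_of_nonneg_left (by linarith) hb)
    have h2 : q ^ 2 ≤ (b * δ) ^ 2 := by rw [← sq_abs q]; gcongr
    have h3 : PSSAV.errR L dt ε C₀ F φ Rh (k + 1) = r + q := by
      simp only [PSSAV.errR, hr, hq]; ring
    rw [h3, sq_abs]
    linarith [sq_nonneg (r - q)]
  have hδsq : δ ^ 2 ≤ 2 * (h ^ 4 + dt ^ 2) := by
    have := sq_nonneg (h ^ 2 - dt)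
    rw [hδ]; linarith
  have hs0 := PSSAV.gradSqTM_nonneg (h := h) (PSSAV.errPhi L dt φ φh (k + 1))
  have hs1 := PSSAV.normSqM_nonneg (h := h) (PSSAV.errPhi L dt φ φh (k + 1))
  have hs2 : 0 ≤ ∑ l ∈ Finset.range (k + 1), dt * PSSAV.normSqM h (PSSAV.dtErrPhi L dt φ φh l) :=
    Finset.sum_nonneg fun l _ => mul_nonneg hdt0.le (PSSAV.normSqM_nonneg _)
  have hfin := mul_le_mul_of_nonneg_left hδsq (by positivity : 0 ≤ 2 * (C₁ + C₂ / δ₀ ^ 2 + b ^ 2))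
  have hx : 0 ≤ h ^ 4 + dt ^ 2 := by positivity
  linarith
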